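/- Let $\Omega=(a,b)$ with $a<b$, let $\beta\in\mathbb{R}$, $\sigma\ge 1/2$, $0<T<\infty$, and write $H^m_{\rm per}(\Omega)=\{\phi\in H^m(\Omega):\phi^{(k)}(a)=\phi^{(k)}(b),\ k=0,\dots,m-1\}$. Let $V\in H^2_{\rm per}(\Omega)$ be real-valued, put $B(v)=Vv+\beta|v|^{2\sigma}v$, and let $$\psi\in C([0,T];H^4_{\rm per}(\Omega))\cap C^1([0,T];H^2(\Omega))\cap C^2([0,T];L^2(\Omega))$$ be a solution of the nonlinear Schrödinger equation $i\partial_t\psi=-\Delta\psi+B(\psi)$ on $\Omega$ with periodic boundary conditions and $\psi(\cdot,0)=\psi_0$. For a positive even integer $N$ put $h=(b-a)/N$, $\mathcal{T}_N=\{-N/2,\dots,N/2-1\}$, $\mu_l=2\pi l/(b-a)$ and $\widehat u_l=\frac1{b-a}\int_a^b u(x)e^{-i\mu_l(x-a)}\,dx$. Let $\varphi_{\rm s}(\theta)=\sin(\theta)/\theta$ and $\varphi_1(z)=(e^z-1)/z$, with $\varphi_{\rm s}(0)=\varphi_1(0)=1$. For a time step $\tau>0$ put $t_n=n\tau$, and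 let $\psi_h^n=\sum_{l\in\mathcal{T}_N}\widehat{(\psi_h^n)}_l\,e^{i\mu_l(x-a)}$, $n\ge0$, be defined by the sEWI Fourier spectral scheme: for $l\in\mathcal{T}_N$, $$\widehat{(\psi_h^{n+1})}_l=e^{-2i\tau\mu_l^2}\widehat{(\psi_h^{n-1})}_l-2i\tau e^{-i\tau\mu_l^2}\varphi_{\rm s}(\tau\mu_l^2)\widehat{(B(\psi_h^n))}_l\quad(n\ge1),$$ $$\widehat{(\psi_h^1)}_l=e^{-i\tau\mu_l^2}\widehat{(\psi_h^0)}_l-i\tau\varphi_1(-i\tau\mu_l^2)\widehat{(B(\psi_h^0))}_l,\qquad \widehat{(\psi_h^0)}_l=\widehat{(\psi_0)}_l.$$ Then there exist $\tau_0>0$, $h_0>0$ and $C>0$, independent of $\tau$, $h$ and $n$, such that whenever $0<\tau<\tau_0$, $0<h<h_0$ and $\tau\le\frac{h^2}{2\pi}$, $$\|\psi(\cdot,t_n)-\psi_h^n\|_{L^2}\le C(\tau^2+h^4),\qquad \|\psi(\cdot,t_n)-\psi_h^n\|_{H^1}\le C(\tau^{3/2}+h^3),\qquad 0\le n\le T/\tau.$$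 -/

import Mathlib

open MeasureTheory Set

noncomputable section

namespace SEWI

/-! ### Function spaces on the interval `Ω = (a, b)` -/

/-- `L²(Ω)`, complex valued, for `Ω = (a, b)`. -/
abbrev L2 (a b : ℝ) : Type := Lp ℂ 2 (volume.restrict (Ioo a b))

/-- `v` is the weak derivative of `u` on `(a, b)`: `∫ φ' u = - ∫ φ v` for every test function
`φ ∈ C_c^∞(a, b)`. -/
def IsWeakDeriv (a b : ℝ) (u v : L2 a b) : Prop :=
  ∀ φ : ℝ → ℝ, ContDiff ℝ ((⊤ : ℕ∞) : WithTop ℕ∞) φ → HasCompactSupport φ →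
    tsupport φ ⊆ Ioo a b →
      ∫ x in Ioo a b, ((deriv φ x : ℝ) : ℂ) * u x = -∫ x in Ioo a b, (φ x : ℂ) * v x

/-- The continuous representative of `u` on `[a, b]` takes the same value at `a` and at `b`. -/
def HasEqualEndpoints (a b : ℝ) (u : L2 a b) : Prop :=
  ∃ w : ℝ → ℂ, ContinuousOn w (Icc a b) ∧ (∀ᵐ x ∂(volume.restrict (Ioo a b)), u x = w x) ∧
    w a = w b

/-- The Hilbert space of `(m+1)`-tuples in `L²(Ω)`, with norm `(∑ₖ ‖uₖ‖²)^(1/2)`. -/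
abbrev Jet (a b : ℝ) (m : ℕ) : Type := PiLp 2 (fun _ : Fin (m + 1) => L2 a b)

lemma integrable_mul_L2 {a b : ℝ} {g : ℝ → ℝ} (hg : Continuous g) (hc : HasCompactSupport g)
    (u : L2 a b) : Integrable (fun x => (g x : ℂ) * u x) (volume.restrict (Ioo a b)) := by
  have hu : Integrable u (volume.restrict (Ioo a b)) := (Lp.memLp u).integrable (by norm_num)
  obtain ⟨C, hC⟩ := hc.exists_bound_of_continuous hg
  exact hu.bdd_mul (c := C) (Complex.continuous_ofReal.comp hg).aestronglyMeasurable
    (Filter.Eventually.of_forall fun x => by simpa using hC x)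

lemma integrable_test {a b : ℝ} {φ : ℝ → ℝ} (hφ : ContDiff ℝ ((⊤ : ℕ∞) : WithTop ℕ∞) φ)
    (hc : HasCompactSupport φ) (u : L2 a b) :
    Integrable (fun x => (φ x : ℂ) * u x) (volume.restrict (Ioo a b)) ∧
    Integrable (fun x => ((deriv φ x : ℝ) : ℂ) * u x) (volume.restrict (Ioo a b)) :=
  ⟨integrable_mul_L2 hφ.continuous hc u,
    integrable_mul_L2 (hφ.continuous_deriv (by simp)) hc.deriv u⟩

lemma integral_mul_add {a b : ℝ} {g : ℝ → ℝ} {u u' : L2 a b}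
    (h : Integrable (fun x => (g x : ℂ) * u x) (volume.restrict (Ioo a b)))
    (h' : Integrable (fun x => (g x : ℂ) * u' x) (volume.restrict (Ioo a b))) :
    ∫ x in Ioo a b, (g x : ℂ) * (u + u' : L2 a b) x =
      (∫ x in Ioo a b, (g x : ℂ) * u x) + ∫ x in Ioo a b, (g x : ℂ) * u' x := by
  rw [← integral_add h h']
  refine integral_congr_ae ?_
  filter_upwards [Lp.coeFn_add u u'] with x hx
  rw [hx, Pi.add_apply, mul_add]

lemma integral_mul_smul {a b : ℝ} {g : ℝ → ℝ} (c : ℂ) (u : L2 a b) :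
    ∫ x in Ioo a b, (g x : ℂ) * (c • u : L2 a b) x = c * ∫ x in Ioo a b, (g x : ℂ) * u x := by
  rw [← integral_const_mul]
  refine integral_congr_ae ?_
  filter_upwards [Lp.coeFn_smul c u] with x hx
  rw [hx, Pi.smul_apply, smul_eq_mul]
  ring

lemma IsWeakDeriv.add {a b : ℝ} {u v u' v' : L2 a b} (h : IsWeakDeriv a b u v)
    (h' : IsWeakDeriv a b u' v') : IsWeakDeriv a b (u + u') (v + v') := by
  intro φ hφ hc hs
  rw [integral_mul_add (integrable_test hφ hc u).2 (integrable_test hφ hc u').2,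
    integral_mul_add (integrable_test hφ hc v).1 (integrable_test hφ hc v').1,
    h φ hφ hc hs, h' φ hφ hc hs]
  ring

lemma IsWeakDeriv.smul {a b : ℝ} {u v : L2 a b} (c : ℂ) (h : IsWeakDeriv a b u v) :
    IsWeakDeriv a b (c • u) (c • v) := by
  intro φ hφ hc hs
  rw [integral_mul_smul, integral_mul_smul, h φ hφ hc hs]
  ring

lemma IsWeakDeriv.zero (a b : ℝ) : IsWeakDeriv a b 0 0 := by
  have := fun (φ : ℝ → ℝ) => integral_mul_smul (g := φ) (0 : ℂ) (0 : L2 a b)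
  intro φ _ _ _
  have h1 := this φ
  have h2 := this (deriv φ)
  rw [zero_smul, zero_mul] at h1 h2
  rw [h1, h2, neg_zero]

lemma HasEqualEndpoints.add {a b : ℝ} {u u' : L2 a b} (h : HasEqualEndpoints a b u)
    (h' : HasEqualEndpoints a b u') : HasEqualEndpoints a b (u + u') := by
  obtain ⟨w, hw, hu, he⟩ := h
  obtain ⟨w', hw', hu', he'⟩ := h'
  refine ⟨fun x => w x + w' x, hw.add hw', ?_, by simp only [he, he']⟩
  filter_upwards [Lp.coeFn_add u u', hu, hu'] with x hx h1 h2
  rw [hx, Pi.add_apply, h1, h2]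

lemma HasEqualEndpoints.smul {a b : ℝ} {u : L2 a b} (c : ℂ) (h : HasEqualEndpoints a b u) :
    HasEqualEndpoints a b (c • u) := by
  obtain ⟨w, hw, hu, he⟩ := h
  refine ⟨fun x => c * w x, continuousOn_const.mul hw, ?_, by simp only [he]⟩
  filter_upwards [Lp.coeFn_smul c u, hu] with x hx h1
  rw [hx, Pi.smul_apply, h1, smul_eq_mul]

lemma HasEqualEndpoints.zero (a b : ℝ) : HasEqualEndpoints a b 0 :=
  ⟨fun _ => 0, continuousOn_const, Lp.coeFn_zero _ _ _, rfl⟩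

/-- The Sobolev space `H^m(Ω)`: a function `u` is represented by the tuple `(u, u', …, u^(m))` of
its weak derivatives, all in `L²(Ω)`. The induced norm is the standard one,
`‖u‖_{H^m} = (∑_{k ≤ m} ‖u^(k)‖²_{L²})^(1/2)`. -/
def Sobolev (a b : ℝ) (m : ℕ) : Submodule ℂ (Jet a b m) where
  carrier := {u | ∀ k : Fin m, IsWeakDeriv a b (u k.castSucc) (u k.succ)}
  add_mem' hu hv k := (hu k).add (hv k)
  zero_mem' _ := IsWeakDeriv.zero a b
  smul_mem' c _ hu k := (hu k).smul c

/-- The periodic Sobolev space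
`H^m_per(Ω) = {u ∈ H^m(Ω) : u^(k)(a) = u^(k)(b), k = 0, …, m-1}`. -/
def SobolevPer (a b : ℝ) (m : ℕ) : Submodule ℂ (Jet a b m) where
  carrier := {u | u ∈ Sobolev a b m ∧ ∀ k : Fin m, HasEqualEndpoints a b (u k.castSucc)}
  add_mem' hu hv := ⟨add_mem hu.1 hv.1, fun k => (hu.2 k).add (hv.2 k)⟩
  zero_mem' := ⟨zero_mem _, fun _ => HasEqualEndpoints.zero a b⟩
  smul_mem' c _ hu := ⟨Submodule.smul_mem _ c hu.1, fun k => (hu.2 k).smul c⟩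

/-- `ψ ∈ C^k([0, T]; S)` for a space `S` of Sobolev functions (`S = H^m` or `S = H^m_per`), with
one-sided derivatives at the end points of `[0, T]`. -/
def MemCk {a b : ℝ} {m : ℕ} (k : ℕ) (T : ℝ) (S : Submodule ℂ (Jet a b m)) (ψ : ℝ → L2 a b) :
    Prop :=
  ∃ Ψ : ℝ → S, ContDiffOn ℝ k Ψ (Icc 0 T) ∧ ∀ t ∈ Icc (0 : ℝ) T, (Ψ t : Jet a b m) 0 = ψ t

/-- `‖u‖_{H^m(Ω)} ≤ r`, including the assertion `u ∈ H^m(Ω)`. -/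
def SobolevNormLE {a b : ℝ} (m : ℕ) (u : L2 a b) (r : ℝ) : Prop :=
  ∃ e : Sobolev a b m, (e : Jet a b m) 0 = u ∧ ‖e‖ ≤ r

/-! ### The nonlinear Schrödinger equation -/

/-- `B(v) = V v + f(|v|²) v` with `f(ρ) = β ρ^σ`. -/
def opB (V : ℝ → ℝ) (β σ : ℝ) (v : ℝ → ℂ) (x : ℝ) : ℂ :=
  (V x : ℂ) * v x + ((β * (‖v x‖ ^ 2) ^ σ : ℝ) : ℂ) * v x

/-- `i ∂ₜψ = -Δψ + V ψ + f(|ψ|²) ψ` in `L²(Ω)` for `0 < t < T`; here `w = (ψ, ∂ₓψ, ∂ₓₓψ)`. -/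
def SolvesNLS (a b : ℝ) (V : ℝ → ℝ) (β σ T : ℝ) (ψ : ℝ → L2 a b) : Prop :=
  ∀ t ∈ Ioo 0 T, ∃ w ∈ SobolevPer a b 2, w 0 = ψ t ∧
    ∀ᵐ x ∂(volume.restrict (Ioo a b)),
      Complex.I * (deriv ψ t : L2 a b) x = -(w 2 : L2 a b) x + opB V β σ (ψ t) x

/-! ### The symmetric exponential wave integrator Fourier spectral method -/

/-- `μ_l = 2πl/(b-a)`. -/
def freq (a b : ℝ) (l : ℤ) : ℝ := 2 * Real.pi * l / (b - a)

/-- `û_l = (b-a)⁻¹ ∫ₐᵇ u(x) e^{-iμ_l(x-a)} dx`. -/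
def fourierHat (a b : ℝ) (u : ℝ → ℂ) (l : ℤ) : ℂ :=
  1 / ((b : ℂ) - a) *
    ∫ x in Ioo a b, u x * Complex.exp (-Complex.I * (freq a b l : ℂ) * ((x : ℂ) - a))

/-- `T_N = {-N/2, …, N/2 - 1}` (used for even `N`). -/
def indexSet (N : ℕ) : Finset ℤ := Finset.Ico (-((N : ℤ) / 2)) ((N : ℤ) / 2)

/-- The function `∑_{l ∈ T_N} c_l e^{iμ_l(x-a)}`. -/
def trigPoly (a b : ℝ) (N : ℕ) (c : ℤ → ℂ) (x : ℝ) : ℂ :=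
  ∑ l ∈ indexSet N, c l * Complex.exp (Complex.I * (freq a b l : ℂ) * ((x : ℂ) - a))

/-- The entire function `φ₁(z) = (e^z - 1)/z`. -/
def phi1 (z : ℂ) : ℂ := if z = 0 then 1 else (Complex.exp z - 1) / z

/-- The Fourier coefficients `(ψ_h^n)^_l`, `l ∈ T_N`, of the numerical solution with `N` modes, time
step `τ` and initial datum `ψ₀`. Only the values at `l ∈ T_N` enter `ψ_h^n`. -/
def schemeCoeff (a b : ℝ) (V : ℝ → ℝ) (β σ : ℝ) (ψ₀ : ℝ → ℂ) (N : ℕ) (τ : ℝ) : ℕ → ℤ → ℂ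
  | 0 => fun l => fourierHat a b ψ₀ l
  | 1 => fun l =>
      Complex.exp (-Complex.I * τ * (freq a b l : ℂ) ^ 2) * fourierHat a b ψ₀ l
        - Complex.I * τ * phi1 (-Complex.I * τ * (freq a b l : ℂ) ^ 2) *
          fourierHat a b (opB V β σ (trigPoly a b N (fourierHat a b ψ₀))) l
  | n + 2 => fun l =>
      Complex.exp (-2 * Complex.I * τ * (freq a b l : ℂ) ^ 2) *
          schemeCoeff a b V β σ ψ₀ N τ n l
        - 2 * Complex.I * τ * Complex.exp (-Complex.I * τ * (freq a b l : ℂ) ^ 2) *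
          (Real.sinc (τ * freq a b l ^ 2) : ℂ) *
          fourierHat a b
            (opB V β σ (trigPoly a b N (schemeCoeff a b V β σ ψ₀ N τ (n + 1)))) l

lemma memLp_trigPoly (a b : ℝ) (N : ℕ) (c : ℤ → ℂ) :
    MemLp (trigPoly a b N c) 2 (volume.restrict (Ioo a b)) := by
  have hcont : Continuous (trigPoly a b N c) := by
    unfold trigPoly
    fun_prop
  obtain ⟨C, hC⟩ := (isCompact_Icc (a := a) (b := b)).exists_bound_of_continuousOn
    hcont.continuousOn
  refine MemLp.of_bound hcont.aestronglyMeasurable C ?_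
  filter_upwards [ae_restrict_mem measurableSet_Ioo] with x hx
  exact hC x (Ioo_subset_Icc_self hx)

/-- The numerical solution `ψ_h^n ∈ X_N`, as an element of `L²(Ω)`. -/
def schemeSol (a b : ℝ) (V : ℝ → ℝ) (β σ : ℝ) (ψ₀ : ℝ → ℂ) (N : ℕ) (τ : ℝ) (n : ℕ) : L2 a b :=
  (memLp_trigPoly a b N (schemeCoeff a b V β σ ψ₀ N τ n)).toLp _

end SEWI

end

noncomputable section

namespace SEWI

/-! On the resolved modes put κ = μ_l² and let p, g be the Fourier coefficients of ψ and B(ψ), so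
that p' = -iκp - ig. The scheme freezes g at the midpoint in the exact variation-of-constants
formula over two steps (`duhamel_symmetric`). The defect has two parts. The even part integrates
cos(sκ) against g(t+s) - 2g(t) + g(t-s) and is O(τ³). The odd part integrates sin(sκ) against g(t+s)
- g(t-s); it is only O(τ²), and summing it naively would lose an order.

The remedy is the step restriction, which says τκ ≤ π/2. Then 0 ≤ sin(sκ) ≤ sin(τκ) for 0 ≤ s ≤ τ,
so the odd part can be divided by 2i sin(τκ) without loss. Since 1 - e^{-2iτκ} = 2i sin(τκ)
e^{-iτκ}, the odd part equals (1 - e^{-2iτκ})Q(t), where Q is the `corrector`, of size O(τ²). Errors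
propagate over two steps by e^{-2iτκ}; hence subtracting Q from the error removes the odd part up to
one-step increments of Q, and these are mixed second differences of g, thus O(τ³)
(`norm_corrector_sub_le`). The corrected error therefore obeys a recursion with an O(τ³) source
(`exists_error_recursion`).

The time regularity of g enters only through first and mixed second differences. As σ ≥ 1/2, the map
z ↦ |z|^{2σ}z is C^{1,1} on bounded sets (`norm_powNL_second_difference_le`), which suffices because
ψ is C² into L² and Lipschitz into L^∞.

In space, `IsWeakDeriv.fourierHat_eq` turns H⁴_per into the weight μ_l⁸ on squared coefficients, so
the unresolved modes cost h⁴ in L² and h³ in H¹. The Lipschitz bound for B needs a sup bound for the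
numerical solution. It comes from the ℓ¹ norm of the coefficients, where an ℓ² error e costs at most
√N e, small because τ ≤ h². The apparent circularity is closed by induction in `two_step_gronwall`.
The H¹ bound follows from the factor π/h on resolved modes and τ² ≤ τ^{3/2}h. -/

/-! ### Fourier coefficients on the interval and Parseval's identity. -/

lemma fourierHat_congr_ae {a b : ℝ} {u v : ℝ → ℂ}
    (h : ∀ᵐ x ∂(volume.restrict (Ioo a b)), u x = v x) (l : ℤ) :
    fourierHat a b u l = fourierHat a b v l := by
  unfold fourierHat
  congr 1
  refine integral_congr_ae ?_
  filter_upwards [h] with x hx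
  rw [hx]

/-- The two coefficients differ by the phase e^{iμ_l a}, because `fourierHat` places the origin at
a. Moduli are all that Parseval's identity needs. -/
lemma norm_fourierHat {a b : ℝ} (hab : a < b) (u : ℝ → ℂ) (l : ℤ) :
    ‖fourierHat a b u l‖ = ‖fourierCoeffOn hab u l‖ := by
  have key : fourierHat a b u l =
      Complex.exp (Complex.I * (freq a b l : ℂ) * a) * fourierCoeffOn hab u l := by
    rw [fourierCoeffOn_eq_integral, intervalIntegral.integral_of_le hab.le,
      integral_Ioc_eq_integral_Ioo, fourierHat, Complex.real_smul, mul_left_comm]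
    push_cast
    congr 1
    rw [← integral_const_mul]
    refine integral_congr_ae (Filter.Eventually.of_forall fun x => ?_)
    simp only [smul_eq_mul, fourier_coe_apply]
    rw [mul_comm (u x), ← mul_assoc, ← Complex.exp_add]
    congr 2
    unfold freq
    push_cast
    ring
  rw [key, norm_mul]
  have : Complex.I * (freq a b l : ℂ) * a = ((freq a b l * a : ℝ) : ℂ) * Complex.I := by
    push_cast; ring
  rw [this, Complex.norm_exp_ofReal_mul_I, one_mul]

lemma norm_sq_eq_integral {a b : ℝ} (u : L2 a b) :
    ‖u‖ ^ 2 = ∫ x in Ioo a b, ‖u x‖ ^ 2 := by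
  have h := congr_arg RCLike.re (L2.inner_def (𝕜 := ℂ) u u)
  rw [← integral_re (L2.integrable_inner u u)] at h
  rw [norm_sq_eq_re_inner (𝕜 := ℂ) u, h]
  refine integral_congr_ae (Filter.Eventually.of_forall fun x => ?_)
  exact (norm_sq_eq_re_inner (𝕜 := ℂ) (u x)).symm

/-- Parseval's identity on `(a, b)`. -/
lemma hasSum_sq_fourierHat {a b : ℝ} (hab : a < b) (u : L2 a b) :
    HasSum (fun l => ‖fourierHat a b u l‖ ^ 2) (‖u‖ ^ 2 / (b - a)) := by
  have hm : MemLp u 2 (volume.restrict (Ioc a b)) := by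
    rw [← restrict_Ioo_eq_restrict_Ioc]
    exact Lp.memLp u
  have := hasSum_sq_fourierCoeffOn hab hm
  simp only [← norm_fourierHat hab] at this
  rw [intervalIntegral.integral_of_le hab.le, integral_Ioc_eq_integral_Ioo,
    ← norm_sq_eq_integral, smul_eq_mul, inv_mul_eq_div] at this
  exact this

lemma norm_fourierExp (a b : ℝ) (l : ℤ) (x : ℝ) :
    ‖Complex.exp (Complex.I * (freq a b l : ℂ) * ((x : ℂ) - a))‖ = 1 := by
  have : Complex.I * (freq a b l : ℂ) * ((x : ℂ) - a)
      = ((freq a b l * (x - a) : ℝ) : ℂ) * Complex.I := by push_cast; ring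
  rw [this, Complex.norm_exp_ofReal_mul_I]

lemma norm_fourierExp_neg (a b : ℝ) (l : ℤ) (x : ℝ) :
    ‖Complex.exp (-Complex.I * (freq a b l : ℂ) * ((x : ℂ) - a))‖ = 1 := by
  have : -Complex.I * (freq a b l : ℂ) * ((x : ℂ) - a)
      = ((-freq a b l * (x - a) : ℝ) : ℂ) * Complex.I := by push_cast; ring
  rw [this, Complex.norm_exp_ofReal_mul_I]

lemma integrable_mul_fourierExp {a b : ℝ} {u : ℝ → ℂ}
    (hu : Integrable u (volume.restrict (Ioo a b))) (l : ℤ) :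
    Integrable (fun x : ℝ => u x * Complex.exp (-Complex.I * (freq a b l : ℂ) * ((x : ℂ) - a)))
      (volume.restrict (Ioo a b)) := by
  refine hu.mul_bdd (c := 1) (Continuous.aestronglyMeasurable (by fun_prop)) ?_
  exact Filter.Eventually.of_forall fun x => (norm_fourierExp_neg a b l x).le

/-- The `l`-th Fourier coefficient as a continuous linear functional on `L²(a, b)`. -/
def fourierCLM {a b : ℝ} (hab : a < b) (l : ℤ) : L2 a b →L[ℂ] ℂ :=
  LinearMap.mkContinuous
    { toFun := fun u => fourierHat a b u l
      map_add' := fun u v => by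
        have hu : Integrable u (volume.restrict (Ioo a b)) := (Lp.memLp u).integrable (by norm_num)
        have hv : Integrable v (volume.restrict (Ioo a b)) := (Lp.memLp v).integrable (by norm_num)
        rw [fourierHat_congr_ae (Lp.coeFn_add u v)]
        simp only [fourierHat, Pi.add_apply, add_mul]
        rw [integral_add (integrable_mul_fourierExp hu l) (integrable_mul_fourierExp hv l), mul_add]
      map_smul' := fun c u => by
        rw [fourierHat_congr_ae (Lp.coeFn_smul c u)]
        simp only [fourierHat, Pi.smul_apply, smul_eq_mul, RingHom.id_apply, mul_assoc]
        rw [integral_const_mul]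
        ring }
    (Real.sqrt (1 / (b - a))) (fun u => by
      have h := le_hasSum (hasSum_sq_fourierHat hab u) l fun _ _ => sq_nonneg _
      refine le_trans (Real.le_sqrt_of_sq_le h) ?_
      rw [div_eq_mul_one_div, mul_comm, Real.sqrt_mul (by have := sub_pos.2 hab; positivity),
        Real.sqrt_sq (norm_nonneg _)])

@[simp] lemma fourierCLM_apply {a b : ℝ} (hab : a < b) (l : ℤ) (u : L2 a b) :
    fourierCLM hab l u = fourierHat a b u l := rfl

lemma fourierHat_sub {a b : ℝ} (hab : a < b) (u v : L2 a b) (l : ℤ) :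
    fourierHat a b (u - v : L2 a b) l = fourierHat a b u l - fourierHat a b v l := by
  simpa using map_sub (fourierCLM hab l) u v

lemma integral_fourierExp {a b : ℝ} (hab : a < b) (k : ℤ) :
    ∫ x in Ioo a b, Complex.exp (Complex.I * (freq a b k : ℂ) * ((x : ℂ) - a)) =
      if k = 0 then (b : ℂ) - a else 0 := by
  have hba : ((b : ℂ) - a) ≠ 0 := by
    rw [← Complex.ofReal_sub]; exact_mod_cast (sub_pos.2 hab).ne'
  rw [← integral_Ioc_eq_integral_Ioo, ← intervalIntegral.integral_of_le hab.le]
  split_ifs with hk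
  · simp [hk, freq]
  · have hc : Complex.I * (freq a b k : ℂ) ≠ 0 := by
      have : freq a b k ≠ 0 := by
        unfold freq
        have := (sub_pos.2 hab).ne'
        have hk' : (k : ℝ) ≠ 0 := by exact_mod_cast hk
        have := Real.pi_ne_zero
        positivity
      exact mul_ne_zero Complex.I_ne_zero (by exact_mod_cast this)
    have h1 : (fun x : ℝ => Complex.exp (Complex.I * (freq a b k : ℂ) * ((x : ℂ) - a))) =
        fun x : ℝ => Complex.exp (-(Complex.I * (freq a b k : ℂ) * a)) *
          Complex.exp (Complex.I * (freq a b k : ℂ) * x) := by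
      funext x
      rw [← Complex.exp_add]
      congr 1
      ring
    rw [h1, intervalIntegral.integral_const_mul, integral_exp_mul_complex hc]
    have h2 : Complex.exp (Complex.I * (freq a b k : ℂ) * b) =
        Complex.exp (Complex.I * (freq a b k : ℂ) * a) := by
      rw [Complex.exp_eq_exp_iff_exists_int]
      refine ⟨k, ?_⟩
      unfold freq
      push_cast
      field_simp
      ring
    rw [h2]
    simp

lemma fourierHat_trigPoly {a b : ℝ} (hab : a < b) (N : ℕ) (c : ℤ → ℂ) (l : ℤ) :
    fourierHat a b (trigPoly a b N c) l = if l ∈ indexSet N then c l else 0 := by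
  have hba : ((b : ℂ) - a) ≠ 0 := by
    rw [← Complex.ofReal_sub]; exact_mod_cast (sub_pos.2 hab).ne'
  have h1 : ∀ x : ℝ, trigPoly a b N c x *
      Complex.exp (-Complex.I * (freq a b l : ℂ) * ((x : ℂ) - a)) =
      ∑ k ∈ indexSet N, c k * Complex.exp (Complex.I * (freq a b (k - l) : ℂ) * ((x : ℂ) - a)) := by
    intro x
    rw [trigPoly, Finset.sum_mul]
    refine Finset.sum_congr rfl fun k _ => ?_
    rw [mul_assoc, ← Complex.exp_add]
    congr 2
    unfold freq
    push_cast
    ring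
  have hint : ∀ k ∈ indexSet N, Integrable (fun x : ℝ => c k *
      Complex.exp (Complex.I * (freq a b (k - l) : ℂ) * ((x : ℂ) - a)))
      (volume.restrict (Ioo a b)) := by
    intro k _
    refine IntegrableOn.mono_set (t := Icc a b) ?_ Ioo_subset_Icc_self
    exact Continuous.integrableOn_Icc (by fun_prop)
  rw [fourierHat]
  simp_rw [h1]
  rw [integral_finsetSum _ hint]
  simp_rw [integral_const_mul, integral_fourierExp hab, sub_eq_zero]
  simp only [mul_ite, mul_zero, Finset.sum_ite_eq', one_div]
  split_ifs with h
  · field_simp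
  · rfl

/-- The element of `L²(a, b)` given by a trigonometric polynomial. -/
def trigL2 (a b : ℝ) (N : ℕ) (c : ℤ → ℂ) : L2 a b := (memLp_trigPoly a b N c).toLp _

lemma coeFn_trigL2 (a b : ℝ) (N : ℕ) (c : ℤ → ℂ) :
    ∀ᵐ x ∂(volume.restrict (Ioo a b)), trigL2 a b N c x = trigPoly a b N c x :=
  (memLp_trigPoly a b N c).coeFn_toLp

lemma fourierHat_trigL2 {a b : ℝ} (hab : a < b) (N : ℕ) (c : ℤ → ℂ) (l : ℤ) :
    fourierHat a b (trigL2 a b N c) l = if l ∈ indexSet N then c l else 0 := by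
  rw [fourierHat_congr_ae (coeFn_trigL2 a b N c), fourierHat_trigPoly hab]

lemma norm_trigPoly_le (a b : ℝ) (N : ℕ) (c : ℤ → ℂ) (x : ℝ) :
    ‖trigPoly a b N c x‖ ≤ ∑ l ∈ indexSet N, ‖c l‖ := by
  refine (norm_sum_le _ _).trans (Finset.sum_le_sum fun l _ => ?_)
  rw [norm_mul, norm_fourierExp, mul_one]

/-- Parseval bound for the `L²` distance to a trigonometric polynomial, split into the resolved
modes and the remaining ones. -/
lemma norm_sub_trigL2_sq_le {a b : ℝ} (hab : a < b) (N : ℕ) (u : L2 a b) (c : ℤ → ℂ) {A : ℝ}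
    (hA : ∀ s : Finset ℤ, Disjoint s (indexSet N) → ∑ l ∈ s, ‖fourierHat a b u l‖ ^ 2 ≤ A) :
    ‖u - trigL2 a b N c‖ ^ 2 ≤
      (b - a) * (A + ∑ l ∈ indexSet N, ‖fourierHat a b u l - c l‖ ^ 2) := by
  have hba := sub_pos.2 hab
  have h := hasSum_sq_fourierHat hab (u - trigL2 a b N c)
  rw [← div_le_iff₀' hba]
  refine le_of_tendsto h (Filter.Eventually.of_forall fun s => ?_)
  rw [← Finset.sdiff_union_inter s (indexSet N),
    Finset.sum_union (Finset.disjoint_sdiff_inter _ _)]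
  refine add_le_add ?_ ?_
  · refine le_trans (le_of_eq (Finset.sum_congr rfl fun l hl => ?_))
      (hA (s \ indexSet N) Finset.sdiff_disjoint)
    rw [fourierHat_sub hab, fourierHat_trigL2 hab, if_neg (Finset.mem_sdiff.1 hl).2, sub_zero]
  · refine le_trans (le_of_eq (Finset.sum_congr rfl fun l hl => ?_))
      (Finset.sum_le_sum_of_subset_of_nonneg Finset.inter_subset_right fun _ _ _ => sq_nonneg _)
    rw [fourierHat_sub hab, fourierHat_trigL2 hab, if_pos (Finset.mem_inter.1 hl).2]

lemma sum_sq_fourierHat_le {a b : ℝ} (hab : a < b) (u : L2 a b) (s : Finset ℤ) :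
    ∑ l ∈ s, ‖fourierHat a b u l‖ ^ 2 ≤ ‖u‖ ^ 2 / (b - a) :=
  sum_le_hasSum s (fun _ _ => sq_nonneg _) (hasSum_sq_fourierHat hab u)

/-- The squared distance is at most b - a times the Parseval tail outside the index set. Even orders
2K are used because `indexSet` halves its argument. -/
lemma tendsto_trigL2_fourierHat {a b : ℝ} (hab : a < b) (u : L2 a b) :
    Filter.Tendsto (fun K : ℕ => trigL2 a b (2 * K) (fourierHat a b u)) Filter.atTop (nhds u) := by
  have hba := sub_pos.2 hab
  have hS := hasSum_sq_fourierHat hab u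
  have hmono : Filter.Tendsto (fun K : ℕ => indexSet (2 * K)) Filter.atTop Filter.atTop := by
    refine Filter.tendsto_atTop_finset_of_monotone ?_ ?_
    · intro m n hmn
      refine Finset.Ico_subset_Ico ?_ ?_ <;> push_cast <;> omega
    · intro l
      refine ⟨l.natAbs + 1, ?_⟩
      have h1 := Int.natCast_natAbs l
      have h2 := abs_le.1 (le_refl |l|)
      simp only [indexSet, Finset.mem_Ico]
      push_cast
      omega
  have ht := hS.comp hmono
  rw [tendsto_iff_norm_sub_tendsto_zero]
  have hsq : Filter.Tendsto (fun K : ℕ => Real.sqrt ((b - a) * (‖u‖ ^ 2 / (b - a) -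
      ∑ l ∈ indexSet (2 * K), ‖fourierHat a b u l‖ ^ 2))) Filter.atTop (nhds 0) := by
    have := ((tendsto_const_nhds (x := ‖u‖ ^ 2 / (b - a))).sub ht).const_mul (b - a)
    rw [sub_self, mul_zero] at this
    have h2 := (Real.continuous_sqrt.tendsto 0).comp this
    rw [Real.sqrt_zero] at h2
    exact h2
  refine squeeze_zero (fun _ => norm_nonneg _) (fun K => ?_) hsq
  refine Real.le_sqrt_of_sq_le ?_
  rw [norm_sub_rev]
  refine (norm_sub_trigL2_sq_le hab _ u (fourierHat a b u) (A := ‖u‖ ^ 2 / (b - a) -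
      ∑ l ∈ indexSet (2 * K), ‖fourierHat a b u l‖ ^ 2) fun s hs => ?_).trans (by simp)
  rw [le_sub_iff_add_le, ← Finset.sum_union hs]
  exact sum_sq_fourierHat_le hab u _

/-- A function whose Fourier series converges absolutely is bounded by the sum of the series. -/
lemma ae_norm_le_of_sum_fourierHat_le {a b : ℝ} (hab : a < b) (u : L2 a b) {M : ℝ}
    (hM : ∀ s : Finset ℤ, ∑ l ∈ s, ‖fourierHat a b u l‖ ≤ M) :
    ∀ᵐ x ∂(volume.restrict (Ioo a b)), ‖u x‖ ≤ M := by
  -- L² convergence gives a subsequence of partial sums converging almost everywhere, and each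
  -- partial sum is bounded pointwise by the ℓ¹ norm of its coefficients.
  have h := tendstoInMeasure_of_tendsto_Lp (tendsto_trigL2_fourierHat hab u)
  obtain ⟨ns, -, hns⟩ := h.exists_seq_tendsto_ae
  have hall : ∀ᵐ x ∂(volume.restrict (Ioo a b)), ∀ K : ℕ,
      trigL2 a b (2 * K) (fourierHat a b u) x = trigPoly a b (2 * K) (fourierHat a b u) x :=
    ae_all_iff.2 fun K => coeFn_trigL2 a b _ _
  filter_upwards [hns, hall] with x hx hx'
  refine le_of_tendsto hx.norm (Filter.Eventually.of_forall fun i => ?_)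
  rw [hx']
  exact (norm_trigPoly_le _ _ _ _ _).trans (hM _)

/-! ### Cutoff functions and the Fourier coefficients of a weak derivative. -/

lemma exists_abs_deriv_smoothTransition_le : ∃ D > 0, ∀ x, |deriv Real.smoothTransition x| ≤ D := by
  have hc : Continuous (deriv Real.smoothTransition) :=
    (Real.smoothTransition.contDiff (n := 1)).continuous_deriv le_rfl
  obtain ⟨C, hC⟩ := (isCompact_Icc (a := (0 : ℝ)) (b := 1)).exists_bound_of_continuousOn
    hc.continuousOn
  refine ⟨max C 1, by positivity, fun x => ?_⟩
  by_cases hx : x ∈ Icc (0 : ℝ) 1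
  · exact (hC x hx).trans (le_max_left _ _)
  · have h0 : deriv Real.smoothTransition x = 0 := by
      rw [mem_Icc, not_and_or, not_le, not_le] at hx
      rcases hx with hx | hx
      · have : Real.smoothTransition =ᶠ[nhds x] fun _ => 0 := by
          filter_upwards [Iio_mem_nhds hx] with y hy
          exact Real.smoothTransition.zero_of_nonpos (le_of_lt hy)
        rw [this.deriv_eq, deriv_const]
      · have : Real.smoothTransition =ᶠ[nhds x] fun _ => 1 := by
          filter_upwards [Ioi_mem_nhds hx] with y hy
          exact Real.smoothTransition.one_of_one_le (le_of_lt hy)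
        rw [this.deriv_eq, deriv_const]
    rw [h0, abs_zero]
    positivity

/-- The constant D does not depend on ε. The derivative lives in boundary layers of total length at
most 4ε, so its bound D/ε keeps its L¹ norm bounded as ε → 0. -/
lemma exists_cutoff (a b : ℝ) : ∃ D > 0, ∀ ε > 0, 4 * ε < b - a → ∃ χ : ℝ → ℝ,
    ContDiff ℝ ((⊤ : ℕ∞) : WithTop ℕ∞) χ ∧ HasCompactSupport χ ∧ tsupport χ ⊆ Ioo a b ∧
    (∀ x, |χ x| ≤ 1) ∧ (∀ x ∈ Ioo (a + 2 * ε) (b - 2 * ε), χ x = 1) ∧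
    (∀ x, |deriv χ x| ≤ D / ε) ∧ (∀ x ∈ Ioo (a + 2 * ε) (b - 2 * ε), deriv χ x = 0) := by
  obtain ⟨D, hD, hDb⟩ := exists_abs_deriv_smoothTransition_le
  refine ⟨2 * D, by positivity, fun ε hε hεb => ?_⟩
  set S := Real.smoothTransition
  have hS1 : ∀ x, |S x| ≤ 1 := fun x => by
    rw [abs_of_nonneg (Real.smoothTransition.nonneg x)]
    exact Real.smoothTransition.le_one x
  have hsupp : tsupport (fun x => S ((x - a) / ε - 1) * S ((b - x) / ε - 1)) ⊆
      Icc (a + ε) (b - ε) := by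
    refine closure_minimal (fun x hx => ?_) isClosed_Icc
    rw [Function.mem_support, mul_ne_zero_iff] at hx
    constructor
    · by_contra hlt
      refine hx.1 (Real.smoothTransition.zero_of_nonpos ?_)
      have : (x - a) / ε ≤ 1 := by rw [div_le_one hε]; linarith
      linarith
    · by_contra hlt
      refine hx.2 (Real.smoothTransition.zero_of_nonpos ?_)
      have : (b - x) / ε ≤ 1 := by rw [div_le_one hε]; linarith
      linarith
  have hone : ∀ x ∈ Ioo (a + 2 * ε) (b - 2 * ε),
      S ((x - a) / ε - 1) * S ((b - x) / ε - 1) = 1 := by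
    intro x hx
    have h1 : 2 ≤ (x - a) / ε := by rw [le_div_iff₀ hε]; linarith [hx.1]
    have h2 : 2 ≤ (b - x) / ε := by rw [le_div_iff₀ hε]; linarith [hx.2]
    rw [show S ((x - a) / ε - 1) = 1 from Real.smoothTransition.one_of_one_le (by linarith),
      show S ((b - x) / ε - 1) = 1 from Real.smoothTransition.one_of_one_le (by linarith), one_mul]
  have hder : ∀ x, HasDerivAt (fun x => S ((x - a) / ε - 1) * S ((b - x) / ε - 1))
      (deriv S ((x - a) / ε - 1) * (1 / ε) * S ((b - x) / ε - 1) +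
        S ((x - a) / ε - 1) * (deriv S ((b - x) / ε - 1) * (-1 / ε))) x := by
    intro x
    have hd : ∀ y, HasDerivAt S (deriv S y) y := fun y =>
      ((Real.smoothTransition.contDiff (n := 1)).differentiable (by norm_num) y).hasDerivAt
    have h1 : HasDerivAt (fun x : ℝ => (x - a) / ε - 1) (1 / ε) x :=
      (((hasDerivAt_id x).sub_const a).div_const ε).sub_const 1
    have h2 : HasDerivAt (fun x : ℝ => (b - x) / ε - 1) (-1 / ε) x :=
      (((hasDerivAt_id x).const_sub b).div_const ε).sub_const 1
    exact ((hd _).comp x h1).mul ((hd _).comp x h2)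
  refine ⟨fun x => S ((x - a) / ε - 1) * S ((b - x) / ε - 1), ?_, ?_, ?_, ?_, hone, ?_, ?_⟩
  · refine ContDiff.mul ?_ ?_
    · exact Real.smoothTransition.contDiff.comp
        (((contDiff_id.sub contDiff_const).div_const ε).sub contDiff_const)
    · exact Real.smoothTransition.contDiff.comp
        (((contDiff_const.sub contDiff_id).div_const ε).sub contDiff_const)
  · exact isCompact_Icc.of_isClosed_subset (isClosed_tsupport _) hsupp
  · exact hsupp.trans (Icc_subset_Ioo (by linarith) (by linarith))
  · intro x
    rw [abs_mul]
    exact mul_le_one₀ (hS1 _) (abs_nonneg _) (hS1 _)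
  · intro x
    rw [(hder x).deriv]
    refine (abs_add_le _ _).trans ?_
    simp only [abs_mul, abs_div, abs_neg, abs_one, abs_of_pos hε]
    have e1 := hDb ((x - a) / ε - 1)
    have e2 := hDb ((b - x) / ε - 1)
    have h1 : |deriv S ((x - a) / ε - 1)| * (1 / ε) * |S ((b - x) / ε - 1)| ≤ D * (1 / ε) * 1 := by
      gcongr
      exact hS1 _
    have h2 : |S ((x - a) / ε - 1)| * (|deriv S ((b - x) / ε - 1)| * (1 / ε)) ≤
        1 * (D * (1 / ε)) := by
      gcongr
      exact hS1 _
    refine (add_le_add h1 h2).trans (le_of_eq ?_)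
    ring
  · intro x hx
    have : (fun x => S ((x - a) / ε - 1) * S ((b - x) / ε - 1)) =ᶠ[nhds x] fun _ => 1 := by
      filter_upwards [Ioo_mem_nhds hx.1 hx.2] with y hy
      exact hone y hy
    rw [this.deriv_eq, deriv_const]

/-- Testing a weak derivative with a cutoff times a complex exponential. -/
lemma IsWeakDeriv.integral_cutoff_mul {a b : ℝ} {u v : L2 a b} (h : IsWeakDeriv a b u v)
    {χ : ℝ → ℝ} (hχ : ContDiff ℝ ((⊤ : ℕ∞) : WithTop ℕ∞) χ) (hc : HasCompactSupport χ)
    (hs : tsupport χ ⊆ Ioo a b) (μ : ℝ) :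
    (∫ x in Ioo a b, ((deriv χ x : ℝ) : ℂ) * (u x * Complex.exp (-Complex.I * (μ : ℂ) * ((x : ℂ) - a))))
      = Complex.I * μ *
        (∫ x in Ioo a b, (χ x : ℂ) * (u x * Complex.exp (-Complex.I * (μ : ℂ) * ((x : ℂ) - a))))
      - ∫ x in Ioo a b, (χ x : ℂ) * (v x * Complex.exp (-Complex.I * (μ : ℂ) * ((x : ℂ) - a))) := by
  have hexp : ∀ x : ℝ, Complex.exp (-Complex.I * (μ : ℂ) * ((x : ℂ) - a)) =
      (Real.cos (μ * (x - a)) : ℂ) - (Real.sin (μ * (x - a)) : ℂ) * Complex.I := by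
    intro x
    have : -Complex.I * (μ : ℂ) * ((x : ℂ) - a) = ((-(μ * (x - a)) : ℝ) : ℂ) * Complex.I := by
      push_cast; ring
    rw [this, Complex.exp_mul_I, ← Complex.ofReal_cos, ← Complex.ofReal_sin, Real.cos_neg,
      Real.sin_neg]
    push_cast; ring
  have hdχ : ∀ x, HasDerivAt χ (deriv χ x) x := fun x =>
    (hχ.differentiable (by simp) x).hasDerivAt
  have hlin : ∀ x : ℝ, HasDerivAt (fun x : ℝ => μ * (x - a)) μ x := fun x => by
    simpa using ((hasDerivAt_id x).sub_const a).const_mul μ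
  -- Test functions are real valued, so the exponential is split into cosine and sine and the two
  -- identities are recombined.
  set φ₁ : ℝ → ℝ := fun x => χ x * Real.cos (μ * (x - a))
  set φ₂ : ℝ → ℝ := fun x => χ x * Real.sin (μ * (x - a))
  have p1 : ∀ x, φ₁ x = χ x * Real.cos (μ * (x - a)) := fun _ => rfl
  have p2 : ∀ x, φ₂ x = χ x * Real.sin (μ * (x - a)) := fun _ => rfl
  have d1 : ∀ x, deriv φ₁ x = deriv χ x * Real.cos (μ * (x - a)) - χ x * (Real.sin (μ * (x - a)) * μ) :=
    fun x => by
      rw [((hdχ x).fun_mul (hlin x).cos).deriv]; ring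
  have d2 : ∀ x, deriv φ₂ x = deriv χ x * Real.sin (μ * (x - a)) + χ x * (Real.cos (μ * (x - a)) * μ) :=
    fun x => by
      rw [((hdχ x).fun_mul (hlin x).sin).deriv]
  have c1 : ContDiff ℝ ((⊤ : ℕ∞) : WithTop ℕ∞) φ₁ :=
    hχ.mul (Real.contDiff_cos.comp (contDiff_const.mul (contDiff_id.sub contDiff_const)))
  have c2 : ContDiff ℝ ((⊤ : ℕ∞) : WithTop ℕ∞) φ₂ :=
    hχ.mul (Real.contDiff_sin.comp (contDiff_const.mul (contDiff_id.sub contDiff_const)))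
  have s1 : HasCompactSupport φ₁ := hc.mul_right
  have s2 : HasCompactSupport φ₂ := hc.mul_right
  have w1 := h φ₁ c1 s1 ((tsupport_mul_subset_left).trans hs)
  have w2 := h φ₂ c2 s2 ((tsupport_mul_subset_left).trans hs)
  have i1u := integrable_test c1 s1 u
  have i2u := integrable_test c2 s2 u
  have i1v := (integrable_test c1 s1 v).1
  have i2v := (integrable_test c2 s2 v).1
  have eu : ∀ x : ℝ, (χ x : ℂ) * (u x * Complex.exp (-Complex.I * (μ : ℂ) * ((x : ℂ) - a))) =
      (φ₁ x : ℂ) * u x - Complex.I * ((φ₂ x : ℂ) * u x) := fun x => by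
    rw [hexp, p1, p2]; push_cast; ring
  have ev : ∀ x : ℝ, (χ x : ℂ) * (v x * Complex.exp (-Complex.I * (μ : ℂ) * ((x : ℂ) - a))) =
      (φ₁ x : ℂ) * v x - Complex.I * ((φ₂ x : ℂ) * v x) := fun x => by
    rw [hexp, p1, p2]; push_cast; ring
  have ed : ∀ x : ℝ,
      ((deriv χ x : ℝ) : ℂ) * (u x * Complex.exp (-Complex.I * (μ : ℂ) * ((x : ℂ) - a))) =
      (((deriv φ₁ x : ℝ) : ℂ) * u x - Complex.I * (((deriv φ₂ x : ℝ) : ℂ) * u x)) +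
        Complex.I * μ * ((φ₁ x : ℂ) * u x - Complex.I * ((φ₂ x : ℂ) * u x)) := fun x => by
    rw [hexp, d1, d2, p1, p2]
    push_cast
    linear_combination ((χ x : ℂ) * u x * Complex.sin (μ * (x - a)) * μ) * Complex.I_sq
  simp_rw [ed, eu, ev]
  rw [integral_add (i1u.2.sub' (i2u.2.const_mul _))
    ((i1u.1.sub' (i2u.1.const_mul _)).const_mul _),
    integral_sub i1u.2 (i2u.2.const_mul _), integral_const_mul, integral_const_mul,
    integral_sub i1v (i2v.const_mul _), integral_const_mul, w1, w2]
  ring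

lemma norm_integral_le_of_eq_zero_of_mem_Ioo {a b ε K : ℝ} {F : ℝ → ℂ}
    (hF : ContinuousOn F (Icc a b)) (hε : 0 < ε) (hεb : 4 * ε < b - a)
    (h0 : ∀ x ∈ Ioo (a + 2 * ε) (b - 2 * ε), F x = 0)
    (hl : ∀ x ∈ Icc a (a + 2 * ε), ‖F x‖ ≤ K) (hr : ∀ x ∈ Icc (b - 2 * ε) b, ‖F x‖ ≤ K) :
    ‖∫ x in a..b, F x‖ ≤ 4 * ε * K := by
  have hi : ∀ c d : ℝ, a ≤ c → c ≤ d → d ≤ b → IntervalIntegrable F volume c d :=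
    fun c d h1 h2 h3 => ContinuousOn.intervalIntegrable_of_Icc h2
      (hF.mono (Icc_subset_Icc h1 h3))
  rw [← intervalIntegral.integral_add_adjacent_intervals (b := a + 2 * ε)
      (hi _ _ le_rfl (by linarith) (by linarith)) (hi _ _ (by linarith) (by linarith) le_rfl),
    ← intervalIntegral.integral_add_adjacent_intervals (a := a + 2 * ε) (b := b - 2 * ε)
      (hi _ _ (by linarith) (by linarith) (by linarith))
      (hi _ _ (by linarith) (by linarith) le_rfl)]
  have hm : ∫ x in (a + 2 * ε)..(b - 2 * ε), F x = 0 := by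
    rw [intervalIntegral.integral_of_le (by linarith), integral_Ioc_eq_integral_Ioo]
    exact setIntegral_eq_zero_of_forall_eq_zero h0
  have h1 : ‖∫ x in a..(a + 2 * ε), F x‖ ≤ K * |a + 2 * ε - a| := by
    refine intervalIntegral.norm_integral_le_of_norm_le_const fun x hx => hl x ?_
    rw [uIoc_of_le (by linarith)] at hx
    exact Ioc_subset_Icc_self hx
  have h2 : ‖∫ x in (b - 2 * ε)..b, F x‖ ≤ K * |b - (b - 2 * ε)| := by
    refine intervalIntegral.norm_integral_le_of_norm_le_const fun x hx => hr x ?_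
    rw [uIoc_of_le (by linarith)] at hx
    exact Ioc_subset_Icc_self hx
  rw [abs_of_nonneg (by linarith)] at h1 h2
  rw [hm, zero_add]
  refine (norm_add_le _ _).trans ((add_le_add h1 h2).trans (le_of_eq ?_))
  ring

/-- The Fourier coefficients of the weak derivative of a periodic function. -/
lemma IsWeakDeriv.fourierHat_eq {a b : ℝ} (hab : a < b) {u v : L2 a b} (h : IsWeakDeriv a b u v)
    (hu : HasEqualEndpoints a b u) (l : ℤ) :
    fourierHat a b v l = Complex.I * freq a b l * fourierHat a b u l := by
  have hba := sub_pos.2 hab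
  obtain ⟨w, hw, huw, hwab⟩ := hu
  obtain ⟨D, hD, hcut⟩ := exists_cutoff a b
  -- The factor 1/5 keeps 4ε below b - a for every n, as `exists_cutoff` requires.
  set ε : ℕ → ℝ := fun n => (b - a) / 5 * (1 / ((n : ℝ) + 1)) with hε
  have hεpos : ∀ n, 0 < ε n := fun n => by positivity
  have hεlt : ∀ n, 4 * ε n < b - a := fun n => by
    have : 1 / ((n : ℝ) + 1) ≤ 1 := by
      rw [div_le_one (by positivity)]; linarith [(Nat.cast_nonneg n : (0 : ℝ) ≤ n)]
    have : ε n ≤ (b - a) / 5 := mul_le_of_le_one_right (by positivity) this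
    linarith
  have hε0 : Filter.Tendsto ε Filter.atTop (nhds 0) := by
    have := (tendsto_one_div_add_atTop_nhds_zero_nat (𝕜 := ℝ)).const_mul ((b - a) / 5)
    rwa [mul_zero] at this
  choose χ hχs hχc hχt hχ1 hχe hχd hχ0 using fun n => hcut (ε n) (hεpos n) (hεlt n)
  set e : ℝ → ℂ := fun x => Complex.exp (-Complex.I * (freq a b l : ℂ) * ((x : ℂ) - a)) with he
  have hec : Continuous e := by rw [he]; fun_prop
  have hid : ∀ n, (∫ x in Ioo a b, ((deriv (χ n) x : ℝ) : ℂ) * (u x * e x)) =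
      Complex.I * (freq a b l : ℂ) * (∫ x in Ioo a b, (χ n x : ℂ) * (u x * e x))
      - ∫ x in Ioo a b, (χ n x : ℂ) * (v x * e x) :=
    fun n => h.integral_cutoff_mul (hχs n) (hχc n) (hχt n) (freq a b l)
  have hlim : ∀ z : L2 a b, Filter.Tendsto (fun n => ∫ x in Ioo a b, (χ n x : ℂ) * (z x * e x))
      Filter.atTop (nhds (∫ x in Ioo a b, z x * e x)) := by
    intro z
    have hz : Integrable (fun x => z x * e x) (volume.restrict (Ioo a b)) :=
      integrable_mul_fourierExp ((Lp.memLp z).integrable (by norm_num)) l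
    refine tendsto_integral_of_dominated_convergence (fun x => ‖z x * e x‖) ?_ hz.norm ?_ ?_
    · exact fun n => (Complex.continuous_ofReal.comp (hχs n).continuous).aestronglyMeasurable.mul
        hz.aestronglyMeasurable
    · refine fun n => Filter.Eventually.of_forall fun x => ?_
      rw [norm_mul, Complex.norm_real]
      exact mul_le_of_le_one_left (norm_nonneg _) (hχ1 n x)
    · filter_upwards [ae_restrict_mem measurableSet_Ioo] with x hx
      refine tendsto_const_nhds.congr' ?_
      have hpos : 0 < min (x - a) (b - x) / 2 := by
        have h1 := hx.1
        have h2 := hx.2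
        have : 0 < min (x - a) (b - x) := lt_min (by linarith) (by linarith)
        positivity
      filter_upwards [hε0.eventually (gt_mem_nhds hpos)] with n hn
      have h1 := min_le_left (x - a) (b - x)
      have h2 := min_le_right (x - a) (b - x)
      rw [hχe n x ⟨by linarith, by linarith⟩, Complex.ofReal_one, one_mul]
  -- The boundary terms cancel by periodicity. As χ' has integral zero, f(a) may be subtracted from
  -- f = w·e; since f(a) = f(b), the difference is small in both layers, which compensates the bound
  -- D/ε.
  have hzero : Filter.Tendsto (fun n => ∫ x in Ioo a b, ((deriv (χ n) x : ℝ) : ℂ) * (u x * e x))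
      Filter.atTop (nhds 0) := by
    set f : ℝ → ℂ := fun x => w x * e x with hf
    have hfc : ContinuousOn f (Icc a b) := hw.mul hec.continuousOn
    have hfab : f a = f b := by
      have e1 : e a = 1 := by simp [he]
      have e2 : e b = 1 := by
        rw [he, Complex.exp_eq_one_iff]
        refine ⟨-l, ?_⟩
        have : ((b : ℂ) - a) ≠ 0 := by rw [← Complex.ofReal_sub]; exact_mod_cast hba.ne'
        unfold freq
        push_cast
        field_simp
      simp only [hf, e1, e2, hwab]
    have hdc : ∀ n, Continuous (fun x => ((deriv (χ n) x : ℝ) : ℂ)) := fun n =>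
      Complex.continuous_ofReal.comp ((hχs n).continuous_deriv (by simp))
    have hrew : ∀ n, (∫ x in Ioo a b, ((deriv (χ n) x : ℝ) : ℂ) * (u x * e x)) =
        ∫ x in a..b, ((deriv (χ n) x : ℝ) : ℂ) * (f x - f a) := by
      intro n
      have h1 : (∫ x in Ioo a b, ((deriv (χ n) x : ℝ) : ℂ) * (u x * e x)) =
          ∫ x in a..b, ((deriv (χ n) x : ℝ) : ℂ) * f x := by
        rw [intervalIntegral.integral_of_le hab.le, integral_Ioc_eq_integral_Ioo]
        refine integral_congr_ae ?_
        filter_upwards [huw] with x hx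
        rw [hx]
      have h2 : ∫ x in a..b, ((deriv (χ n) x : ℝ) : ℂ) = 0 := by
        rw [intervalIntegral.integral_ofReal, intervalIntegral.integral_deriv_eq_sub
          (fun x _ => (hχs n).differentiable (by simp) x)
          (((hχs n).continuous_deriv (by simp)).intervalIntegrable _ _)]
        have ha : χ n a = 0 := image_eq_zero_of_notMem_tsupport fun hm => (hχt n hm).1.false
        have hb : χ n b = 0 := image_eq_zero_of_notMem_tsupport fun hm => (hχt n hm).2.false
        simp [ha, hb]
      simp only [mul_sub]
      rw [intervalIntegral.integral_sub, intervalIntegral.integral_mul_const, h2, zero_mul,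
        sub_zero, h1]
      · exact ContinuousOn.intervalIntegrable_of_Icc hab.le ((hdc n).continuousOn.mul hfc)
      · exact ((hdc n).mul continuous_const).intervalIntegrable _ _
    simp_rw [hrew]
    rw [Metric.tendsto_atTop]
    intro η hη
    -- Chosen so that 4ε · (D/ε) · η/(8D) = η/2.
    have hη' : 0 < η / (8 * D) := by positivity
    obtain ⟨δ₁, hδ₁, h₁⟩ := Metric.continuousOn_iff.1 hfc a (left_mem_Icc.2 hab.le) _ hη'
    obtain ⟨δ₂, hδ₂, h₂⟩ := Metric.continuousOn_iff.1 hfc b (right_mem_Icc.2 hab.le) _ hη'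
    have hδ : 0 < min δ₁ δ₂ / 2 := by positivity
    obtain ⟨n₀, hn₀⟩ := Filter.eventually_atTop.1 (hε0.eventually (gt_mem_nhds hδ))
    refine ⟨n₀, fun n hn => ?_⟩
    have hεn := hn₀ n hn
    have m1 := min_le_left δ₁ δ₂
    have m2 := min_le_right δ₁ δ₂
    have e0 := hεpos n
    have e4 := hεlt n
    have key : ‖∫ x in a..b, ((deriv (χ n) x : ℝ) : ℂ) * (f x - f a)‖ ≤
        4 * ε n * (D / ε n * (η / (8 * D))) := by
      refine norm_integral_le_of_eq_zero_of_mem_Ioo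
        ((hdc n).continuousOn.mul (hfc.sub continuousOn_const)) e0 e4 ?_ ?_ ?_
      · intro x hx
        rw [hχ0 n x hx, Complex.ofReal_zero, zero_mul]
      · intro x hx
        rw [norm_mul, Complex.norm_real]
        refine mul_le_mul (hχd n x) ?_ (norm_nonneg _) (by positivity)
        rw [← dist_eq_norm]
        refine (h₁ x ⟨hx.1, by linarith [hx.2]⟩ ?_).le
        rw [Real.dist_eq, abs_of_nonneg (by linarith [hx.1])]
        linarith [hx.2]
      · intro x hx
        rw [norm_mul, Complex.norm_real]
        refine mul_le_mul (hχd n x) ?_ (norm_nonneg _) (by positivity)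
        rw [hfab, ← dist_eq_norm]
        refine (h₂ x ⟨by linarith [hx.1], hx.2⟩ ?_).le
        rw [Real.dist_eq, abs_of_nonpos (by linarith [hx.2])]
        linarith [hx.1]
    rw [dist_zero_right]
    refine key.trans_lt ?_
    have : 4 * ε n * (D / ε n * (η / (8 * D))) = η / 2 := by field_simp; ring
    rw [this]
    linarith
  have hlim2 := ((hlim u).const_mul (Complex.I * (freq a b l : ℂ))).sub (hlim v)
  simp_rw [← hid] at hlim2
  have huniq := tendsto_nhds_unique hzero hlim2
  unfold fourierHat
  rw [sub_eq_zero.1 huniq.symm |>.symm]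
  ring

/-! ### Absolute convergence of Fourier series in H¹, and derivatives of trigonometric polynomials.
-/

lemma freq_zero (a b : ℝ) : freq a b 0 = 0 := by simp [freq]

lemma summable_freq_inv_sq (a b : ℝ) : Summable fun l : ℤ => (freq a b l)⁻¹ ^ 2 := by
  have h := (Real.summable_one_div_int_pow (p := 2)).2 one_lt_two
  refine (h.mul_left ((2 * Real.pi / (b - a))⁻¹ ^ 2)).congr fun l => ?_
  unfold freq
  rw [one_div, ← inv_pow, ← mul_pow, ← mul_inv]
  congr 2
  ring

/-- Sobolev embedding: a periodic `H¹` function has an absolutely convergent Fourier series. -/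
lemma exists_sum_norm_fourierHat_le {a b : ℝ} (hab : a < b) : ∃ C > 0, ∀ u v : L2 a b,
    IsWeakDeriv a b u v → HasEqualEndpoints a b u →
      ∀ s : Finset ℤ, ∑ l ∈ s, ‖fourierHat a b u l‖ ≤ C * (‖u‖ + ‖v‖) := by
  have hba := sub_pos.2 hab
  set W := 1 + ∑' l : ℤ, (freq a b l)⁻¹ ^ 2 with hW
  have hW0 : 0 < W := by
    have : 0 ≤ ∑' l : ℤ, (freq a b l)⁻¹ ^ 2 := tsum_nonneg fun _ => sq_nonneg _
    linarith
  refine ⟨Real.sqrt (W * (2 / (b - a))), by positivity, fun u v h hu s => ?_⟩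
  -- Cauchy–Schwarz with weights 1/|μ_l|, whose squares are summable. The zero mode gets weight 1,
  -- which accounts for the 1 in W, since the inverse of `freq a b 0` is 0 in the series.
  set w : ℤ → ℝ := fun l => if l = 0 then 1 else |(freq a b l)⁻¹| with hw
  have hle : ∀ l, ‖fourierHat a b u l‖ ≤ w l * (‖fourierHat a b u l‖ + ‖fourierHat a b v l‖) := by
    intro l
    by_cases hl : l = 0
    · simp only [hw, hl, if_true, one_mul]
      linarith [norm_nonneg (fourierHat a b v 0)]
    · have hf : freq a b l ≠ 0 := by
        unfold freq
        have hl' : (l : ℝ) ≠ 0 := by exact_mod_cast hl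
        have := Real.pi_ne_zero
        have := hba.ne'
        positivity
      simp only [hw, hl, if_false]
      rw [h.fourierHat_eq hab hu, norm_mul, norm_mul, Complex.norm_I, one_mul, Complex.norm_real,
        Real.norm_eq_abs, mul_add, abs_inv, inv_mul_cancel_left₀ (abs_ne_zero.2 hf)]
      have : 0 ≤ |freq a b l|⁻¹ * ‖fourierHat a b u l‖ := by positivity
      linarith
  have hw2 : ∑ l ∈ s, w l ^ 2 ≤ W := by
    have h1 : ∀ l, w l ^ 2 = (if l = 0 then 1 else 0) + (freq a b l)⁻¹ ^ 2 := by
      intro l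
      by_cases hl : l = 0
      · simp [hw, hl, freq_zero]
      · simp [hw, hl]
    simp_rw [h1]
    rw [Finset.sum_add_distrib, hW]
    refine add_le_add ?_ ((summable_freq_inv_sq a b).sum_le_tsum s fun _ _ => sq_nonneg _)
    rw [Finset.sum_ite_eq']
    split_ifs <;> norm_num
  have hcs := Finset.sum_mul_sq_le_sq_mul_sq s w
    (fun l => ‖fourierHat a b u l‖ + ‖fourierHat a b v l‖)
  have hsum : ∑ l ∈ s, (‖fourierHat a b u l‖ + ‖fourierHat a b v l‖) ^ 2 ≤
      2 / (b - a) * (‖u‖ + ‖v‖) ^ 2 := by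
    have h1 : ∑ l ∈ s, (‖fourierHat a b u l‖ + ‖fourierHat a b v l‖) ^ 2 ≤
        ∑ l ∈ s, (2 * ‖fourierHat a b u l‖ ^ 2 + 2 * ‖fourierHat a b v l‖ ^ 2) := by
      refine Finset.sum_le_sum fun l _ => ?_
      nlinarith [sq_nonneg (‖fourierHat a b u l‖ - ‖fourierHat a b v l‖)]
    rw [Finset.sum_add_distrib, ← Finset.mul_sum, ← Finset.mul_sum] at h1
    have h2 := sum_sq_fourierHat_le hab u s
    have h3 := sum_sq_fourierHat_le hab v s
    have h4 : 2 / (b - a) * (‖u‖ + ‖v‖) ^ 2 = 2 * (‖u‖ ^ 2 / (b - a)) + 2 * (‖v‖ ^ 2 / (b - a)) +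
        2 / (b - a) * (2 * ‖u‖ * ‖v‖) := by ring
    have h5 : 0 ≤ 2 / (b - a) * (2 * ‖u‖ * ‖v‖) := by positivity
    linarith
  refine (Finset.sum_le_sum fun l _ => hle l).trans ?_
  refine abs_le_of_sq_le_sq' ?_ (by positivity) |>.2
  rw [mul_pow, Real.sq_sqrt (by positivity)]
  refine hcs.trans ((mul_le_mul hw2 hsum (by positivity) hW0.le).trans (le_of_eq ?_))
  ring

lemma continuous_trigPoly (a b : ℝ) (N : ℕ) (c : ℤ → ℂ) : Continuous (trigPoly a b N c) := by
  unfold trigPoly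
  fun_prop

lemma hasDerivAt_trigPoly (a b : ℝ) (N : ℕ) (c : ℤ → ℂ) (x : ℝ) :
    HasDerivAt (trigPoly a b N c)
      (trigPoly a b N (fun l => Complex.I * freq a b l * c l) x) x := by
  unfold trigPoly
  refine HasDerivAt.fun_sum fun l _ => ?_
  have h1 : HasDerivAt (fun x : ℝ => Complex.I * (freq a b l : ℂ) * ((x : ℂ) - a))
      (Complex.I * (freq a b l : ℂ)) x := by
    simpa using ((hasDerivAt_id x).ofReal_comp.sub_const (a : ℂ)).const_mul
      (Complex.I * (freq a b l : ℂ))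
  refine (h1.cexp.const_mul (c l)).congr_deriv ?_
  ring

lemma isWeakDeriv_trigL2 {a b : ℝ} (hab : a < b) (N : ℕ) (c : ℤ → ℂ) :
    IsWeakDeriv a b (trigL2 a b N c) (trigL2 a b N (fun l => Complex.I * freq a b l * c l)) := by
  intro φ hφ hc hs
  set c' : ℤ → ℂ := fun l => Complex.I * freq a b l * c l
  have h1 : ∫ x in Ioo a b, ((deriv φ x : ℝ) : ℂ) * trigL2 a b N c x =
      ∫ x in a..b, ((deriv φ x : ℝ) : ℂ) * trigPoly a b N c x := by
    rw [intervalIntegral.integral_of_le hab.le, integral_Ioc_eq_integral_Ioo]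
    refine integral_congr_ae ?_
    filter_upwards [coeFn_trigL2 a b N c] with x hx
    rw [hx]
  have h2 : ∫ x in Ioo a b, (φ x : ℂ) * trigL2 a b N c' x =
      ∫ x in a..b, (φ x : ℂ) * trigPoly a b N c' x := by
    rw [intervalIntegral.integral_of_le hab.le, integral_Ioc_eq_integral_Ioo]
    refine integral_congr_ae ?_
    filter_upwards [coeFn_trigL2 a b N c'] with x hx
    rw [hx]
  have hφc : Continuous fun x => ((deriv φ x : ℝ) : ℂ) :=
    Complex.continuous_ofReal.comp (hφ.continuous_deriv (by simp))
  have h3 := intervalIntegral.integral_deriv_mul_eq_sub (a := a) (b := b)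
    (u := fun x => (φ x : ℂ)) (v := trigPoly a b N c) (u' := fun x => ((deriv φ x : ℝ) : ℂ))
    (v' := trigPoly a b N c')
    (fun x _ => ((hφ.differentiable (by simp) x).hasDerivAt).ofReal_comp)
    (fun x _ => hasDerivAt_trigPoly a b N c x)
    (hφc.intervalIntegrable _ _) ((continuous_trigPoly _ _ _ _).intervalIntegrable _ _)
  have ha : φ a = 0 := image_eq_zero_of_notMem_tsupport fun hm => (hs hm).1.false
  have hb : φ b = 0 := image_eq_zero_of_notMem_tsupport fun hm => (hs hm).2.false
  have i1 : IntervalIntegrable (fun x => ((deriv φ x : ℝ) : ℂ) * trigPoly a b N c x) volume a b :=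
    (hφc.mul (continuous_trigPoly a b N c)).intervalIntegrable _ _
  have i2 : IntervalIntegrable (fun x => (φ x : ℂ) * trigPoly a b N c' x) volume a b :=
    ((Complex.continuous_ofReal.comp hφ.continuous).mul
      (continuous_trigPoly a b N c')).intervalIntegrable _ _
  rw [intervalIntegral.integral_add i1 i2, ha, hb] at h3
  rw [h1, h2]
  simp only [Complex.ofReal_zero, zero_mul, sub_zero] at h3
  exact eq_neg_of_add_eq_zero_left h3

/-! ### C^{1,1} estimates for the power nonlinearity. -/

/-- The power nonlinearity `|z|^{2σ} z`. -/
def powNL (σ : ℝ) (z : ℂ) : ℂ := (((‖z‖ ^ 2) ^ σ : ℝ) : ℂ) * z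

/-- `z / |z|`, with value `0` at `z = 0`. -/
def unitVec (z : ℂ) : ℂ := ((‖z‖⁻¹ : ℝ) : ℂ) * z

/-- The real derivative of `powNL σ` at `z` in the direction `y`. -/
def dPowNL (σ : ℝ) (z y : ℂ) : ℂ :=
  ((‖z‖ ^ (2 * σ) : ℝ) : ℂ) * y +
    ((2 * σ * ‖z‖ ^ (2 * σ) * inner ℝ (unitVec z) y : ℝ) : ℂ) * unitVec z

lemma norm_unitVec_le (z : ℂ) : ‖unitVec z‖ ≤ 1 := by
  rw [unitVec, norm_mul, Complex.norm_real, norm_inv, norm_norm]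
  exact inv_mul_le_one

lemma norm_mul_unitVec (z : ℂ) : (‖z‖ : ℂ) * unitVec z = z := by
  by_cases hz : z = 0
  · simp [hz, unitVec]
  · rw [unitVec, ← mul_assoc, ← Complex.ofReal_mul, mul_inv_cancel₀ (norm_ne_zero_iff.2 hz),
      Complex.ofReal_one, one_mul]

/-- The map z ↦ z/|z| is singular at the origin; one factor ‖w‖ makes it Lipschitz. This follows
from |w|(u_z - u_w) = (z - w) + (|w| - |z|)u_z, with u_z = z/|z|. -/
lemma norm_mul_norm_unitVec_sub_le (z w : ℂ) : ‖w‖ * ‖unitVec z - unitVec w‖ ≤ 2 * ‖z - w‖ := by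
  have h : (‖w‖ : ℂ) * (unitVec z - unitVec w) =
      (z - w) + ((‖w‖ - ‖z‖ : ℝ) : ℂ) * unitVec z := by
    push_cast
    linear_combination norm_mul_unitVec z - norm_mul_unitVec w
  have h2 : ‖w‖ * ‖unitVec z - unitVec w‖ = ‖(‖w‖ : ℂ) * (unitVec z - unitVec w)‖ := by
    rw [norm_mul, Complex.norm_real, norm_norm]
  rw [h2, h]
  refine (norm_add_le _ _).trans ?_
  rw [norm_mul, Complex.norm_real, Real.norm_eq_abs]
  have h3 : |‖w‖ - ‖z‖| ≤ ‖z - w‖ := by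
    rw [norm_sub_rev]
    exact abs_norm_sub_norm_le w z
  have h4 : |‖w‖ - ‖z‖| * ‖unitVec z‖ ≤ |‖w‖ - ‖z‖| :=
    mul_le_of_le_one_right (abs_nonneg _) (norm_unitVec_le z)
  linarith

lemma abs_rpow_sub_rpow_le {p R x y : ℝ} (hp : 1 ≤ p) (hx : 0 ≤ x) (hxR : x ≤ R) (hy : 0 ≤ y)
    (hyR : y ≤ R) : |x ^ p - y ^ p| ≤ p * R ^ (p - 1) * |x - y| := by
  have h := Convex.norm_image_sub_le_of_norm_hasDerivWithin_le (f := fun x : ℝ => x ^ p)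
    (f' := fun x => p * x ^ (p - 1)) (s := Icc 0 R) (C := p * R ^ (p - 1)) (x := y) (y := x)
    (fun t _ => (Real.hasDerivAt_rpow_const (Or.inr hp)).hasDerivWithinAt)
    (fun t ht => by
      rw [Real.norm_eq_abs, abs_of_nonneg (mul_nonneg (by linarith) (Real.rpow_nonneg ht.1 _))]
      exact mul_le_mul_of_nonneg_left (Real.rpow_le_rpow ht.1 ht.2 (by linarith)) (by linarith))
    (convex_Icc 0 R) ⟨hy, hyR⟩ ⟨hx, hxR⟩
  simpa using h

lemma norm_dPowNL_le {σ R : ℝ} (hσ : 1 / 2 ≤ σ) {z : ℂ} (hz : ‖z‖ ≤ R) (y : ℂ) :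
    ‖dPowNL σ z y‖ ≤ (1 + 2 * σ) * R ^ (2 * σ) * ‖y‖ := by
  have h1 : ‖z‖ ^ (2 * σ) ≤ R ^ (2 * σ) := Real.rpow_le_rpow (norm_nonneg _) hz (by linarith)
  have h0 : 0 ≤ ‖z‖ ^ (2 * σ) := Real.rpow_nonneg (norm_nonneg _) _
  have hR : 0 ≤ R := (norm_nonneg _).trans hz
  have hσ0 : 0 ≤ σ := by linarith
  refine (norm_add_le _ _).trans ?_
  simp only [norm_mul, Complex.norm_real, Real.norm_eq_abs, abs_of_nonneg h0, abs_two,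
    abs_of_nonneg hσ0]
  have h2 : |inner ℝ (unitVec z) y| ≤ ‖y‖ :=
    (abs_real_inner_le_norm _ _).trans (mul_le_of_le_one_left (norm_nonneg _) (norm_unitVec_le z))
  have h3 : 2 * σ * ‖z‖ ^ (2 * σ) * |inner ℝ (unitVec z) y| * ‖unitVec z‖ ≤
      2 * σ * R ^ (2 * σ) * ‖y‖ * 1 := by
    gcongr
    exact norm_unitVec_le z
  have h4 : ‖z‖ ^ (2 * σ) * ‖y‖ ≤ R ^ (2 * σ) * ‖y‖ := by gcongr
  linarith

/-- This is where σ ≥ 1/2 is essential: r ↦ r^{2σ} is then locally Lipschitz, and the factor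
|w|^{2σ} contains a full power of |w| to pay for the variation of the unit vector. -/
lemma norm_dPowNL_sub_le {σ R : ℝ} (hσ : 1 / 2 ≤ σ) {z w : ℂ} (hz : ‖z‖ ≤ R) (hw : ‖w‖ ≤ R)
    (y : ℂ) :
    ‖dPowNL σ z y - dPowNL σ w y‖ ≤
      2 * σ * R ^ (2 * σ - 1) * (5 + 2 * σ) * ‖z - w‖ * ‖y‖ := by
  have hR : 0 ≤ R := (norm_nonneg _).trans hz
  set p := 2 * σ with hp
  have hp1 : 1 ≤ p := by linarith
  set Q := R ^ (p - 1) with hQ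
  have hQ0 : 0 ≤ Q := Real.rpow_nonneg hR _
  have hd : |‖z‖ ^ p - ‖w‖ ^ p| ≤ p * Q * ‖z - w‖ :=
    (abs_rpow_sub_rpow_le hp1 (norm_nonneg _) hz (norm_nonneg _) hw).trans
      (mul_le_mul_of_nonneg_left (abs_norm_sub_norm_le z w) (by positivity))
  have hwp : ‖w‖ ^ p * ‖unitVec z - unitVec w‖ ≤ 2 * Q * ‖z - w‖ := by
    have h1 : ‖w‖ ^ p = ‖w‖ ^ (p - 1) * ‖w‖ := by
      rcases (norm_nonneg w).eq_or_lt with h0 | h0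
      · rw [← h0, mul_zero, Real.zero_rpow (by linarith)]
      · rw [← Real.rpow_add_one h0.ne', sub_add_cancel]
    have h2 : ‖w‖ ^ (p - 1) ≤ Q := Real.rpow_le_rpow (norm_nonneg _) hw (by linarith)
    rw [h1, mul_assoc]
    refine (mul_le_mul h2 (norm_mul_norm_unitVec_sub_le z w) (by positivity) hQ0).trans
      (le_of_eq (by ring))
  have hsplit : dPowNL σ z y - dPowNL σ w y =
      ((‖z‖ ^ p - ‖w‖ ^ p : ℝ) : ℂ) * y +
      ((p * (‖z‖ ^ p - ‖w‖ ^ p) * inner ℝ (unitVec z) y : ℝ) : ℂ) * unitVec z +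
      ((p * (‖w‖ ^ p * inner ℝ (unitVec z - unitVec w) y) : ℝ) : ℂ) * unitVec z +
      ((p * (‖w‖ ^ p) * inner ℝ (unitVec w) y : ℝ) : ℂ) * (unitVec z - unitVec w) := by
    unfold dPowNL
    rw [← hp, inner_sub_left]
    push_cast
    ring
  have iz : |inner ℝ (unitVec z) y| ≤ ‖y‖ :=
    (abs_real_inner_le_norm _ _).trans (mul_le_of_le_one_left (norm_nonneg _) (norm_unitVec_le z))
  have iw : |inner ℝ (unitVec w) y| ≤ ‖y‖ :=
    (abs_real_inner_le_norm _ _).trans (mul_le_of_le_one_left (norm_nonneg _) (norm_unitVec_le w))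
  have izw : |inner ℝ (unitVec z - unitVec w) y| ≤ ‖unitVec z - unitVec w‖ * ‖y‖ :=
    abs_real_inner_le_norm _ _
  have uz := norm_unitVec_le z
  have hwp0 : 0 ≤ ‖w‖ ^ p := Real.rpow_nonneg (norm_nonneg _) _
  have hp0 : 0 ≤ p := by linarith
  set m := ‖z - w‖ with hm
  have hm0 : 0 ≤ m := norm_nonneg _
  have t1 : |‖z‖ ^ p - ‖w‖ ^ p| * ‖y‖ ≤ p * Q * m * ‖y‖ := by gcongr
  have t2 : p * |‖z‖ ^ p - ‖w‖ ^ p| * |inner ℝ (unitVec z) y| * ‖unitVec z‖ ≤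
      p * (p * Q * m) * ‖y‖ * 1 := by gcongr
  have t3 : p * (‖w‖ ^ p * |inner ℝ (unitVec z - unitVec w) y|) * ‖unitVec z‖ ≤
      p * (2 * Q * m * ‖y‖) * 1 := by
    have : ‖w‖ ^ p * |inner ℝ (unitVec z - unitVec w) y| ≤ 2 * Q * m * ‖y‖ :=
      (mul_le_mul_of_nonneg_left izw hwp0).trans (by
        rw [← mul_assoc]
        exact mul_le_mul_of_nonneg_right hwp (norm_nonneg y))
    gcongr
  have t4 : p * ‖w‖ ^ p * |inner ℝ (unitVec w) y| * ‖unitVec z - unitVec w‖ ≤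
      p * (2 * Q * m) * ‖y‖ := by
    have : p * ‖w‖ ^ p * |inner ℝ (unitVec w) y| * ‖unitVec z - unitVec w‖ =
        p * (‖w‖ ^ p * ‖unitVec z - unitVec w‖) * |inner ℝ (unitVec w) y| := by ring
    rw [this]
    gcongr
  rw [hsplit]
  refine (norm_add_le _ _).trans ?_
  refine (add_le_add (norm_add₃_le) le_rfl).trans ?_
  simp only [norm_mul, Complex.norm_real, Real.norm_eq_abs, abs_of_nonneg hp0,
    abs_of_nonneg hwp0]
  linarith

lemma hasDerivAt_powNL_comp {σ : ℝ} (hσ : 1 / 2 ≤ σ) {γ : ℝ → ℂ} {γ' : ℂ} {t : ℝ}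
    (h : HasDerivAt γ γ' t) : HasDerivAt (fun s => powNL σ (γ s)) (dPowNL σ (γ t) γ') t := by
  have hn : HasDerivAt (fun s => ‖γ s‖ ^ 2) (2 * inner ℝ (γ t) γ') t := h.norm_sq
  by_cases h0 : γ t = 0
  -- At a zero of γ the power `(‖γ‖ ^ 2) ^ σ` need not be differentiable when σ < 1. It tends to 0,
  -- however, while γ(s) = O(s - t), so the product is o(s - t).
  · have hz : dPowNL σ (γ t) γ' = 0 := by
      simp [dPowNL, h0, unitVec, Real.zero_rpow (show 2 * σ ≠ 0 by linarith)]
    rw [hz, hasDerivAt_iff_isLittleO]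
    have hc : Filter.Tendsto (fun s => (((‖γ s‖ ^ 2) ^ σ : ℝ) : ℂ)) (nhds t) (nhds 0) := by
      have h1 : ContinuousAt (fun s => (((‖γ s‖ ^ 2) ^ σ : ℝ) : ℂ)) t :=
        Complex.continuous_ofReal.continuousAt.comp
          (hn.continuousAt.rpow_const (Or.inr (by linarith)))
      have h2 := h1.tendsto
      simpa [h0, Real.zero_rpow (show σ ≠ 0 by linarith)] using h2
    have hO := h.isBigO_sub
    simp only [h0, sub_zero] at hO
    have := ((Asymptotics.isLittleO_one_iff ℝ).2 hc).mul_isBigO hO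
    simp only [powNL, h0, mul_zero, sub_zero, smul_zero, one_mul] at this ⊢
    exact this
  · have hne : ‖γ t‖ ≠ 0 := norm_ne_zero_iff.2 h0
    have hr := (hn.rpow_const (p := σ) (Or.inl (pow_ne_zero 2 hne))).ofReal_comp
    refine (hr.mul h).congr_deriv ?_
    have e1 : (‖γ t‖ ^ 2) ^ σ = ‖γ t‖ ^ (2 * σ) := by
      rw [Real.rpow_mul (norm_nonneg _), Real.rpow_two]
    have e2 : ‖γ t‖ ^ 2 * (‖γ t‖ ^ 2) ^ (σ - 1) = ‖γ t‖ ^ (2 * σ) := by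
      rw [← e1, mul_comm, ← Real.rpow_add_one (pow_ne_zero 2 hne), sub_add_cancel]
    have e3 : inner ℝ (unitVec (γ t)) γ' = ‖γ t‖⁻¹ * inner ℝ (γ t) γ' := by
      rw [unitVec, ← Complex.real_smul, real_inner_smul_left]
    unfold dPowNL
    rw [e1, e3, ← e2, unitVec]
    have hne' : (‖γ t‖ : ℂ) ≠ 0 := by exact_mod_cast hne
    push_cast
    field_simp
    ring

/-- The power nonlinearity is of class `C^{1,1}` on bounded sets, in terms of mixed second
differences. -/
lemma norm_powNL_second_difference_le {σ R A B : ℝ} (hσ : 1 / 2 ≤ σ) {z₁ z₂ z₃ z₄ : ℂ}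
    (h1 : ‖z₁‖ ≤ R) (h2 : ‖z₂‖ ≤ R) (h3 : ‖z₃‖ ≤ R) (h4 : ‖z₄‖ ≤ R)
    (h24 : ‖z₂ - z₄‖ ≤ A) (h13 : ‖z₁ - z₃‖ ≤ A) (h34 : ‖z₃ - z₄‖ ≤ B) :
    ‖powNL σ z₁ - powNL σ z₂ - powNL σ z₃ + powNL σ z₄‖ ≤
      (1 + 2 * σ) * R ^ (2 * σ) * ‖z₁ - z₂ - z₃ + z₄‖ +
        2 * σ * R ^ (2 * σ - 1) * (5 + 2 * σ) * A * B := by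
  have hR : 0 ≤ R := (norm_nonneg _).trans h1
  have hline : ∀ (x y : ℂ) (t : ℝ), HasDerivAt (fun t : ℝ => x + t * (y - x)) (y - x) t := by
    intro x y t
    simpa using ((hasDerivAt_id t).ofReal_comp.mul_const (y - x)).const_add x
  have hball : ∀ {x y : ℂ} {M : ℝ} {t : ℝ}, ‖x‖ ≤ M → ‖y‖ ≤ M → t ∈ Icc (0 : ℝ) 1 →
      ‖x + t * (y - x)‖ ≤ M := by
    intro x y M t hx hy ht
    have e : x + t * (y - x) = ((1 - t : ℝ) : ℂ) * x + (t : ℂ) * y := by push_cast; ring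
    rw [e]
    refine (norm_add_le _ _).trans ?_
    rw [norm_mul, norm_mul, Complex.norm_real, Complex.norm_real, Real.norm_eq_abs,
      Real.norm_eq_abs, abs_of_nonneg ht.1, abs_of_nonneg (sub_nonneg.2 ht.2)]
    nlinarith [mul_le_mul_of_nonneg_left hx (sub_nonneg.2 ht.2), mul_le_mul_of_nonneg_left hy ht.1]
  -- The second difference is F(1) - F(0) for F comparing the nonlinearity along two segments. At
  -- equal parameters the segments are A apart, and the change of derivative acts on z₃ - z₄, of
  -- size B.
  set F : ℝ → ℂ := fun t => powNL σ (z₂ + t * (z₁ - z₂)) - powNL σ (z₄ + t * (z₃ - z₄)) with hF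
  have hmv := norm_image_sub_le_of_norm_deriv_le_segment_01' (f := F)
    (f' := fun t => dPowNL σ (z₂ + t * (z₁ - z₂)) (z₁ - z₂) -
      dPowNL σ (z₄ + t * (z₃ - z₄)) (z₃ - z₄))
    (C := (1 + 2 * σ) * R ^ (2 * σ) * ‖z₁ - z₂ - z₃ + z₄‖ +
        2 * σ * R ^ (2 * σ - 1) * (5 + 2 * σ) * A * B)
    (fun t _ => ((hasDerivAt_powNL_comp hσ (hline z₂ z₁ t)).sub
      (hasDerivAt_powNL_comp hσ (hline z₄ z₃ t))).hasDerivWithinAt)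
    (fun t ht => by
      have ht' := Ico_subset_Icc_self ht
      set x := z₂ + t * (z₁ - z₂)
      set y := z₄ + t * (z₃ - z₄)
      have hx : ‖x‖ ≤ R := hball h2 h1 ht'
      have hy : ‖y‖ ≤ R := hball h4 h3 ht'
      have hxy : ‖x - y‖ ≤ A := by
        have e : x - y = (z₂ - z₄) + t * ((z₁ - z₃) - (z₂ - z₄)) := by
          simp only [x, y]; ring
        rw [e]
        exact hball h24 h13 ht'
      have e : dPowNL σ x (z₁ - z₂) - dPowNL σ y (z₃ - z₄) =
          dPowNL σ x (z₁ - z₂ - z₃ + z₄) + (dPowNL σ x (z₃ - z₄) - dPowNL σ y (z₃ - z₄)) := by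
        have : z₁ - z₂ - z₃ + z₄ = (z₁ - z₂) - (z₃ - z₄) := by ring
        rw [this]
        simp only [dPowNL, inner_sub_right (unitVec x) (z₁ - z₂)]
        push_cast
        ring
      rw [e]
      refine (norm_add_le _ _).trans (add_le_add (norm_dPowNL_le hσ hx _) ?_)
      refine (norm_dPowNL_sub_le hσ hx hy _).trans ?_
      have h5 : 0 ≤ 2 * σ * R ^ (2 * σ - 1) * (5 + 2 * σ) := by
        have := Real.rpow_nonneg hR (2 * σ - 1)
        have : 0 ≤ σ := by linarith
        positivity
      have hA : 0 ≤ A := (norm_nonneg _).trans h24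
      gcongr)
  have e : F 1 - F 0 = powNL σ z₁ - powNL σ z₂ - powNL σ z₃ + powNL σ z₄ := by
    simp only [hF, Complex.ofReal_one, Complex.ofReal_zero, one_mul, zero_mul, add_zero]
    rw [add_sub_cancel, add_sub_cancel]
    ring
  rwa [e] at hmv

lemma continuous_powNL {σ : ℝ} (hσ : 0 ≤ σ) : Continuous (powNL σ) := by
  unfold powNL
  exact (Complex.continuous_ofReal.comp
    ((continuous_norm.pow 2).rpow_const fun _ => Or.inr hσ)).mul continuous_id

lemma opB_eq (V : ℝ → ℝ) (β σ : ℝ) (v : ℝ → ℂ) (x : ℝ) :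
    opB V β σ v x = (V x : ℂ) * v x + (β : ℂ) * powNL σ (v x) := by
  unfold opB powNL
  push_cast
  ring

/-! ### The nonlinearity as a map on L². -/

lemma norm_le_of_ae_le_add {a b : ℝ} (hab : a < b) {F m : L2 a b} {K D : ℝ} (hK : 0 ≤ K)
    (hD : 0 ≤ D) (h : ∀ᵐ x ∂(volume.restrict (Ioo a b)), ‖F x‖ ≤ K * ‖m x‖ + D) :
    ‖F‖ ≤ K * ‖m‖ + D * Real.sqrt (b - a) := by
  have hc : MemLp (fun _ : ℝ => (D : ℂ)) 2 (volume.restrict (Ioo a b)) := memLp_const _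
  have hm : MemLp (fun x : ℝ => ((K * ‖m x‖ : ℝ) : ℂ)) 2 (volume.restrict (Ioo a b)) :=
    ((Lp.memLp m).norm.const_mul K).ofReal
  have hF : ‖F‖ ≤ ‖hm.toLp _ + hc.toLp _‖ := by
    refine Lp.norm_le_norm_of_ae_le ?_
    filter_upwards [h, Lp.coeFn_add (hm.toLp _) (hc.toLp _), hm.coeFn_toLp, hc.coeFn_toLp]
      with x h1 h2 h3 h4
    rw [h2, Pi.add_apply, h3, h4, ← Complex.ofReal_add, Complex.norm_real, Real.norm_eq_abs,
      abs_of_nonneg (by positivity)]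
    exact h1
  refine hF.trans ((norm_add_le _ _).trans (add_le_add ?_ ?_))
  · refine Lp.norm_le_mul_norm_of_ae_le_mul ?_
    filter_upwards [hm.coeFn_toLp] with x hx
    rw [hx, Complex.norm_real, Real.norm_eq_abs, abs_of_nonneg (by positivity)]
  · refine abs_le_of_sq_le_sq' ?_ (by positivity) |>.2
    rw [norm_sq_eq_integral, mul_pow, Real.sq_sqrt (sub_pos.2 hab).le]
    have : ∫ x in Ioo a b, ‖(hc.toLp _ : L2 a b) x‖ ^ 2 = ∫ _ in Ioo a b, D ^ 2 := by
      refine integral_congr_ae ?_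
      filter_upwards [hc.coeFn_toLp] with x hx
      rw [hx, Complex.norm_real, Real.norm_eq_abs, sq_abs]
    rw [this, setIntegral_const, measureReal_def, Real.volume_Ioo,
      ENNReal.toReal_ofReal (sub_pos.2 hab).le, smul_eq_mul, mul_comm]

lemma memLp_opB {a b : ℝ} {V : ℝ → ℝ} {β σ M R : ℝ} (hσ : 1 / 2 ≤ σ)
    (hVm : AEStronglyMeasurable V (volume.restrict (Ioo a b)))
    (hV : ∀ᵐ x ∂(volume.restrict (Ioo a b)), |V x| ≤ M) {u : L2 a b}
    (hu : ∀ᵐ x ∂(volume.restrict (Ioo a b)), ‖u x‖ ≤ R) :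
    MemLp (opB V β σ u) 2 (volume.restrict (Ioo a b)) := by
  have hum : AEStronglyMeasurable u (volume.restrict (Ioo a b)) := (Lp.memLp u).1
  have hm : AEStronglyMeasurable (opB V β σ u) (volume.restrict (Ioo a b)) := by
    have : opB V β σ u = fun x => (V x : ℂ) * u x + (β : ℂ) * powNL σ (u x) :=
      funext fun x => opB_eq V β σ u x
    rw [this]
    exact ((Complex.continuous_ofReal.comp_aestronglyMeasurable hVm).mul hum).add
      (((continuous_powNL (by linarith)).comp_aestronglyMeasurable hum).const_mul _)
  refine MemLp.of_bound hm (M * R + |β| * ((R ^ 2) ^ σ * R)) ?_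
  filter_upwards [hV, hu] with x h1 h2
  have hR : 0 ≤ R := (norm_nonneg _).trans h2
  rw [opB_eq]
  refine (norm_add_le _ _).trans (add_le_add ?_ ?_)
  · rw [norm_mul, Complex.norm_real]
    exact mul_le_mul h1 h2 (norm_nonneg _) ((abs_nonneg _).trans h1)
  · rw [norm_mul, Complex.norm_real, powNL, norm_mul, Complex.norm_real, Real.norm_eq_abs,
      Real.norm_eq_abs, abs_of_nonneg (Real.rpow_nonneg (sq_nonneg ‖u x‖) σ)]
    have : (‖u x‖ ^ 2) ^ σ ≤ (R ^ 2) ^ σ :=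
      Real.rpow_le_rpow (by positivity) (by gcongr) (by linarith)
    gcongr

open Classical in
/-- The nonlinearity as a map on `L²(a, b)` (with value `0` where the result is not in `L²`). -/
def nonlin (a b : ℝ) (V : ℝ → ℝ) (β σ : ℝ) (u : L2 a b) : L2 a b :=
  if h : MemLp (opB V β σ u) 2 (volume.restrict (Ioo a b)) then h.toLp _ else 0

lemma coeFn_nonlin {a b : ℝ} {V : ℝ → ℝ} {β σ M R : ℝ} (hσ : 1 / 2 ≤ σ)
    (hVm : AEStronglyMeasurable V (volume.restrict (Ioo a b)))
    (hV : ∀ᵐ x ∂(volume.restrict (Ioo a b)), |V x| ≤ M) {u : L2 a b}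
    (hu : ∀ᵐ x ∂(volume.restrict (Ioo a b)), ‖u x‖ ≤ R) :
    ∀ᵐ x ∂(volume.restrict (Ioo a b)), nonlin a b V β σ u x = opB V β σ u x := by
  have h := memLp_opB (β := β) hσ hVm hV hu
  rw [nonlin, dif_pos h]
  exact h.coeFn_toLp

/-- Mixed second differences of the nonlinearity in `L²`. -/
lemma exists_norm_nonlin_second_difference_le {a b : ℝ} (hab : a < b) {V : ℝ → ℝ} {β σ M : ℝ}
    (hσ : 1 / 2 ≤ σ) (hVm : AEStronglyMeasurable V (volume.restrict (Ioo a b)))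
    (hV : ∀ᵐ x ∂(volume.restrict (Ioo a b)), |V x| ≤ M) {R : ℝ} (hR : 0 ≤ R) (hM : 0 ≤ M) :
    ∃ K ≥ 0, ∃ D ≥ 0, ∀ (u₁ u₂ u₃ u₄ : L2 a b) (A B : ℝ), 0 ≤ A → 0 ≤ B →
      (∀ᵐ x ∂(volume.restrict (Ioo a b)), ‖u₁ x‖ ≤ R) →
      (∀ᵐ x ∂(volume.restrict (Ioo a b)), ‖u₂ x‖ ≤ R) →
      (∀ᵐ x ∂(volume.restrict (Ioo a b)), ‖u₃ x‖ ≤ R) →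
      (∀ᵐ x ∂(volume.restrict (Ioo a b)), ‖u₄ x‖ ≤ R) →
      (∀ᵐ x ∂(volume.restrict (Ioo a b)), ‖u₂ x - u₄ x‖ ≤ A) →
      (∀ᵐ x ∂(volume.restrict (Ioo a b)), ‖u₁ x - u₃ x‖ ≤ A) →
      (∀ᵐ x ∂(volume.restrict (Ioo a b)), ‖u₃ x - u₄ x‖ ≤ B) →
      ‖nonlin a b V β σ u₁ - nonlin a b V β σ u₂ - nonlin a b V β σ u₃ + nonlin a b V β σ u₄‖ ≤
        K * ‖u₁ - u₂ - u₃ + u₄‖ + D * (A * B) := by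
  have hσ0 : 0 ≤ σ := by linarith
  have hR1 : 0 ≤ R ^ (2 * σ) := Real.rpow_nonneg hR _
  have hR2 : 0 ≤ R ^ (2 * σ - 1) := Real.rpow_nonneg hR _
  set L := 2 * σ * R ^ (2 * σ - 1) * (5 + 2 * σ) with hL
  have hL0 : 0 ≤ L := by positivity
  refine ⟨M + |β| * ((1 + 2 * σ) * R ^ (2 * σ)), by positivity, |β| * L * Real.sqrt (b - a),
    by positivity, fun u₁ u₂ u₃ u₄ A B hA hB h1 h2 h3 h4 h24 h13 h34 => ?_⟩
  have key := norm_le_of_ae_le_add hab (F := nonlin a b V β σ u₁ - nonlin a b V β σ u₂ -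
    nonlin a b V β σ u₃ + nonlin a b V β σ u₄) (m := u₁ - u₂ - u₃ + u₄)
    (K := M + |β| * ((1 + 2 * σ) * R ^ (2 * σ))) (D := |β| * (L * A * B))
    (by positivity) (by positivity) ?_
  · refine key.trans (le_of_eq ?_)
    ring
  filter_upwards [h1, h2, h3, h4, h24, h13, h34, hV,
    coeFn_nonlin (β := β) hσ hVm hV h1, coeFn_nonlin (β := β) hσ hVm hV h2,
    coeFn_nonlin (β := β) hσ hVm hV h3, coeFn_nonlin (β := β) hσ hVm hV h4,
    Lp.coeFn_add (nonlin a b V β σ u₁ - nonlin a b V β σ u₂ - nonlin a b V β σ u₃)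
      (nonlin a b V β σ u₄),
    Lp.coeFn_sub (nonlin a b V β σ u₁ - nonlin a b V β σ u₂) (nonlin a b V β σ u₃),
    Lp.coeFn_sub (nonlin a b V β σ u₁) (nonlin a b V β σ u₂),
    Lp.coeFn_add (u₁ - u₂ - u₃) u₄, Lp.coeFn_sub (u₁ - u₂) u₃, Lp.coeFn_sub u₁ u₂]
    with x b1 b2 b3 b4 b24 b13 b34 bV c1 c2 c3 c4 e1 e2 e3 e4 e5 e6
  rw [e1, Pi.add_apply, e2, Pi.sub_apply, e3, Pi.sub_apply, e4, Pi.add_apply, e5, Pi.sub_apply,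
    e6, Pi.sub_apply, c1, c2, c3, c4]
  simp only [opB_eq]
  have hp := norm_powNL_second_difference_le hσ b1 b2 b3 b4 b24 b13 b34
  have e : (V x : ℂ) * u₁ x + β * powNL σ (u₁ x) - (V x * u₂ x + β * powNL σ (u₂ x)) -
      (V x * u₃ x + β * powNL σ (u₃ x)) + (V x * u₄ x + β * powNL σ (u₄ x)) =
      V x * (u₁ x - u₂ x - u₃ x + u₄ x) +
        β * (powNL σ (u₁ x) - powNL σ (u₂ x) - powNL σ (u₃ x) + powNL σ (u₄ x)) := by ring
  rw [e]
  refine (norm_add_le _ _).trans ?_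
  rw [norm_mul, norm_mul, Complex.norm_real, Complex.norm_real, Real.norm_eq_abs, Real.norm_eq_abs]
  have h5 := mul_le_mul_of_nonneg_right bV (norm_nonneg (u₁ x - u₂ x - u₃ x + u₄ x))
  have h6 := mul_le_mul_of_nonneg_left hp (abs_nonneg β)
  refine (add_le_add h5 h6).trans (le_of_eq ?_)
  rw [hL]
  ring

/-! ### Coefficient vectors, differences in time, and the regularity of the exact solution. -/

/-- Fourier coefficients in a finite set of modes, as a Euclidean vector. -/
def coeffVec {a b : ℝ} (hab : a < b) (S : Finset ℤ) : L2 a b →ₗ[ℂ] EuclideanSpace ℂ S :=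
  (WithLp.linearEquiv 2 ℂ (S → ℂ)).symm.toLinearMap ∘ₗ
    LinearMap.pi fun l : S => (fourierCLM hab (l : ℤ)).toLinearMap

@[simp] lemma coeffVec_apply {a b : ℝ} (hab : a < b) (S : Finset ℤ) (u : L2 a b) (l : S) :
    coeffVec hab S u l = fourierHat a b u l := rfl

lemma norm_coeffVec_le {a b : ℝ} (hab : a < b) (S : Finset ℤ) (u : L2 a b) :
    ‖coeffVec hab S u‖ ≤ Real.sqrt (1 / (b - a)) * ‖u‖ := by
  rw [EuclideanSpace.norm_eq]
  simp only [coeffVec_apply]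
  rw [Finset.sum_coe_sort S (fun l => ‖fourierHat a b u l‖ ^ 2)]
  refine (Real.sqrt_le_sqrt (sum_sq_fourierHat_le hab u S)).trans (le_of_eq ?_)
  rw [div_eq_mul_one_div, mul_comm, Real.sqrt_mul (by have := sub_pos.2 hab; positivity),
    Real.sqrt_sq (norm_nonneg _)]

lemma exists_lipschitz_of_contDiffOn {E : Type*} [NormedAddCommGroup E] [NormedSpace ℝ E]
    {f : ℝ → E} {T : ℝ} (hT : 0 < T) (hf : ContDiffOn ℝ 1 f (Icc 0 T)) :
    ∃ C ≥ 0, ∀ s ∈ Icc 0 T, ∀ t ∈ Icc 0 T, ‖f t - f s‖ ≤ C * |t - s| := by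
  have hc := hf.continuousOn_derivWithin (uniqueDiffOn_Icc hT) le_rfl
  obtain ⟨C, hC⟩ := isCompact_Icc.exists_bound_of_continuousOn hc
  refine ⟨C, (norm_nonneg _).trans (hC 0 ⟨le_rfl, hT.le⟩), fun s hs t ht => ?_⟩
  exact Convex.norm_image_sub_le_of_norm_derivWithin_le (hf.differentiableOn one_ne_zero) hC
    (convex_Icc 0 T) hs ht

/-- Mean value inequality in the k direction for s ↦ f(s+h) - f(s), whose derivative is O(h) because
f' is Lipschitz. -/
lemma exists_second_difference_le_of_contDiffOn {E : Type*} [NormedAddCommGroup E]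
    [NormedSpace ℝ E] {f : ℝ → E} {T : ℝ} (hT : 0 < T) (hf : ContDiffOn ℝ 2 f (Icc 0 T)) :
    ∃ C ≥ 0, ∀ t h k, 0 ≤ t → 0 ≤ h → 0 ≤ k → t + h + k ≤ T →
      ‖f (t + h + k) - f (t + h) - f (t + k) + f t‖ ≤ C * (h * k) := by
  obtain ⟨C, hC0, hC⟩ := exists_lipschitz_of_contDiffOn hT
    (hf.derivWithin (uniqueDiffOn_Icc hT) (m := 1) (by norm_num))
  refine ⟨C, hC0, fun t h k ht hh hk hT' => ?_⟩
  have hd : ∀ s ∈ Icc 0 T, HasDerivWithinAt f (derivWithin f (Icc 0 T) s) (Icc 0 T) s :=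
    fun s hs => (hf.differentiableOn (by norm_num) s hs).hasDerivWithinAt
  have hm := norm_image_sub_le_of_norm_deriv_le_segment' (a := t) (b := t + k)
    (f := fun s => f (s + h) - f s)
    (f' := fun s => derivWithin f (Icc 0 T) (s + h) - derivWithin f (Icc 0 T) s) (C := C * h)
    (fun s hs => by
      have h1 : s + h ∈ Icc 0 T := ⟨by linarith [hs.1], by linarith [hs.2]⟩
      have h2 : s ∈ Icc 0 T := ⟨by linarith [hs.1], by linarith [hs.2]⟩
      have e1 := (hd _ h1).scomp s (((hasDerivAt_id s).add_const h).hasDerivWithinAt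
        (s := Icc t (t + k))) (fun y (hy : y ∈ Icc t (t + k)) =>
          show y + h ∈ Icc 0 T from ⟨by linarith [hy.1], by linarith [hy.2]⟩)
      rw [one_smul] at e1
      exact e1.sub ((hd s h2).mono (Icc_subset_Icc ht (by linarith))))
    (fun s hs => by
      refine (hC s ⟨by linarith [hs.1], by linarith [hs.2]⟩ (s + h)
        ⟨by linarith [hs.1], by linarith [hs.2]⟩).trans (le_of_eq ?_)
      rw [add_sub_cancel_left, abs_of_nonneg hh])
    (t + k) ⟨by linarith, le_rfl⟩
  have e : f (t + h + k) - f (t + h) - f (t + k) + f t =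
      f (t + k + h) - f (t + k) - (f (t + h) - f t) := by
    rw [add_right_comm t h k]; abel
  rw [e]
  refine hm.trans (le_of_eq ?_)
  ring

/-- Uniform bounds for the exact solution that follow from its space-time regularity. -/
structure Regular (a b T : ℝ) (ψ : ℝ → L2 a b) (R A D : ℝ) : Prop where
  sum_le : ∀ t ∈ Icc 0 T, ∀ s : Finset ℤ, ∑ l ∈ s, ‖fourierHat a b (ψ t) l‖ ≤ R
  ae_sub_le : ∀ s ∈ Icc 0 T, ∀ t ∈ Icc 0 T,
    ∀ᵐ x ∂(volume.restrict (Ioo a b)), ‖ψ t x - ψ s x‖ ≤ A * |t - s|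
  second_difference_le : ∀ t h k, 0 ≤ t → 0 ≤ h → 0 ≤ k → t + h + k ≤ T →
    ‖ψ (t + h + k) - ψ (t + h) - ψ (t + k) + ψ t‖ ≤ A * (h * k)
  norm_sub_le : ∀ s ∈ Icc 0 T, ∀ t ∈ Icc 0 T, ‖ψ t - ψ s‖ ≤ A * |t - s|
  weight_le : ∀ t ∈ Icc 0 T, ∀ s : Finset ℤ,
    ∑ l ∈ s, freq a b l ^ 8 * ‖fourierHat a b (ψ t) l‖ ^ 2 ≤ D
  weakDeriv : ∀ t ∈ Icc 0 T, ∃ v : L2 a b, IsWeakDeriv a b (ψ t) v ∧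
    ∀ l, fourierHat a b v l = Complex.I * freq a b l * fourierHat a b (ψ t) l

lemma exists_regular {a b : ℝ} (hab : a < b) {T : ℝ} (hT : 0 < T) {ψ : ℝ → L2 a b}
    (hreg0 : MemCk 0 T (SobolevPer a b 4) ψ) (hreg1 : MemCk 1 T (Sobolev a b 2) ψ)
    (hreg2 : ContDiffOn ℝ 2 ψ (Icc 0 T)) :
    ∃ R > 0, ∃ A > 0, ∃ D > 0, Regular a b T ψ R A D := by
  obtain ⟨C, hC, hsum⟩ := exists_sum_norm_fourierHat_le hab
  obtain ⟨Ψ, hΨ, hΨψ⟩ := hreg0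
  obtain ⟨Φ, hΦ, hΦψ⟩ := hreg1
  obtain ⟨M, hM⟩ := isCompact_Icc.exists_bound_of_continuousOn hΨ.continuousOn
  have hM0 : 0 ≤ M := (norm_nonneg _).trans (hM 0 ⟨le_rfl, hT.le⟩)
  obtain ⟨L₁, hL₁, hLip⟩ := exists_lipschitz_of_contDiffOn hT (by exact_mod_cast hΦ)
  obtain ⟨L₂, hL₂, hLip2⟩ := exists_lipschitz_of_contDiffOn hT (hreg2.of_le (by norm_num))
  obtain ⟨L₃, hL₃, hsec⟩ := exists_second_difference_le_of_contDiffOn hT hreg2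
  have hba := sub_pos.2 hab
  have hΨn : ∀ t ∈ Icc 0 T, ∀ k, ‖(Ψ t : Jet a b 4) k‖ ≤ M := fun t ht k =>
    (PiLp.norm_apply_le (Ψ t : Jet a b 4) k).trans (hM t ht)
  have hΨw : ∀ t, ∀ k : Fin 4,
      IsWeakDeriv a b ((Ψ t : Jet a b 4) k.castSucc) ((Ψ t : Jet a b 4) k.succ) :=
    fun t => (Ψ t).2.1
  have hΨe : ∀ t, ∀ k : Fin 4, HasEqualEndpoints a b ((Ψ t : Jet a b 4) k.castSucc) :=
    fun t => (Ψ t).2.2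
  have hend : ∀ t ∈ Icc 0 T, HasEqualEndpoints a b (ψ t) := fun t ht => by
    rw [← hΨψ t ht]; exact hΨe t 0
  have hw : ∀ t ∈ Icc 0 T, IsWeakDeriv a b (ψ t) ((Ψ t : Jet a b 4) 1) := fun t ht => by
    rw [← hΨψ t ht]; exact hΨw t 0
  refine ⟨C * (M + M) + 1, by positivity, C * (L₁ + L₁) + L₂ + L₃ + 1, by positivity,
    M ^ 2 / (b - a) + 1, by positivity, ?_, ?_, ?_, ?_, ?_, ?_⟩
  · intro t ht s
    refine (hsum _ _ (hw t ht) (hend t ht) s).trans ?_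
    have h0 : ‖ψ t‖ ≤ M := by rw [← hΨψ t ht]; exact hΨn t ht 0
    have h1 := hΨn t ht 1
    have : C * (‖ψ t‖ + ‖(Ψ t : Jet a b 4) 1‖) ≤ C * (M + M) := by gcongr
    linarith
  · intro s hs t ht
    set e : Sobolev a b 2 := Φ t - Φ s
    have he : ‖e‖ ≤ L₁ * |t - s| := hLip s hs t ht
    have e0 : (e : Jet a b 2) 0 = ψ t - ψ s := by
      rw [← hΦψ t ht, ← hΦψ s hs]; rfl
    have hwd : IsWeakDeriv a b (ψ t - ψ s) ((e : Jet a b 2) 1) := by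
      rw [← e0]; exact e.2 0
    -- The C¹ regularity is in H² without periodicity, so equality at the end points is taken from
    -- the H⁴_per values at s and t.
    have hee : HasEqualEndpoints a b (ψ t - ψ s) := by
      have := (hend t ht).add ((hend s hs).smul (-1))
      rwa [neg_one_smul, ← sub_eq_add_neg] at this
    have n0 : ‖ψ t - ψ s‖ ≤ L₁ * |t - s| := by
      rw [← e0]; exact (PiLp.norm_apply_le (e : Jet a b 2) 0).trans he
    have n1 : ‖(e : Jet a b 2) 1‖ ≤ L₁ * |t - s| :=
      (PiLp.norm_apply_le (e : Jet a b 2) 1).trans he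
    have hae := ae_norm_le_of_sum_fourierHat_le hab _ (hsum _ _ hwd hee)
    filter_upwards [hae, Lp.coeFn_sub (ψ t) (ψ s)] with x h1 h2
    rw [h2, Pi.sub_apply] at h1
    refine h1.trans ?_
    have h3 : C * (‖ψ t - ψ s‖ + ‖(e : Jet a b 2) 1‖) ≤ C * (L₁ * |t - s| + L₁ * |t - s|) := by
      gcongr
    have h4 : 0 ≤ (L₂ + L₃ + 1) * |t - s| := by positivity
    linarith
  · intro t h k ht hh hk hT'
    refine (hsec t h k ht hh hk hT').trans ?_
    gcongr
    have : 0 ≤ C * (L₁ + L₁) := by positivity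
    linarith
  · intro s hs t ht
    refine (hLip2 s hs t ht).trans ?_
    gcongr
    have : 0 ≤ C * (L₁ + L₁) := by positivity
    linarith
  · intro t ht s
    have f1 := fun l => (hΨw t 0).fourierHat_eq hab (hΨe t 0) l
    have f2 := fun l => (hΨw t 1).fourierHat_eq hab (hΨe t 1) l
    have f3 := fun l => (hΨw t 2).fourierHat_eq hab (hΨe t 2) l
    have f4 := fun l => (hΨw t 3).fourierHat_eq hab (hΨe t 3) l
    have hn : ∀ l, freq a b l ^ 8 * ‖fourierHat a b (ψ t) l‖ ^ 2 =
        ‖fourierHat a b ((Ψ t : Jet a b 4) 4) l‖ ^ 2 := by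
      intro l
      have g1 : fourierHat a b ((Ψ t : Jet a b 4) 1) l =
        Complex.I * freq a b l * fourierHat a b (ψ t) l := by rw [← hΨψ t ht]; exact f1 l
      have g2 : fourierHat a b ((Ψ t : Jet a b 4) 2) l =
        Complex.I * freq a b l * fourierHat a b ((Ψ t : Jet a b 4) 1) l := f2 l
      have g3 : fourierHat a b ((Ψ t : Jet a b 4) 3) l =
        Complex.I * freq a b l * fourierHat a b ((Ψ t : Jet a b 4) 2) l := f3 l
      have g4 : fourierHat a b ((Ψ t : Jet a b 4) 4) l =
        Complex.I * freq a b l * fourierHat a b ((Ψ t : Jet a b 4) 3) l := f4 l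
      rw [g4, g3, g2, g1]
      simp only [norm_mul, Complex.norm_I, one_mul, Complex.norm_real, Real.norm_eq_abs, mul_pow,
        sq_abs]
      ring
    simp_rw [hn]
    refine (sum_sq_fourierHat_le hab _ s).trans ?_
    have := hΨn t ht 4
    have : ‖(Ψ t : Jet a b 4) 4‖ ^ 2 / (b - a) ≤ M ^ 2 / (b - a) := by gcongr
    linarith
  · intro t ht
    exact ⟨_, hw t ht, fun l => (hw t ht).fourierHat_eq hab (hend t ht) l⟩

lemma _root_.HasDerivAt.complexCLM_comp {E : Type*} [NormedAddCommGroup E] [NormedSpace ℂ E]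
    [NormedSpace ℝ E] [IsScalarTower ℝ ℂ E] (L : E →L[ℂ] ℂ) {f : ℝ → E} {f' : E} {t : ℝ}
    (h : HasDerivAt f f' t) : HasDerivAt (fun s => L (f s)) (L f') t :=
  (L.restrictScalars ℝ).hasFDerivAt.comp_hasDerivAt t h

/-- The coefficient functional applied to the equation; two uses of periodicity, for w and for its
first derivative, turn -Δ into μ_l². -/
lemma hasDerivAt_fourierHat_of_solvesNLS {a b : ℝ} (hab : a < b) {V : ℝ → ℝ} {β σ T M R : ℝ}
    (hσ : 1 / 2 ≤ σ) (hVm : AEStronglyMeasurable V (volume.restrict (Ioo a b)))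
    (hV : ∀ᵐ x ∂(volume.restrict (Ioo a b)), |V x| ≤ M) {ψ : ℝ → L2 a b}
    (hsol : SolvesNLS a b V β σ T ψ) (hreg2 : ContDiffOn ℝ 2 ψ (Icc 0 T)) {t : ℝ}
    (ht : t ∈ Ioo 0 T) (hR : ∀ᵐ x ∂(volume.restrict (Ioo a b)), ‖ψ t x‖ ≤ R) (l : ℤ) :
    HasDerivAt (fun t => fourierHat a b (ψ t) l)
      (-Complex.I * (freq a b l : ℂ) ^ 2 * fourierHat a b (ψ t) l -
        Complex.I * fourierHat a b (nonlin a b V β σ (ψ t)) l) t := by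
  have hd : HasDerivAt ψ (deriv ψ t) t :=
    ((hreg2.differentiableOn (by norm_num)).differentiableAt
      (Icc_mem_nhds ht.1 ht.2)).hasDerivAt
  have h1 : HasDerivAt (fun t => fourierHat a b (ψ t) l) (fourierHat a b (deriv ψ t : L2 a b) l) t :=
    hd.complexCLM_comp (fourierCLM hab l)
  refine h1.congr_deriv ?_
  obtain ⟨w, hw, hw0, heq⟩ := hsol t ht
  have hL : Complex.I • deriv ψ t = -(w 2) + nonlin a b V β σ (ψ t) := by
    refine Lp.ext ?_
    filter_upwards [heq, Lp.coeFn_smul Complex.I (deriv ψ t),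
      Lp.coeFn_add (-(w 2)) (nonlin a b V β σ (ψ t)), Lp.coeFn_neg (w 2),
      coeFn_nonlin (β := β) hσ hVm hV hR] with x e1 e2 e3 e4 e5
    rw [e2, e3, Pi.smul_apply, Pi.add_apply, e4, Pi.neg_apply, e5, smul_eq_mul, e1]
  have hF : fourierCLM hab l (Complex.I • deriv ψ t) =
      fourierCLM hab l (-(w 2) + nonlin a b V β σ (ψ t)) := congrArg _ hL
  rw [map_smul, map_add, map_neg] at hF
  simp only [fourierCLM_apply, smul_eq_mul] at hF
  have g1 : fourierHat a b (w 1) l = Complex.I * freq a b l * fourierHat a b (w 0) l :=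
    (hw.1 0).fourierHat_eq hab (hw.2 0) l
  have g2 : fourierHat a b (w 2) l = Complex.I * freq a b l * fourierHat a b (w 1) l :=
    (hw.1 1).fourierHat_eq hab (hw.2 1) l
  rw [g2, g1, hw0] at hF
  have hI := Complex.I_sq
  linear_combination (-Complex.I) * hF + (fourierHat a b (deriv ψ t : L2 a b) l +
    Complex.I * (freq a b l : ℂ) ^ 2 * fourierHat a b (ψ t) l) * hI

lemma exists_bound_of_sobolevPer {a b : ℝ} {V : ℝ → ℝ}
    (hV : ∃ v ∈ SobolevPer a b 2,
      ∀ᵐ x ∂(volume.restrict (Ioo a b)), (v 0 : L2 a b) x = (V x : ℂ)) :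
    AEStronglyMeasurable V (volume.restrict (Ioo a b)) ∧
      ∃ M ≥ 0, ∀ᵐ x ∂(volume.restrict (Ioo a b)), |V x| ≤ M := by
  obtain ⟨v, hv, hvV⟩ := hV
  constructor
  · have h1 : AEStronglyMeasurable (fun x => (v 0 x).re) (volume.restrict (Ioo a b)) :=
      Complex.continuous_re.comp_aestronglyMeasurable (Lp.memLp (v 0)).1
    refine h1.congr ?_
    filter_upwards [hvV] with x hx
    rw [hx, Complex.ofReal_re]
  · obtain ⟨w, hw, hvw, -⟩ := hv.2 0
    obtain ⟨M, hM⟩ := isCompact_Icc.exists_bound_of_continuousOn hw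
    refine ⟨max M 0, le_max_right _ _, ?_⟩
    filter_upwards [hvV, hvw, ae_restrict_mem measurableSet_Ioo] with x h1 h2 h3
    have h4 := hM x (Ioo_subset_Icc_self h3)
    have h5 : w x = (V x : ℂ) := by rw [← h1, ← h2]; rfl
    rw [h5, Complex.norm_real] at h4
    exact h4.trans (le_max_left _ _)

/-! ### Diagonal multipliers on coefficient vectors. -/

section Diagonal
variable {ι : Type*}

/-- The diagonal operator with entries `m` on Euclidean space. -/
def diagMul (m : ι → ℂ) (v : EuclideanSpace ℂ ι) : EuclideanSpace ℂ ι :=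
  WithLp.toLp 2 fun l => m l * v l

@[simp] lemma diagMul_apply (m : ι → ℂ) (v : EuclideanSpace ℂ ι) (l : ι) :
    diagMul m v l = m l * v l := rfl

lemma norm_diagMul_le [Fintype ι] {m : ι → ℂ} {c : ℝ} (hc : 0 ≤ c) (hm : ∀ l, ‖m l‖ ≤ c)
    (v : EuclideanSpace ℂ ι) : ‖diagMul m v‖ ≤ c * ‖v‖ := by
  rw [EuclideanSpace.norm_eq, EuclideanSpace.norm_eq]
  refine abs_le_of_sq_le_sq' ?_ (by positivity) |>.2
  rw [mul_pow, Real.sq_sqrt (by positivity), Real.sq_sqrt (by positivity), Finset.mul_sum]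
  refine Finset.sum_le_sum fun l _ => ?_
  rw [diagMul_apply, norm_mul, mul_pow]
  gcongr
  exact hm l

lemma continuous_diagMul {m : ℝ → ι → ℂ} {v : ℝ → EuclideanSpace ℂ ι}
    (hm : ∀ l, Continuous fun s => m s l) (hv : Continuous v) :
    Continuous fun s => diagMul (m s) (v s) := by
  unfold diagMul
  refine (PiLp.continuous_toLp 2 _).comp (continuous_pi fun l => (hm l).mul ?_)
  exact (EuclideanSpace.proj (𝕜 := ℂ) l).continuous.comp hv

lemma intervalIntegral_euclidean_apply [Fintype ι] {v : ℝ → EuclideanSpace ℂ ι} (hv : Continuous v)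
    (a b : ℝ) (l : ι) : (∫ s in a..b, v s) l = ∫ s in a..b, v s l :=
  ((EuclideanSpace.proj (𝕜 := ℂ) l).intervalIntegral_comp_comm
    (hv.intervalIntegrable a b)).symm

end Diagonal

/-! ### Filter functions and variation of constants in one Fourier mode. -/

lemma norm_exp_neg_I_mul (x : ℝ) : ‖Complex.exp (-Complex.I * x)‖ = 1 := by
  have : -Complex.I * x = ((-x : ℝ) : ℂ) * Complex.I := by push_cast; ring
  rw [this, Complex.norm_exp_ofReal_mul_I]

lemma norm_exp_I_mul (x : ℝ) : ‖Complex.exp (Complex.I * x)‖ = 1 := by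
  rw [mul_comm, Complex.norm_exp_ofReal_mul_I]

lemma norm_phi1_le (x : ℝ) : ‖phi1 (-Complex.I * x)‖ ≤ 1 := by
  unfold phi1
  split_ifs with h
  · simp
  · have hx : x ≠ 0 := by rintro rfl; simp at h
    have h1 := Real.norm_exp_I_mul_ofReal_sub_one_le (x := -x)
    have e : -Complex.I * x = Complex.I * ((-x : ℝ) : ℂ) := by push_cast; ring
    rw [e, norm_div, norm_mul, Complex.norm_I, one_mul, Complex.norm_real]
    exact div_le_one_of_le₀ h1 (norm_nonneg _)

/-- The source of the filter φ_s: the symmetric integral with frozen nonlinearity is evaluated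
exactly. -/
lemma integral_cos_mul_eq_sinc (κ τ : ℝ) :
    ∫ s in (0 : ℝ)..τ, Real.cos (s * κ) = τ * Real.sinc (τ * κ) := by
  by_cases hκ : κ = 0
  · simp [hκ]
  by_cases hτ : τ = 0
  · simp [hτ]
  rw [intervalIntegral.integral_comp_mul_right _ hκ, integral_cos,
    Real.sinc_of_ne_zero (mul_ne_zero hτ hκ), zero_mul, Real.sin_zero, sub_zero, smul_eq_mul]
  field_simp

/-- The source of φ₁ in the starting step. -/
lemma exp_mul_integral_exp_eq_phi1 (κ τ : ℝ) :
    Complex.exp (-Complex.I * (τ * κ)) * ∫ s in (0 : ℝ)..τ, Complex.exp (Complex.I * (s * κ)) =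
      τ * phi1 (-Complex.I * (τ * κ)) := by
  by_cases hκ : κ = 0
  · simp [hκ, phi1]
  by_cases hτ : τ = 0
  · simp [hτ]
  have hc : Complex.I * (κ : ℂ) ≠ 0 := mul_ne_zero Complex.I_ne_zero (by exact_mod_cast hκ)
  have hτ' : (τ : ℂ) ≠ 0 := by exact_mod_cast hτ
  have hκ' : (κ : ℂ) ≠ 0 := by exact_mod_cast hκ
  have hne : -Complex.I * (τ * κ : ℂ) ≠ 0 :=
    mul_ne_zero (neg_ne_zero.2 Complex.I_ne_zero) (mul_ne_zero hτ' hκ')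
  have e : ∀ s : ℝ, Complex.exp (Complex.I * (s * κ)) = Complex.exp (Complex.I * κ * s) := by
    intro s; congr 1; ring
  simp_rw [e]
  rw [integral_exp_mul_complex hc, phi1, if_neg hne]
  have e2 : Complex.exp (-Complex.I * (τ * κ)) * Complex.exp (Complex.I * κ * τ) = 1 := by
    rw [← Complex.exp_add, Complex.exp_eq_one_iff]
    exact ⟨0, by push_cast; ring⟩
  have hI := Complex.I_ne_zero
  rw [mul_div_assoc', mul_sub, e2]
  simp only [Complex.ofReal_zero, mul_zero, Complex.exp_zero, mul_one]
  field_simp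
  ring

/-- Variation of constants over one time step, in one Fourier mode. -/
lemma duhamel_forward {κ τ T : ℝ} (hτ : 0 < τ) (hT : τ ≤ T) {p g : ℝ → ℂ} (hg : Continuous g)
    (hp : ContinuousOn p (Icc 0 T))
    (hd : ∀ t ∈ Ioo 0 T, HasDerivAt p (-Complex.I * κ * p t - Complex.I * g t) t) :
    p τ = Complex.exp (-Complex.I * (τ * κ)) * p 0 -
      Complex.I * τ * phi1 (-Complex.I * (τ * κ)) * g 0 +
      Complex.exp (-Complex.I * (τ * κ)) *
        ∫ s in (0 : ℝ)..τ, -Complex.I * Complex.exp (Complex.I * (s * κ)) * (g s - g 0) := by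
  have hexp : ∀ s : ℝ, HasDerivAt (fun s : ℝ => Complex.exp (Complex.I * (s * κ)))
      (Complex.I * κ * Complex.exp (Complex.I * (s * κ))) s := by
    intro s
    have h1 : HasDerivAt (fun s : ℝ => Complex.I * ((s : ℂ) * κ)) (Complex.I * κ) s := by
      simpa using ((hasDerivAt_id s).ofReal_comp.mul_const (κ : ℂ)).const_mul Complex.I
    exact h1.cexp.congr_deriv (by ring)
  have hcexp : Continuous fun s : ℝ => Complex.exp (Complex.I * (s * κ)) := by fun_prop
  have h1 := intervalIntegral.integral_eq_sub_of_hasDerivAt_of_le hτ.le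
    (f := fun s => Complex.exp (Complex.I * (s * κ)) * p s)
    (f' := fun s => -Complex.I * Complex.exp (Complex.I * (s * κ)) * (g s - g 0) +
      -Complex.I * g 0 * Complex.exp (Complex.I * (s * κ)))
    (hcexp.continuousOn.mul (hp.mono (Icc_subset_Icc le_rfl hT)))
    (fun s hs => by
      refine ((hexp s).fun_mul (hd s ⟨hs.1, hs.2.trans_le hT⟩)).congr_deriv ?_
      ring)
    ((Continuous.intervalIntegrable (by fun_prop) _ _))
  rw [intervalIntegral.integral_add (Continuous.intervalIntegrable (by fun_prop) _ _)
    (Continuous.intervalIntegrable (by fun_prop) _ _), intervalIntegral.integral_const_mul] at h1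
  have h2 := exp_mul_integral_exp_eq_phi1 κ τ
  have e2 : Complex.exp (-Complex.I * (τ * κ)) * Complex.exp (Complex.I * (τ * κ)) = 1 := by
    rw [← Complex.exp_add, Complex.exp_eq_one_iff]
    exact ⟨0, by push_cast; ring⟩
  simp only [Complex.ofReal_zero, zero_mul, mul_zero, Complex.exp_zero, one_mul] at h1
  linear_combination (-p τ) * e2 - Complex.exp (-Complex.I * (τ * κ)) * h1 +
    (-Complex.I * g 0) * h2

/-- Symmetric variation of constants over two time steps, in one Fourier mode. -/
lemma duhamel_symmetric {κ τ t T : ℝ} (hτ : 0 < τ) (ht : τ ≤ t) (htT : t + τ ≤ T) {p g : ℝ → ℂ}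
    (hg : Continuous g) (hp : ContinuousOn p (Icc 0 T))
    (hd : ∀ t ∈ Ioo 0 T, HasDerivAt p (-Complex.I * κ * p t - Complex.I * g t) t) :
    p (t + τ) = Complex.exp (-2 * Complex.I * (τ * κ)) * p (t - τ) -
      2 * Complex.I * τ * Complex.exp (-Complex.I * (τ * κ)) * (Real.sinc (τ * κ) : ℂ) * g t +
      Complex.exp (-Complex.I * (τ * κ)) *
        ((∫ s in (0 : ℝ)..τ, -Complex.I * (Real.cos (s * κ) : ℂ) *
            (g (t + s) - g t - g t + g (t - s))) +
          ∫ s in (0 : ℝ)..τ, (Real.sin (s * κ) : ℂ) * (g (t + s) - g (t - s))) := by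
  have hexp : ∀ (c : ℂ) (s : ℝ), HasDerivAt (fun s : ℝ => Complex.exp (c * (s * κ)))
      (c * κ * Complex.exp (c * (s * κ))) s := by
    intro c s
    have h1 : HasDerivAt (fun s : ℝ => c * ((s : ℂ) * κ)) (c * κ) s := by
      simpa using ((hasDerivAt_id s).ofReal_comp.mul_const (κ : ℂ)).const_mul c
    exact h1.cexp.congr_deriv (by ring)
  have hcexp : ∀ c : ℂ, Continuous fun s : ℝ => Complex.exp (c * (s * κ)) := by
    intro c; fun_prop
  have hcs : ∀ s : ℝ, Complex.exp (Complex.I * (s * κ)) =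
      (Real.cos (s * κ) : ℂ) + (Real.sin (s * κ) : ℂ) * Complex.I := by
    intro s
    rw [mul_comm, Complex.exp_mul_I]
    push_cast; ring
  have hcs' : ∀ s : ℝ, Complex.exp (-Complex.I * (s * κ)) =
      (Real.cos (s * κ) : ℂ) - (Real.sin (s * κ) : ℂ) * Complex.I := by
    intro s
    have : -Complex.I * (s * κ) = ((-(s * κ) : ℝ) : ℂ) * Complex.I := by push_cast; ring
    rw [this, Complex.exp_mul_I, ← Complex.ofReal_cos, ← Complex.ofReal_sin, Real.cos_neg,
      Real.sin_neg]
    push_cast; ring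
  -- The difference of the forward and backward twisted solutions vanishes at s = 0. The linear
  -- terms drop out of its derivative, which is -i cos(sκ)(g(t+s) + g(t-s)) + sin(sκ)(g(t+s) -
  -- g(t-s)). Splitting off 2g(t) from the sum produces the scheme's term.
  have h1 := intervalIntegral.integral_eq_sub_of_hasDerivAt_of_le hτ.le
    (f := fun s => Complex.exp (Complex.I * (s * κ)) * p (t + s) -
      Complex.exp (-Complex.I * (s * κ)) * p (t - s))
    (f' := fun s => -Complex.I * (Real.cos (s * κ) : ℂ) * (g (t + s) - g t - g t + g (t - s)) +
      (Real.sin (s * κ) : ℂ) * (g (t + s) - g (t - s)) +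
      -2 * Complex.I * g t * (Real.cos (s * κ) : ℂ))
    (by
      refine ((hcexp _).continuousOn.mul (hp.comp (by fun_prop) ?_)).sub
        ((hcexp _).continuousOn.mul (hp.comp (by fun_prop) ?_))
      · intro s hs
        exact ⟨by linarith [hs.1], by linarith [hs.2]⟩
      · intro s hs
        exact ⟨by linarith [hs.2], by linarith [hs.1]⟩)
    (fun s hs => by
      have d1 : HasDerivAt (fun s => p (t + s)) _ s :=
        (hd (t + s) ⟨by linarith [hs.1], by linarith [hs.2]⟩).comp_const_add t s
      have d2 : HasDerivAt (fun s => p (t - s)) _ s :=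
        (hd (t - s) ⟨by linarith [hs.2], by linarith [hs.1]⟩).comp_const_sub t s
      refine (((hexp _ s).fun_mul d1).fun_sub ((hexp _ s).fun_mul d2)).congr_deriv ?_
      rw [hcs, hcs']
      linear_combination (-(Real.sin (s * κ) : ℂ) * (g (t + s) - g (t - s))) * Complex.I_sq)
    (Continuous.intervalIntegrable (by fun_prop) _ _)
  rw [intervalIntegral.integral_add (Continuous.intervalIntegrable (by fun_prop) _ _)
    (Continuous.intervalIntegrable (by fun_prop) _ _),
    intervalIntegral.integral_add (Continuous.intervalIntegrable (by fun_prop) _ _)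
    (Continuous.intervalIntegrable (by fun_prop) _ _), intervalIntegral.integral_const_mul,
    intervalIntegral.integral_ofReal, integral_cos_mul_eq_sinc] at h1
  have e2 : Complex.exp (-Complex.I * (τ * κ)) * Complex.exp (Complex.I * (τ * κ)) = 1 := by
    rw [← Complex.exp_add, Complex.exp_eq_one_iff]
    exact ⟨0, by push_cast; ring⟩
  have e3 : Complex.exp (-2 * Complex.I * (τ * κ)) =
      Complex.exp (-Complex.I * (τ * κ)) * Complex.exp (-Complex.I * (τ * κ)) := by
    rw [← Complex.exp_add]; congr 1; ring
  simp only [Complex.ofReal_zero, zero_mul, mul_zero, Complex.exp_zero, one_mul, add_zero,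
    sub_zero, sub_self, Complex.ofReal_mul] at h1
  rw [e3]
  linear_combination (-p (t + τ)) * e2 - Complex.exp (-Complex.I * (τ * κ)) * h1

/-- Monotonicity of sine on [0, π/2]. The restriction τκ ≤ π/2 serves to exclude resonances, where
sin(τκ) vanishes while sin(sκ) does not. -/
lemma sin_mul_nonneg_le {κ τ s : ℝ} (hκ : 0 ≤ κ) (hκτ : τ * κ ≤ Real.pi / 2) (hs : 0 ≤ s)
    (hsτ : s ≤ τ) : 0 ≤ Real.sin (s * κ) ∧ Real.sin (s * κ) ≤ Real.sin (τ * κ) := by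
  have h0 : 0 ≤ s * κ := mul_nonneg hs hκ
  have h1 : s * κ ≤ τ * κ := mul_le_mul_of_nonneg_right hsτ hκ
  have hpi := Real.pi_pos
  exact ⟨Real.sin_nonneg_of_nonneg_of_le_pi h0 (by linarith),
    Real.sin_le_sin_of_le_of_le_pi_div_two (by linarith) hκτ h1⟩

/-! ### The corrector, local errors and the error recursion. -/

section ErrorRecursion
variable {ι : Type*} [Fintype ι]

/-- The multiplier `sin(sκ) / (2i sin(τκ))` of the corrector. -/
def corrMul (κ : ι → ℝ) (τ s : ℝ) (l : ι) : ℂ :=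
  ((Real.sin (s * κ l) / Real.sin (τ * κ l) / 2 : ℝ) : ℂ) * -Complex.I

lemma norm_corrMul_le {κ : ι → ℝ} {τ s : ℝ} (hκ : ∀ l, 0 ≤ κ l)
    (hκτ : ∀ l, τ * κ l ≤ Real.pi / 2) (hs : 0 ≤ s) (hsτ : s ≤ τ) (l : ι) :
    ‖corrMul κ τ s l‖ ≤ 1 / 2 := by
  obtain ⟨h1, h2⟩ := sin_mul_nonneg_le (hκ l) (hκτ l) hs hsτ
  rw [corrMul, norm_mul, norm_neg, Complex.norm_I, mul_one, Complex.norm_real, Real.norm_eq_abs,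
    abs_of_nonneg (div_nonneg (div_nonneg h1 (h1.trans h2)) zero_le_two)]
  exact div_le_div_of_nonneg_right (div_le_one_of_le₀ h2 (h1.trans h2)) zero_le_two

/-- The corrector which absorbs the part of the local error that is not of third order. -/
def corrector (κ : ι → ℝ) (τ : ℝ) (g : ℝ → EuclideanSpace ℂ ι) (t : ℝ) : EuclideanSpace ℂ ι :=
  ∫ s in (0 : ℝ)..τ, diagMul (corrMul κ τ s) (g (t + s) - g (t - s))

lemma continuous_corrector_integrand (κ : ι → ℝ) (τ : ℝ) {g : ℝ → EuclideanSpace ℂ ι}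
    (hg : Continuous g) (t : ℝ) :
    Continuous fun s => diagMul (corrMul κ τ s) (g (t + s) - g (t - s)) := by
  refine continuous_diagMul (fun l => ?_) (by fun_prop)
  unfold corrMul
  fun_prop

lemma norm_corrector_le {κ : ι → ℝ} {T τ L : ℝ} (hτ : 0 < τ) (hκ : ∀ l, 0 ≤ κ l)
    (hκτ : ∀ l, τ * κ l ≤ Real.pi / 2) {g : ℝ → EuclideanSpace ℂ ι} (hL0 : 0 ≤ L)
    (hL : ∀ s ∈ Icc 0 T, ∀ t ∈ Icc 0 T, ‖g t - g s‖ ≤ L * |t - s|) {t : ℝ}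
    (ht : t ∈ Icc τ (T - τ)) : ‖corrector κ τ g t‖ ≤ L * τ ^ 2 := by
  have h := intervalIntegral.norm_integral_le_of_norm_le_const (a := 0) (b := τ) (C := L * τ)
    (f := fun s => diagMul (corrMul κ τ s) (g (t + s) - g (t - s))) (fun s hs => by
      rw [uIoc_of_le hτ.le] at hs
      refine (norm_diagMul_le (by norm_num) (norm_corrMul_le hκ hκτ hs.1.le hs.2) _).trans ?_
      have h1 := hL (t - s) ⟨by linarith [ht.1, hs.2], by linarith [ht.2, hs.1]⟩ (t + s)
        ⟨by linarith [ht.1, hs.1], by linarith [ht.2, hs.2]⟩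
      rw [show t + s - (t - s) = 2 * s by ring, abs_of_pos (by linarith [hs.1])] at h1
      have h2 := mul_le_mul_of_nonneg_left hs.2 hL0
      linarith)
  rw [sub_zero, abs_of_pos hτ] at h
  exact h.trans (le_of_eq (by ring))

/-- Changing t to t' in g(t+s) - g(t-s) gives a mixed second difference based at t - s with
increments 2s and t' - t; this gains the factor t' - t over the size τ² of the corrector. -/
lemma norm_corrector_sub_le_of_le {κ : ι → ℝ} {T τ L : ℝ} (hτ : 0 < τ) (hκ : ∀ l, 0 ≤ κ l)
    (hκτ : ∀ l, τ * κ l ≤ Real.pi / 2) {g : ℝ → EuclideanSpace ℂ ι} (hg : Continuous g)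
    (hL0 : 0 ≤ L)
    (hL : ∀ t h k, 0 ≤ t → 0 ≤ h → 0 ≤ k → t + h + k ≤ T →
      ‖g (t + h + k) - g (t + h) - g (t + k) + g t‖ ≤ L * (h * k)) {t t' : ℝ}
    (ht : t ∈ Icc τ (T - τ)) (ht' : t' ∈ Icc τ (T - τ)) (htt' : t ≤ t') :
    ‖corrector κ τ g t' - corrector κ τ g t‖ ≤ L * τ ^ 2 * (t' - t) := by
  rw [corrector, corrector, ← intervalIntegral.integral_sub
    ((continuous_corrector_integrand κ τ hg t').intervalIntegrable _ _)
    ((continuous_corrector_integrand κ τ hg t).intervalIntegrable _ _)]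
  have h := intervalIntegral.norm_integral_le_of_norm_le_const (a := 0) (b := τ)
    (C := L * τ * (t' - t))
    (f := fun s => diagMul (corrMul κ τ s) (g (t' + s) - g (t' - s)) -
      diagMul (corrMul κ τ s) (g (t + s) - g (t - s))) (fun s hs => by
      rw [uIoc_of_le hτ.le] at hs
      have e : diagMul (corrMul κ τ s) (g (t' + s) - g (t' - s)) -
          diagMul (corrMul κ τ s) (g (t + s) - g (t - s)) = diagMul (corrMul κ τ s)
            (g (t - s + 2 * s + (t' - t)) - g (t - s + 2 * s) - g (t - s + (t' - t)) +
              g (t - s)) := by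
        rw [show t - s + 2 * s + (t' - t) = t' + s by ring, show t - s + 2 * s = t + s by ring,
          show t - s + (t' - t) = t' - s by ring]
        ext l
        simp only [PiLp.sub_apply, PiLp.add_apply, diagMul_apply]
        ring
      rw [e]
      refine (norm_diagMul_le (by norm_num) (norm_corrMul_le hκ hκτ hs.1.le hs.2) _).trans ?_
      have h1 := hL (t - s) (2 * s) (t' - t) (by linarith [ht.1, hs.2]) (by linarith [hs.1])
        (by linarith) (by linarith [ht'.2, hs.2])
      have h2 := mul_le_mul_of_nonneg_left (mul_le_mul_of_nonneg_right hs.2 (sub_nonneg.2 htt')) hL0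
      linarith)
  rw [sub_zero, abs_of_pos hτ] at h
  exact h.trans (le_of_eq (by ring))

lemma norm_corrector_sub_le {κ : ι → ℝ} {T τ L : ℝ} (hτ : 0 < τ) (hκ : ∀ l, 0 ≤ κ l)
    (hκτ : ∀ l, τ * κ l ≤ Real.pi / 2) {g : ℝ → EuclideanSpace ℂ ι} (hg : Continuous g)
    (hL0 : 0 ≤ L)
    (hL : ∀ t h k, 0 ≤ t → 0 ≤ h → 0 ≤ k → t + h + k ≤ T →
      ‖g (t + h + k) - g (t + h) - g (t + k) + g t‖ ≤ L * (h * k)) {t t' : ℝ}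
    (ht : t ∈ Icc τ (T - τ)) (ht' : t' ∈ Icc τ (T - τ)) :
    ‖corrector κ τ g t' - corrector κ τ g t‖ ≤ L * τ ^ 2 * |t' - t| := by
  rcases le_total t t' with h | h
  · rw [abs_of_nonneg (sub_nonneg.2 h)]
    exact norm_corrector_sub_le_of_le hτ hκ hκτ hg hL0 hL ht ht' h
  · rw [norm_sub_rev, abs_sub_comm, abs_of_nonneg (sub_nonneg.2 h)]
    exact norm_corrector_sub_le_of_le hτ hκ hκτ hg hL0 hL ht' ht h

/-- The local error of the symmetric scheme, with its corrector. -/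
lemma exists_local_error {κ : ι → ℝ} {T τ L : ℝ} (hτ : 0 < τ) (hκ : ∀ l, 0 ≤ κ l)
    (hκτ : ∀ l, τ * κ l ≤ Real.pi / 2) {p g : ℝ → EuclideanSpace ℂ ι} (hg : Continuous g)
    (hp : ∀ l, ContinuousOn (fun t => p t l) (Icc 0 T))
    (hd : ∀ l, ∀ t ∈ Ioo 0 T,
      HasDerivAt (fun t => p t l) (-Complex.I * κ l * p t l - Complex.I * g t l) t)
    (hL0 : 0 ≤ L)
    (hL : ∀ t h k, 0 ≤ t → 0 ≤ h → 0 ≤ k → t + h + k ≤ T →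
      ‖g (t + h + k) - g (t + h) - g (t + k) + g t‖ ≤ L * (h * k)) {t : ℝ}
    (ht : t ∈ Icc τ (T - τ)) :
    ∃ A : EuclideanSpace ℂ ι, ‖A‖ ≤ L * τ ^ 3 ∧ ∀ l,
      p (t + τ) l = Complex.exp (-2 * Complex.I * (τ * κ l)) * p (t - τ) l -
        2 * Complex.I * τ * Complex.exp (-Complex.I * (τ * κ l)) * (Real.sinc (τ * κ l) : ℂ) *
          g t l + Complex.exp (-Complex.I * (τ * κ l)) * A l +
        (1 - Complex.exp (-2 * Complex.I * (τ * κ l))) * corrector κ τ g t l := by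
  have hcont : Continuous fun s => diagMul (fun l => -Complex.I * (Real.cos (s * κ l) : ℂ))
      (g (t + s) - g t - g t + g (t - s)) :=
    continuous_diagMul (fun l => by fun_prop) (by fun_prop)
  refine ⟨∫ s in (0 : ℝ)..τ, diagMul (fun l => -Complex.I * (Real.cos (s * κ l) : ℂ))
      (g (t + s) - g t - g t + g (t - s)), ?_, fun l => ?_⟩
  · have h := intervalIntegral.norm_integral_le_of_norm_le_const (a := 0) (b := τ) (C := L * τ ^ 2)
      (f := fun s => diagMul (fun l => -Complex.I * (Real.cos (s * κ l) : ℂ))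
        (g (t + s) - g t - g t + g (t - s))) (fun s hs => by
        rw [uIoc_of_le hτ.le] at hs
        refine (norm_diagMul_le zero_le_one (fun l => ?_) _).trans ?_
        · rw [norm_mul, norm_neg, Complex.norm_I, one_mul, Complex.norm_real]
          exact Real.abs_cos_le_one _
        have h1 := hL (t - s) s s (by linarith [ht.1, hs.2]) hs.1.le hs.1.le
          (by linarith [ht.2, hs.2])
        rw [show t - s + s + s = t + s by ring, show t - s + s = t by ring] at h1
        have h2 : s * s ≤ τ ^ 2 := by nlinarith [hs.1, hs.2]
        have h3 := mul_le_mul_of_nonneg_left h2 hL0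
        linarith)
    rw [sub_zero, abs_of_pos hτ] at h
    exact h.trans (le_of_eq (by ring))
  · have hgl : Continuous fun t => g t l := (EuclideanSpace.proj (𝕜 := ℂ) l).continuous.comp hg
    have h := duhamel_symmetric hτ ht.1 (by linarith [ht.2]) hgl (hp l) (hd l)
    rw [h, intervalIntegral_euclidean_apply hcont, corrector,
      intervalIntegral_euclidean_apply (continuous_corrector_integrand κ τ hg t)]
    simp only [diagMul_apply, PiLp.sub_apply, PiLp.add_apply]
    have h2 : ∫ s in (0 : ℝ)..τ, (Real.sin (s * κ l) : ℂ) * (g (t + s) l - g (t - s) l) =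
        2 * Complex.I * (Real.sin (τ * κ l) : ℂ) *
          ∫ s in (0 : ℝ)..τ, corrMul κ τ s l * (g (t + s) l - g (t - s) l) := by
      rw [← intervalIntegral.integral_const_mul]
      refine intervalIntegral.integral_congr fun s hs => ?_
      rw [uIcc_of_le hτ.le] at hs
      obtain ⟨m1, m2⟩ := sin_mul_nonneg_le (hκ l) (hκτ l) hs.1 hs.2
      have hsin : (Real.sin (s * κ l) : ℂ) =
          2 * Complex.I * (Real.sin (τ * κ l) : ℂ) * corrMul κ τ s l := by
        -- If the denominator of `corrMul` vanishes, so does sin(sκ), and the value 0 of the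
        -- quotient is the right one.
        by_cases h0 : Real.sin (τ * κ l) = 0
        · have : Real.sin (s * κ l) = 0 := le_antisymm (m2.trans h0.le) m1
          rw [this, h0]
          simp
        · have h0' : (Real.sin (τ * κ l) : ℂ) ≠ 0 := by exact_mod_cast h0
          rw [corrMul]
          simp only [Complex.ofReal_div, Complex.ofReal_ofNat]
          have hc := mul_div_cancel₀ (Real.sin (s * κ l) : ℂ) h0'
          linear_combination (Real.sin (s * κ l) : ℂ) * Complex.I_sq + Complex.I ^ 2 * hc
      simp only
      rw [hsin]
      ring
    rw [h2]
    -- This identity puts the odd part of the defect in the form Q - e^{-2iτκ}Q, which the two-step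
    -- propagation can absorb.
    have h3 : 1 - Complex.exp (-2 * Complex.I * (τ * κ l)) =
        Complex.exp (-Complex.I * (τ * κ l)) * (2 * Complex.I * (Real.sin (τ * κ l) : ℂ)) := by
      have e1 : Complex.exp (-2 * Complex.I * (τ * κ l)) =
          Complex.exp (-Complex.I * (τ * κ l)) * Complex.exp (-Complex.I * (τ * κ l)) := by
        rw [← Complex.exp_add]; congr 1; ring
      have e2 : Complex.exp (-Complex.I * (τ * κ l)) * Complex.exp ((τ * κ l) * Complex.I) = 1 := by
        rw [← Complex.exp_add, Complex.exp_eq_one_iff]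
        exact ⟨0, by push_cast; ring⟩
      have e3 : Complex.exp (-Complex.I * (τ * κ l)) = Complex.exp (-(τ * κ l) * Complex.I) := by
        congr 1; ring
      have e4 : 2 * Complex.I * (Real.sin (τ * κ l) : ℂ) =
          Complex.exp ((τ * κ l) * Complex.I) - Complex.exp (-Complex.I * (τ * κ l)) := by
        rw [Complex.ofReal_sin, Complex.sin, e3]
        push_cast
        linear_combination (Complex.exp (-(↑τ * ↑(κ l)) * Complex.I) -
          Complex.exp (↑τ * ↑(κ l) * Complex.I)) * Complex.I_sq
      rw [e1, e4, mul_sub, e2]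
    rw [h3]
    ring

/-- The local error of the first step. -/
lemma exists_local_error_first {κ : ι → ℝ} {T τ L : ℝ} (hτ : 0 < τ) (hτT : τ ≤ T)
    {p g : ℝ → EuclideanSpace ℂ ι} (hg : Continuous g)
    (hp : ∀ l, ContinuousOn (fun t => p t l) (Icc 0 T))
    (hd : ∀ l, ∀ t ∈ Ioo 0 T,
      HasDerivAt (fun t => p t l) (-Complex.I * κ l * p t l - Complex.I * g t l) t)
    (hL0 : 0 ≤ L) (hL : ∀ s ∈ Icc 0 T, ∀ t ∈ Icc 0 T, ‖g t - g s‖ ≤ L * |t - s|) :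
    ∃ A : EuclideanSpace ℂ ι, ‖A‖ ≤ L * τ ^ 2 ∧ ∀ l,
      p τ l = Complex.exp (-Complex.I * (τ * κ l)) * p 0 l -
        Complex.I * τ * phi1 (-Complex.I * (τ * κ l)) * g 0 l +
          Complex.exp (-Complex.I * (τ * κ l)) * A l := by
  have hcont : Continuous fun s : ℝ => diagMul
      (fun l => -Complex.I * Complex.exp (Complex.I * (s * κ l))) (g s - g 0) :=
    continuous_diagMul (fun l => by fun_prop) (by fun_prop)
  refine ⟨∫ s in (0 : ℝ)..τ, diagMul
      (fun l => -Complex.I * Complex.exp (Complex.I * (s * κ l))) (g s - g 0), ?_, fun l => ?_⟩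
  · have h := intervalIntegral.norm_integral_le_of_norm_le_const (a := 0) (b := τ) (C := L * τ)
      (f := fun s : ℝ => diagMul
      (fun l => -Complex.I * Complex.exp (Complex.I * (s * κ l))) (g s - g 0)) (fun s hs => by
        rw [uIoc_of_le hτ.le] at hs
        refine (norm_diagMul_le zero_le_one (fun l => ?_) _).trans ?_
        · have := norm_exp_I_mul (s * κ l)
          push_cast at this
          rw [norm_mul, norm_neg, Complex.norm_I, one_mul, this]
        have h1 := hL 0 ⟨le_rfl, by linarith⟩ s ⟨hs.1.le, hs.2.trans hτT⟩
        rw [sub_zero, abs_of_pos hs.1] at h1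
        have h3 := mul_le_mul_of_nonneg_left hs.2 hL0
        linarith)
    rw [sub_zero, abs_of_pos hτ] at h
    exact h.trans (le_of_eq (by ring))
  · have hgl : Continuous fun t => g t l := (EuclideanSpace.proj (𝕜 := ℂ) l).continuous.comp hg
    have h := duhamel_forward hτ hτT hgl (hp l) (hd l)
    rw [h, intervalIntegral_euclidean_apply hcont]
    simp only [diagMul_apply, PiLp.sub_apply]

/-- The recursion for the norm of the corrected error of the scheme. -/
lemma exists_error_recursion {κ : ι → ℝ} {T τ L₁ L₂ : ℝ} (hτ : 0 < τ) (hτT : 2 * τ ≤ T)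
    (hκ : ∀ l, 0 ≤ κ l) (hκτ : ∀ l, τ * κ l ≤ Real.pi / 2) {p g : ℝ → EuclideanSpace ℂ ι}
    (hg : Continuous g) (hp : ∀ l, ContinuousOn (fun t => p t l) (Icc 0 T))
    (hd : ∀ l, ∀ t ∈ Ioo 0 T,
      HasDerivAt (fun t => p t l) (-Complex.I * κ l * p t l - Complex.I * g t l) t)
    (hL₁0 : 0 ≤ L₁) (hL₁ : ∀ s ∈ Icc 0 T, ∀ t ∈ Icc 0 T, ‖g t - g s‖ ≤ L₁ * |t - s|)
    (hL₂0 : 0 ≤ L₂)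
    (hL₂ : ∀ t h k, 0 ≤ t → 0 ≤ h → 0 ≤ k → t + h + k ≤ T →
      ‖g (t + h + k) - g (t + h) - g (t + k) + g t‖ ≤ L₂ * (h * k)) :
    ∃ Q : ℕ → EuclideanSpace ℂ ι, (∀ n, ‖Q n‖ ≤ L₁ * τ ^ 2) ∧
      ∀ q r : ℕ → EuclideanSpace ℂ ι, q 0 = p 0 →
        (∀ l, q 1 l = Complex.exp (-Complex.I * (τ * κ l)) * q 0 l -
          Complex.I * τ * phi1 (-Complex.I * (τ * κ l)) * r 0 l) →
        (∀ n l, q (n + 2) l = Complex.exp (-2 * Complex.I * (τ * κ l)) * q n l -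
          2 * Complex.I * τ * Complex.exp (-Complex.I * (τ * κ l)) * (Real.sinc (τ * κ l) : ℂ) *
            r (n + 1) l) →
        ‖p τ - q 1‖ ≤ τ * ‖g 0 - r 0‖ + L₁ * τ ^ 2 ∧
        ∀ n : ℕ, ((n : ℝ) + 2) * τ ≤ T →
          ‖p ((n + 2) * τ) - q (n + 2) - Q (n + 2)‖ ≤ ‖p (n * τ) - q n - Q n‖ +
            2 * τ * ‖g ((n + 1) * τ) - r (n + 1)‖ + 3 * L₂ * τ ^ 3 := by
  have hE : ∀ l, ‖Complex.exp (-Complex.I * (τ * κ l))‖ ≤ 1 := fun l => by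
    have := norm_exp_neg_I_mul (τ * κ l)
    push_cast at this
    exact this.le
  have hE2 : ∀ l, ‖Complex.exp (-2 * Complex.I * (τ * κ l))‖ ≤ 1 := fun l => by
    have := norm_exp_neg_I_mul (2 * (τ * κ l))
    push_cast at this
    rw [show -2 * Complex.I * (τ * κ l) = -Complex.I * (2 * (τ * κ l)) by ring]
    exact this.le
  -- The corrector is controlled only for times in [τ, T - τ]. Clamping defines Q at all indices,
  -- including 0 and the last ones; being 1-Lipschitz, it keeps the increments at most τ. The middle
  -- index n + 1 of a step within [0, T] is unaffected.
  set clamp : ℕ → ℝ := fun n => max τ (min (n * τ) (T - τ)) with hclamp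
  have hcl : ∀ n, clamp n ∈ Icc τ (T - τ) := fun n =>
    ⟨le_max_left _ _, max_le (by linarith) (min_le_right _ _)⟩
  have hcl1 : ∀ n : ℕ, ((n : ℝ) + 2) * τ ≤ T → clamp (n + 1) = (n + 1) * τ := fun n hn => by
    have h1 : ((n + 1 : ℕ) : ℝ) * τ = (n + 1) * τ := by push_cast; ring
    have h2 : 0 ≤ (n : ℝ) * τ := by positivity
    simp only [hclamp, h1]
    rw [min_eq_left (by linarith), max_eq_right (by linarith)]
  have hcld : ∀ n, |clamp (n + 1) - clamp n| ≤ τ := fun n => by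
    have h1 : |clamp (n + 1) - clamp n| ≤
        |min (((n + 1 : ℕ) : ℝ) * τ) (T - τ) - min (n * τ) (T - τ)| := by
      simp only [hclamp, max_comm τ]
      exact abs_max_sub_max_le_abs _ _ _
    refine h1.trans ((abs_min_sub_min_le_max _ _ _ _).trans (max_le ?_ (by simp [hτ.le])))
    push_cast
    rw [show ((n : ℝ) + 1) * τ - n * τ = τ by ring, abs_of_pos hτ]
  refine ⟨fun n => corrector κ τ g (clamp n),
    fun n => norm_corrector_le hτ hκ hκτ hL₁0 hL₁ (hcl n), fun q r h0 h1 h2 => ⟨?_, fun n hn => ?_⟩⟩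
  · obtain ⟨A, hA, hAe⟩ := exists_local_error_first hτ (by linarith) hg hp hd hL₁0 hL₁
    have e : p τ - q 1 = diagMul (fun l => Complex.exp (-Complex.I * (τ * κ l))) A -
        diagMul (fun l => Complex.I * τ * phi1 (-Complex.I * (τ * κ l))) (g 0 - r 0) := by
      ext l
      simp only [PiLp.sub_apply, diagMul_apply]
      rw [hAe, h1, h0]
      ring
    rw [e]
    refine (norm_sub_le _ _).trans ?_
    have n1 := norm_diagMul_le zero_le_one hE A
    have n2 := norm_diagMul_le hτ.le (m := fun l => Complex.I * τ * phi1 (-Complex.I * (τ * κ l)))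
      (fun l => by
        have := norm_phi1_le (τ * κ l)
        push_cast at this
        rw [norm_mul, norm_mul, Complex.norm_I, one_mul, Complex.norm_real, Real.norm_eq_abs,
          abs_of_pos hτ]
        exact mul_le_of_le_one_right hτ.le this) (g 0 - r 0)
    linarith
  · have hc := hcl1 n hn
    obtain ⟨A, hA, hAe⟩ := exists_local_error hτ hκ hκτ hg hp hd hL₂0 hL₂ (hcl (n + 1))
    rw [hc, show ((n : ℝ) + 1) * τ + τ = (n + 2) * τ by ring,
      show ((n : ℝ) + 1) * τ - τ = n * τ by ring] at hAe
    -- The defect carries (1 - e^{-2iτκ})Q_{n+1}, whereas the corrected errors involve Q_{n+2} and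
    -- e^{-2iτκ}Q_n. The mismatch is two increments of Q; with A, these are the three contributions
    -- L₂τ³.
    have e : p ((n + 2) * τ) - q (n + 2) - corrector κ τ g (clamp (n + 2)) =
        diagMul (fun l => Complex.exp (-2 * Complex.I * (τ * κ l)))
          (p (n * τ) - q n - corrector κ τ g (clamp n)) -
        diagMul (fun l => 2 * Complex.I * τ * Complex.exp (-Complex.I * (τ * κ l)) *
          (Real.sinc (τ * κ l) : ℂ)) (g ((n + 1) * τ) - r (n + 1)) +
        diagMul (fun l => Complex.exp (-Complex.I * (τ * κ l))) A -
        diagMul (fun l => Complex.exp (-2 * Complex.I * (τ * κ l)))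
          (corrector κ τ g (clamp (n + 1)) - corrector κ τ g (clamp n)) -
        (corrector κ τ g (clamp (n + 2)) - corrector κ τ g (clamp (n + 1))) := by
      rw [hc]
      ext l
      simp only [PiLp.sub_apply, PiLp.add_apply, diagMul_apply]
      rw [hAe, h2]
      ring
    have n1 := norm_diagMul_le zero_le_one hE2 (p (n * τ) - q n - corrector κ τ g (clamp n))
    have n2 := norm_diagMul_le (c := 2 * τ) (by positivity)
      (m := fun l => 2 * Complex.I * τ * Complex.exp (-Complex.I * (τ * κ l)) *
          (Real.sinc (τ * κ l) : ℂ)) (fun l => by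
        rw [norm_mul, norm_mul, norm_mul, norm_mul, Complex.norm_I, Complex.norm_real,
          Complex.norm_real, Complex.norm_ofNat, Real.norm_eq_abs, Real.norm_eq_abs,
          abs_of_pos hτ, mul_one, mul_assoc]
        exact mul_le_of_le_one_right (by positivity)
          (mul_le_one₀ (hE l) (abs_nonneg _) (Real.abs_sinc_le_one _))) (g ((n + 1) * τ) - r (n + 1))
    have n3 := norm_diagMul_le zero_le_one hE A
    have n4 := norm_diagMul_le zero_le_one hE2
      (corrector κ τ g (clamp (n + 1)) - corrector κ τ g (clamp n))
    have hQ : ∀ m, ‖corrector κ τ g (clamp (m + 1)) - corrector κ τ g (clamp m)‖ ≤ L₂ * τ ^ 3 := by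
      intro m
      refine (norm_corrector_sub_le hτ hκ hκτ hg hL₂0 hL₂ (hcl m) (hcl (m + 1))).trans ?_
      refine (mul_le_mul_of_nonneg_left (hcld m) (by positivity)).trans (le_of_eq (by ring))
    have n5 := hQ n
    have n6 := hQ (n + 1)
    change ‖p ((n + 2) * τ) - q (n + 2) - corrector κ τ g (clamp (n + 2))‖ ≤ _
    rw [e]
    refine (norm_sub_le _ _).trans ?_
    refine (add_le_add ((norm_sub_le _ _).trans (add_le_add ((norm_add_le _ _).trans
      (add_le_add (norm_sub_le _ _) le_rfl)) le_rfl)) le_rfl).trans ?_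
    rw [show n + 1 + 1 = n + 2 from rfl] at n6
    linarith

end ErrorRecursion

/-! ### A two-step Gronwall inequality with bootstrap. -/

/-- Comparison with Aδ(1 + τ(c + B))ⁿ, where A ≥ 1 lets the source Bδ be treated as a multiple of
the comparison sequence. The recursion is assumed only when d (n+1) already satisfies the final
bound: the nonlinear estimate is available only while the numerical solution is known to be bounded.
-/
lemma two_step_gronwall {d : ℕ → ℝ} {A c B δ τ T : ℝ} (hτ : 0 ≤ τ) (hδ : 0 ≤ δ) (hc : 0 ≤ c)
    (hB : 0 ≤ B) (hA : 1 ≤ A) (h0 : d 0 ≤ A * δ) (h1 : d 1 ≤ A * δ)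
    (hstep : ∀ n : ℕ, ((n : ℝ) + 2) * τ ≤ T → d (n + 1) ≤ A * δ * Real.exp ((c + B) * T) →
      d (n + 2) ≤ d n + τ * (c * d (n + 1) + B * δ)) (n : ℕ) (hn : n * τ ≤ T) :
    d n ≤ A * δ * Real.exp ((c + B) * T) := by
  set P := 1 + τ * (c + B) with hP
  have hP1 : 1 ≤ P := by have : 0 ≤ τ * (c + B) := by positivity
                         linarith
  have hexp : ∀ n : ℕ, n * τ ≤ T → A * δ * P ^ n ≤ A * δ * Real.exp ((c + B) * T) := by
    intro n hn
    refine mul_le_mul_of_nonneg_left ?_ (by positivity)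
    have h2 : P ≤ Real.exp (τ * (c + B)) := by
      rw [hP, add_comm]; exact Real.add_one_le_exp _
    refine (pow_le_pow_left₀ (by linarith) h2 n).trans ?_
    rw [← Real.exp_nat_mul]
    refine Real.exp_le_exp.2 ?_
    have : (n * τ) * (c + B) ≤ T * (c + B) := mul_le_mul_of_nonneg_right hn (by positivity)
    linarith
  -- The induction carries two consecutive indices, as the recursion looks back two steps.
  have key : ∀ n : ℕ, (n * τ ≤ T → d n ≤ A * δ * P ^ n) ∧
      (((n + 1 : ℕ) : ℝ) * τ ≤ T → d (n + 1) ≤ A * δ * P ^ (n + 1)) := by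
    intro n
    induction n with
    | zero =>
      refine ⟨fun _ => by simpa using h0, fun _ => ?_⟩
      rw [zero_add, pow_one]
      exact h1.trans (le_mul_of_one_le_right (by positivity) hP1)
    | succ n ih =>
      refine ⟨ih.2, fun hn => ?_⟩
      push_cast at hn
      have hn2 : ((n : ℝ) + 2) * τ ≤ T := by linarith
      have hn1 : ((n + 1 : ℕ) : ℝ) * τ ≤ T := by push_cast; linarith
      have hn0 : (n : ℝ) * τ ≤ T := by linarith
      have i1 := ih.2 hn1
      have i0 := ih.1 hn0
      have hs := hstep n hn2 (i1.trans (hexp _ hn1))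
      have hPn : 1 ≤ P ^ (n + 1) := one_le_pow₀ hP1
      have e1 : A * δ * P ^ n ≤ A * δ * P ^ (n + 1) :=
        mul_le_mul_of_nonneg_left (pow_le_pow_right₀ hP1 (Nat.le_succ n)) (by positivity)
      have e2 : τ * (c * d (n + 1)) ≤ τ * (c * (A * δ * P ^ (n + 1))) := by gcongr
      have e3 : 1 * 1 ≤ A * P ^ (n + 1) := mul_le_mul hA hPn zero_le_one (by linarith)
      have e4 : τ * (B * δ) * 1 ≤ τ * (B * δ) * (A * P ^ (n + 1)) :=
        mul_le_mul_of_nonneg_left (by linarith) (by positivity)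
      have e5 : A * δ * P ^ (n + 1 + 1) = A * δ * P ^ (n + 1) +
          τ * (c * (A * δ * P ^ (n + 1))) + τ * (B * δ) * (A * P ^ (n + 1)) := by
        rw [pow_succ P (n + 1)]
        nth_rewrite 2 [hP]
        ring
      rw [e5]
      linarith
  exact ((key n).1 hn).trans (hexp n hn)

/-! ### Resolved and unresolved frequencies. -/

section Frequencies
variable {a b h : ℝ} {N : ℕ}

/-- Isolates the ratio 2l/N, of modulus at most 1 on the resolved modes and at least 1 on the others
when N is even. -/
lemma freq_eq (hab : a < b) (hN : 0 < N) (hh : h = (b - a) / N) (l : ℤ) :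
    freq a b l = Real.pi / h * ((2 * l : ℤ) / N) := by
  have := (sub_pos.2 hab).ne'
  have hN' : (N : ℝ) ≠ 0 := by exact_mod_cast hN.ne'
  rw [hh, freq]
  push_cast
  field_simp

lemma freq_sq_le_of_mem (hab : a < b) (hN : 0 < N) (hE : Even N) (hh : h = (b - a) / N) {l : ℤ}
    (hl : l ∈ indexSet N) : freq a b l ^ 2 ≤ (Real.pi / h) ^ 2 := by
  rw [freq_eq hab hN hh, mul_pow]
  refine mul_le_of_le_one_right (sq_nonneg _) ?_
  have hN' : (0 : ℝ) < N := by exact_mod_cast hN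
  rw [sq_le_one_iff_abs_le_one, abs_div, abs_of_pos hN', div_le_one hN']
  have : |2 * l| ≤ (N : ℤ) := by
    obtain ⟨k, hk⟩ := hE
    rw [indexSet, Finset.mem_Ico] at hl
    rw [abs_le]
    constructor <;> omega
  exact_mod_cast this

lemma one_le_sq_mul_freq_sq (hab : a < b) (hN : 0 < N) (hE : Even N) (hh : h = (b - a) / N)
    {l : ℤ} (hl : l ∉ indexSet N) : 1 ≤ h ^ 2 * freq a b l ^ 2 := by
  have hN' : (0 : ℝ) < N := by exact_mod_cast hN
  have hh0 : h ≠ 0 := by rw [hh]; exact (div_pos (sub_pos.2 hab) hN').ne'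
  have e : h ^ 2 * freq a b l ^ 2 = (Real.pi * ((2 * l : ℤ) / N)) ^ 2 := by
    rw [freq_eq hab hN hh]
    field_simp
  have h1 : (1 : ℝ) ≤ |((2 * l : ℤ) : ℝ) / N| := by
    rw [abs_div, abs_of_pos hN', one_le_div hN']
    have : (N : ℤ) ≤ |2 * l| := by
      obtain ⟨k, hk⟩ := hE
      rw [indexSet, Finset.mem_Ico] at hl
      rw [le_abs]
      omega
    exact_mod_cast this
  rw [e, one_le_sq_iff_one_le_abs, abs_mul, abs_of_pos Real.pi_pos]
  have := Real.pi_gt_three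
  nlinarith

lemma card_indexSet (hE : Even N) : (indexSet N).card = N := by
  obtain ⟨k, hk⟩ := hE
  rw [indexSet, Int.card_Ico]
  omega

end Frequencies

lemma sum_sq_eq_norm_sq {S : Finset ℤ} (f : ℤ → ℂ) {v : EuclideanSpace ℂ S}
    (hv : ∀ l : S, v l = f l) : ∑ l ∈ S, ‖f l‖ ^ 2 = ‖v‖ ^ 2 := by
  rw [EuclideanSpace.norm_eq, Real.sq_sqrt (by positivity), ← Finset.sum_coe_sort S]
  exact Finset.sum_congr rfl fun l _ => by rw [hv]

/-! ### Spatial approximation and inverse inequalities. -/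

section Approximation
variable {a b T R A D h : ℝ} {N : ℕ} {ψ : ℝ → L2 a b}

lemma Regular.nonneg_of_mem (hreg : Regular a b T ψ R A D) {t : ℝ} (ht : t ∈ Icc 0 T) : 0 ≤ D := by
  simpa using hreg.weight_le t ht ∅

lemma Regular.ae_le (hab : a < b) (hreg : Regular a b T ψ R A D) {t : ℝ} (ht : t ∈ Icc 0 T) :
    ∀ᵐ x ∂(volume.restrict (Ioo a b)), ‖ψ t x‖ ≤ R :=
  ae_norm_le_of_sum_fourierHat_le hab _ (hreg.sum_le t ht)

/-- On unresolved modes (hμ_l)⁸ ≥ 1, so the tail is at most h⁸ times the H⁴ weight; the resolved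
modes contribute e. -/
lemma Regular.norm_sub_trigL2_le (hreg : Regular a b T ψ R A D) (hab : a < b) (hN : 0 < N)
    (hE : Even N) (hh : h = (b - a) / N) {t : ℝ} (ht : t ∈ Icc 0 T) (c : ℤ → ℂ) {e : ℝ}
    (he0 : 0 ≤ e) (he : ∑ l ∈ indexSet N, ‖fourierHat a b (ψ t) l - c l‖ ^ 2 ≤ e ^ 2) :
    ‖ψ t - trigL2 a b N c‖ ≤ Real.sqrt (b - a) * (Real.sqrt D * h ^ 4 + e) := by
  have hba := sub_pos.2 hab
  have hD : 0 ≤ D := hreg.nonneg_of_mem ht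
  have h1 := norm_sub_trigL2_sq_le hab N (ψ t) c (A := h ^ 8 * D) fun s hs => by
    refine le_trans ?_ (mul_le_mul_of_nonneg_left (hreg.weight_le t ht s) (by positivity))
    rw [Finset.mul_sum]
    refine Finset.sum_le_sum fun l hl => ?_
    have h2 := one_le_pow₀ (n := 4)
      (one_le_sq_mul_freq_sq hab hN hE hh (Finset.disjoint_left.1 hs hl))
    have e : h ^ 8 * (freq a b l ^ 8 * ‖fourierHat a b (ψ t) l‖ ^ 2) =
        (h ^ 2 * freq a b l ^ 2) ^ 4 * ‖fourierHat a b (ψ t) l‖ ^ 2 := by ring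
    rw [e]
    exact le_mul_of_one_le_left (sq_nonneg _) h2
  refine abs_le_of_sq_le_sq' ?_ (by positivity) |>.2
  rw [mul_pow, Real.sq_sqrt hba.le]
  refine h1.trans (mul_le_mul_of_nonneg_left ?_ hba.le)
  have h3 : (Real.sqrt D * h ^ 4) ^ 2 = h ^ 8 * D := by
    rw [mul_pow, Real.sq_sqrt hD]; ring
  have h4 : 0 ≤ Real.sqrt D * h ^ 4 := by positivity
  nlinarith [mul_nonneg h4 he0]

/-- The derivative uses μ_l² of the weight μ_l⁸, leaving (hμ_l)⁶ for the tail; on resolved modes it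
costs the inverse-inequality factor π/h. -/
lemma Regular.norm_deriv_sub_trigL2_le (hreg : Regular a b T ψ R A D) (hab : a < b) (hN : 0 < N)
    (hE : Even N) (hh : h = (b - a) / N) {t : ℝ} (ht : t ∈ Icc 0 T) {v : L2 a b}
    (hv : ∀ l, fourierHat a b v l = Complex.I * freq a b l * fourierHat a b (ψ t) l)
    (c : ℤ → ℂ) {e : ℝ} (he0 : 0 ≤ e)
    (he : ∑ l ∈ indexSet N, ‖fourierHat a b (ψ t) l - c l‖ ^ 2 ≤ e ^ 2) :
    ‖v - trigL2 a b N (fun l => Complex.I * freq a b l * c l)‖ ≤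
      Real.sqrt (b - a) * (Real.sqrt D * h ^ 3 + Real.pi / h * e) := by
  have hba := sub_pos.2 hab
  have hN' : (0 : ℝ) < N := by exact_mod_cast hN
  have hh0 : 0 < h := by rw [hh]; positivity
  have hD : 0 ≤ D := hreg.nonneg_of_mem ht
  have hI : ∀ (μ : ℝ) (z : ℂ), ‖Complex.I * μ * z‖ ^ 2 = μ ^ 2 * ‖z‖ ^ 2 := fun μ z => by
    rw [norm_mul, norm_mul, Complex.norm_I, one_mul, Complex.norm_real, mul_pow, Real.norm_eq_abs,
      sq_abs]
  have h1 := norm_sub_trigL2_sq_le hab N v (fun l => Complex.I * freq a b l * c l)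
    (A := h ^ 6 * D) fun s hs => by
    refine le_trans ?_ (mul_le_mul_of_nonneg_left (hreg.weight_le t ht s) (by positivity))
    rw [Finset.mul_sum]
    refine Finset.sum_le_sum fun l hl => ?_
    have h2 := one_le_pow₀ (n := 3)
      (one_le_sq_mul_freq_sq hab hN hE hh (Finset.disjoint_left.1 hs hl))
    have e : h ^ 6 * (freq a b l ^ 8 * ‖fourierHat a b (ψ t) l‖ ^ 2) =
        (h ^ 2 * freq a b l ^ 2) ^ 3 * (freq a b l ^ 2 * ‖fourierHat a b (ψ t) l‖ ^ 2) := by ring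
    rw [e, hv, hI]
    exact le_mul_of_one_le_left (by positivity) h2
  have h2 : ∑ l ∈ indexSet N, ‖fourierHat a b v l - Complex.I * freq a b l * c l‖ ^ 2 ≤
      (Real.pi / h * e) ^ 2 := by
    rw [mul_pow]
    refine le_trans ?_ (mul_le_mul_of_nonneg_left he (sq_nonneg _))
    rw [Finset.mul_sum]
    refine Finset.sum_le_sum fun l hl => ?_
    rw [hv, ← mul_sub, hI]
    exact mul_le_mul_of_nonneg_right (freq_sq_le_of_mem hab hN hE hh hl) (sq_nonneg _)
  have hpi := Real.pi_pos
  refine abs_le_of_sq_le_sq' ?_ (by positivity) |>.2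
  rw [mul_pow, Real.sq_sqrt hba.le]
  refine h1.trans (mul_le_mul_of_nonneg_left ?_ hba.le)
  have h3 : (Real.sqrt D * h ^ 3) ^ 2 = h ^ 6 * D := by
    rw [mul_pow, Real.sq_sqrt hD]; ring
  have h4 : 0 ≤ Real.sqrt D * h ^ 3 := by positivity
  have h5 : 0 ≤ Real.pi / h * e := by positivity
  nlinarith [mul_nonneg h4 h5]

/-- Cauchy–Schwarz over the N resolved modes: an ℓ² error e adds at most √N e to the ℓ¹ norm. This
yields the sup bound for the numerical solution. -/
lemma Regular.sum_norm_coeff_le (hreg : Regular a b T ψ R A D) (hE : Even N) {t : ℝ}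
    (ht : t ∈ Icc 0 T) (c : ℤ → ℂ) {e : ℝ}
    (he : ∑ l ∈ indexSet N, ‖fourierHat a b (ψ t) l - c l‖ ^ 2 ≤ e ^ 2)
    (hsmall : N * e ^ 2 ≤ 1) : ∑ l ∈ indexSet N, ‖c l‖ ≤ R + 1 := by
  have h1 : ∑ l ∈ indexSet N, ‖c l‖ ≤ ∑ l ∈ indexSet N,
      (‖fourierHat a b (ψ t) l‖ + ‖fourierHat a b (ψ t) l - c l‖) :=
    Finset.sum_le_sum fun l _ => by
      have := _root_.norm_sub_le (fourierHat a b (ψ t) l) (fourierHat a b (ψ t) l - c l)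
      rwa [sub_sub_cancel] at this
  rw [Finset.sum_add_distrib] at h1
  refine h1.trans (add_le_add (hreg.sum_le t ht _) ?_)
  refine abs_le_of_sq_le_sq' ?_ zero_le_one |>.2
  refine sq_sum_le_card_mul_sum_sq.trans ?_
  rw [card_indexSet hE, one_pow]
  exact (mul_le_mul_of_nonneg_left he (Nat.cast_nonneg _)).trans hsmall

end Approximation

/-! ### Stability of the nonlinearity and convergence of the resolved coefficients. -/

lemma fourierHat_opB_trigPoly {a b : ℝ} {V : ℝ → ℝ} {β σ M R : ℝ} (hσ : 1 / 2 ≤ σ)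
    (hVm : AEStronglyMeasurable V (volume.restrict (Ioo a b)))
    (hV : ∀ᵐ x ∂(volume.restrict (Ioo a b)), |V x| ≤ M) {N : ℕ} {c : ℤ → ℂ}
    (hc : ∀ᵐ x ∂(volume.restrict (Ioo a b)), ‖trigL2 a b N c x‖ ≤ R) (l : ℤ) :
    fourierHat a b (opB V β σ (trigPoly a b N c)) l =
      fourierHat a b (nonlin a b V β σ (trigL2 a b N c)) l := by
  refine fourierHat_congr_ae ?_ l
  filter_upwards [coeFn_nonlin (β := β) hσ hVm hV hc, coeFn_trigL2 a b N c] with x h1 h2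
  rw [h1, opB, opB, h2]

lemma ae_norm_trigL2_le {a b R : ℝ} {N : ℕ} {c : ℤ → ℂ}
    (hc : ∑ l ∈ indexSet N, ‖c l‖ ≤ R) :
    ∀ᵐ x ∂(volume.restrict (Ioo a b)), ‖trigL2 a b N c x‖ ≤ R := by
  filter_upwards [coeFn_trigL2 a b N c] with x hx
  rw [hx]
  exact (norm_trigPoly_le a b N c x).trans hc

lemma exists_norm_nonlin_sub_le {a b : ℝ} (hab : a < b) {V : ℝ → ℝ} {β σ M : ℝ}
    (hσ : 1 / 2 ≤ σ) (hVm : AEStronglyMeasurable V (volume.restrict (Ioo a b)))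
    (hV : ∀ᵐ x ∂(volume.restrict (Ioo a b)), |V x| ≤ M) (hM : 0 ≤ M) {T : ℝ}
    {ψ : ℝ → L2 a b} {R A D : ℝ} (hR : 0 ≤ R) (hA : 0 ≤ A) (hreg : Regular a b T ψ R A D) :
    ∃ K ≥ 0, (∀ u w : L2 a b, (∀ᵐ x ∂(volume.restrict (Ioo a b)), ‖u x‖ ≤ R + 1) →
        (∀ᵐ x ∂(volume.restrict (Ioo a b)), ‖w x‖ ≤ R + 1) →
        ‖nonlin a b V β σ u - nonlin a b V β σ w‖ ≤ K * ‖u - w‖) ∧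
      ∃ L ≥ 0, ∀ t h k, 0 ≤ t → 0 ≤ h → 0 ≤ k → t + h + k ≤ T →
        ‖nonlin a b V β σ (ψ (t + h + k)) - nonlin a b V β σ (ψ (t + h)) -
          nonlin a b V β σ (ψ (t + k)) + nonlin a b V β σ (ψ t)‖ ≤ L * (h * k) := by
  obtain ⟨K, hK, E, hE, hKE⟩ := exists_norm_nonlin_second_difference_le (β := β) hab hσ hVm hV
    (R := R + 1) (by positivity) hM
  refine ⟨K, hK, fun u w hu hw => ?_, K * A + E * (A * A), by positivity,
    fun t h k ht hh hk hT => ?_⟩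
  -- The Lipschitz bound is the degenerate second difference with u₂ = u₃ = u₄ and B = 0, so that
  -- the A·B term disappears.
  · have h1 := hKE u w w w (2 * (R + 1)) 0 (by positivity) le_rfl hu hw hw hw
      (Filter.Eventually.of_forall fun x => by rw [sub_self, norm_zero]; positivity)
      (by
        filter_upwards [hu, hw] with x h1 h2
        exact (_root_.norm_sub_le _ _).trans (by linarith))
      (Filter.Eventually.of_forall fun x => by rw [sub_self, norm_zero])
    simpa using h1
  · have m1 : t ∈ Icc 0 T := ⟨ht, by linarith⟩
    have m2 : t + h ∈ Icc 0 T := ⟨by linarith, by linarith⟩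
    have m3 : t + k ∈ Icc 0 T := ⟨by linarith, by linarith⟩
    have m4 : t + h + k ∈ Icc 0 T := ⟨by linarith, by linarith⟩
    have hae : ∀ s ∈ Icc 0 T, ∀ᵐ x ∂(volume.restrict (Ioo a b)), ‖ψ s x‖ ≤ R + 1 := fun s hs => by
      filter_upwards [hreg.ae_le hab hs] with x hx
      linarith
    have d1 := hreg.ae_sub_le _ m1 _ m2
    have d2 := hreg.ae_sub_le _ m3 _ m4
    have d3 := hreg.ae_sub_le _ m1 _ m3
    rw [add_sub_cancel_left, abs_of_nonneg hh] at d1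
    rw [show t + h + k - (t + k) = h by ring, abs_of_nonneg hh] at d2
    rw [add_sub_cancel_left, abs_of_nonneg hk] at d3
    refine (hKE _ _ _ _ (A * h) (A * k) (by positivity) (by positivity) (hae _ m4) (hae _ m2)
      (hae _ m3) (hae _ m1) d1 d2 d3).trans ?_
    have h1 := mul_le_mul_of_nonneg_left (hreg.second_difference_le t h k ht hh hk hT) hK
    linarith

/-- Second order in time and fourth order in space for the resolved Fourier coefficients. -/
lemma exists_coeff_error_le {a b : ℝ} (hab : a < b) {V : ℝ → ℝ} {β σ M : ℝ}
    (hσ : 1 / 2 ≤ σ) (hVm : AEStronglyMeasurable V (volume.restrict (Ioo a b)))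
    (hV : ∀ᵐ x ∂(volume.restrict (Ioo a b)), |V x| ≤ M) (hM : 0 ≤ M) {T : ℝ} (hT : 0 < T)
    {ψ₀ : ℝ → ℂ} {ψ : ℝ → L2 a b} {R A D : ℝ} (hR : 0 ≤ R) (hA : 0 ≤ A)
    (hreg : Regular a b T ψ R A D)
    (hψ₀ : ∀ᵐ x ∂(volume.restrict (Ioo a b)), ψ 0 x = ψ₀ x)
    (hsol : SolvesNLS a b V β σ T ψ) (hreg2 : ContDiffOn ℝ 2 ψ (Icc 0 T)) :
    ∃ h₀ > 0, ∃ C > 0, ∀ (τ : ℝ) (N : ℕ) (h : ℝ), 0 < N → Even N → h = (b - a) / N →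
      0 < τ → 2 * τ ≤ T → h < h₀ → τ ≤ h ^ 2 / (2 * Real.pi) → ∀ n : ℕ, n * τ ≤ T →
        ∑ l ∈ indexSet N,
          ‖fourierHat a b (ψ (n * τ)) l - schemeCoeff a b V β σ ψ₀ N τ n l‖ ^ 2 ≤
            (C * (τ ^ 2 + h ^ 4)) ^ 2 := by
  have hba := sub_pos.2 hab
  obtain ⟨K, hK, hLip, L, hL, hsec⟩ :=
    exists_norm_nonlin_sub_le (β := β) hab hσ hVm hV hM hR hA hreg
  have hRψ : ∀ s ∈ Icc 0 T, ∀ᵐ x ∂(volume.restrict (Ioo a b)), ‖ψ s x‖ ≤ R + 1 := fun s hs => by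
    filter_upwards [hreg.ae_le hab hs] with x hx
    linarith
  set s₀ := Real.sqrt (1 / (b - a)) with hs₀
  have hs₀0 : 0 ≤ s₀ := Real.sqrt_nonneg _
  have hs₀1 : s₀ * Real.sqrt (b - a) = 1 := by
    rw [hs₀, ← Real.sqrt_mul (by positivity), one_div, inv_mul_cancel₀ hba.ne', Real.sqrt_one]
  set L₁ := s₀ * (K * A) with hL₁
  set L₂ := s₀ * L with hL₂
  set d₀ := Real.sqrt D with hd₀
  have hL₁0 : 0 ≤ L₁ := by positivity
  have hL₂0 : 0 ≤ L₂ := by positivity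
  have hd₀0 : 0 ≤ d₀ := Real.sqrt_nonneg _
  -- The source in the recursion: 2K d₀ from the unresolved modes, 2K L₁ from passing between the
  -- error and the corrected error, 3L₂ from the local error. A₀ bounds the starting errors, and the
  -- L₁ in C below restores the corrector at the end.
  set B := 2 * K * (L₁ + d₀) + 3 * L₂ with hB
  set A₀ := T * (K * d₀) + 2 * L₁ + 1 with hA₀
  have hA₀1 : 1 ≤ A₀ := by
    have : 0 ≤ T * (K * d₀) + 2 * L₁ := by positivity
    linarith
  set C₁ := A₀ * Real.exp ((2 * K + B) * T) with hC₁
  have hC₁0 : 0 < C₁ := by positivity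
  set C := C₁ + L₁ with hC
  have hC0 : 0 < C := by positivity
  refine ⟨min 1 (1 / (4 * C ^ 2 * (b - a))), by positivity, C, hC0, ?_⟩
  intro τ N h hN hE hh hτ hτT hh₀ hτh
  have hN' : (0 : ℝ) < N := by exact_mod_cast hN
  have hh0 : 0 < h := by rw [hh]; positivity
  have hh1 : h ≤ 1 := hh₀.le.trans (min_le_left _ _)
  have hpi := Real.pi_gt_three
  have hτh2 : τ ≤ h ^ 2 := hτh.trans (div_le_self (by positivity) (by linarith))
  set δ := τ ^ 2 + h ^ 4 with hδ
  have hδ0 : 0 ≤ δ := by positivity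
  have hτδ : τ ^ 2 ≤ δ := by rw [hδ]; linarith [pow_pos hh0 4]
  have hhδ : h ^ 4 ≤ δ := by rw [hδ]; linarith [pow_pos hτ 2]
  have hδh : δ ≤ 2 * h ^ 4 := by
    have : τ ^ 2 ≤ (h ^ 2) ^ 2 := by gcongr
    rw [hδ]; linarith
  -- As τ ≤ h² gives δ ≤ 2h⁴ and Nh = b - a, the left side is at most 4C²(b - a)h⁷, hence at most
  -- 4C²(b - a)h; this dictates h₀.
  have hsmall : (N : ℝ) * (C * δ) ^ 2 ≤ 1 := by
    have h1 : (C * δ) ^ 2 ≤ (C * (2 * h ^ 4)) ^ 2 := by gcongr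
    have h2 : (N : ℝ) * h = b - a := by rw [hh]; field_simp
    have h3 : h * (4 * C ^ 2 * (b - a)) ≤ 1 := by
      rw [← le_div_iff₀ (by positivity)]
      exact hh₀.le.trans (min_le_right _ _)
    have h4 : h ^ 7 ≤ h := by
      simpa using pow_le_pow_of_le_one hh0.le hh1 (show 1 ≤ 7 by norm_num)
    calc (N : ℝ) * (C * δ) ^ 2 ≤ N * (C * (2 * h ^ 4)) ^ 2 := by gcongr
      _ = (N * h) * (4 * C ^ 2) * h ^ 7 := by ring
      _ ≤ (N * h) * (4 * C ^ 2) * h := by gcongr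
      _ = h * (4 * C ^ 2 * (b - a)) := by rw [h2]; ring
      _ ≤ 1 := h3
  set S := indexSet N with hS
  set κ : S → ℝ := fun l => freq a b l ^ 2 with hκ
  -- Extends g constantly outside [0, T], since the variation-of-constants lemmas ask for continuity
  -- on the whole line.
  set clamp : ℝ → ℝ := fun t => max 0 (min t T) with hclamp
  have hclm : ∀ t, clamp t ∈ Icc 0 T := fun t =>
    ⟨le_max_left _ _, max_le hT.le (min_le_right _ _)⟩
  have hcle : ∀ t ∈ Icc 0 T, clamp t = t := fun t ht => by
    simp only [hclamp]
    rw [min_eq_left ht.2, max_eq_right ht.1]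
  set p : ℝ → EuclideanSpace ℂ S := fun t => coeffVec hab S (ψ t) with hp
  set g : ℝ → EuclideanSpace ℂ S := fun t => coeffVec hab S (nonlin a b V β σ (ψ (clamp t)))
    with hg
  have hgL : ∀ s ∈ Icc 0 T, ∀ t ∈ Icc 0 T,
      ‖coeffVec hab S (nonlin a b V β σ (ψ t)) - coeffVec hab S (nonlin a b V β σ (ψ s))‖ ≤
        L₁ * |t - s| := by
    intro s hs t ht
    rw [← map_sub]
    refine (norm_coeffVec_le hab S _).trans ?_
    have h1 := hLip _ _ (hRψ t ht) (hRψ s hs)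
    have h2 := mul_le_mul_of_nonneg_left (hreg.norm_sub_le s hs t ht) hK
    rw [hL₁, mul_assoc]
    refine mul_le_mul_of_nonneg_left (h1.trans (h2.trans (le_of_eq ?_))) hs₀0
    ring
  have hgc : Continuous g := by
    have hco : ContinuousOn (fun t => coeffVec hab S (nonlin a b V β σ (ψ t))) (Icc 0 T) :=
      (LipschitzOnWith.of_dist_le_mul (K := ⟨L₁, hL₁0⟩) fun t ht s hs => by
        rw [dist_eq_norm, Real.dist_eq]; exact hgL s hs t ht).continuousOn
    exact hco.comp_continuous (by fun_prop) hclm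
  have hg1 : ∀ s ∈ Icc 0 T, ∀ t ∈ Icc 0 T, ‖g t - g s‖ ≤ L₁ * |t - s| := by
    intro s hs t ht
    simp only [hg, hcle s hs, hcle t ht]
    exact hgL s hs t ht
  have hg2 : ∀ t h k, 0 ≤ t → 0 ≤ h → 0 ≤ k → t + h + k ≤ T →
      ‖g (t + h + k) - g (t + h) - g (t + k) + g t‖ ≤ L₂ * (h * k) := by
    intro t h k ht hh hk hT'
    simp only [hg]
    rw [hcle t ⟨ht, by linarith⟩, hcle (t + h) ⟨by linarith, by linarith⟩,
      hcle (t + k) ⟨by linarith, by linarith⟩, hcle (t + h + k) ⟨by linarith, by linarith⟩,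
      ← map_sub, ← map_sub, ← map_add]
    refine (norm_coeffVec_le hab S _).trans ?_
    rw [hL₂, mul_assoc]
    exact mul_le_mul_of_nonneg_left (hsec t h k ht hh hk hT') hs₀0
  have hκ0 : ∀ l, 0 ≤ κ l := fun l => sq_nonneg _
  have hκτ : ∀ l, τ * κ l ≤ Real.pi / 2 := fun l => by
    have h1 := freq_sq_le_of_mem hab hN hE hh l.2
    have h2 : τ * κ l ≤ h ^ 2 / (2 * Real.pi) * (Real.pi / h) ^ 2 :=
      mul_le_mul hτh h1 (hκ0 l) (by positivity)
    refine h2.trans (le_of_eq ?_)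
    field_simp
  have hpc : ∀ l, ContinuousOn (fun t => p t l) (Icc 0 T) := fun l =>
    (fourierCLM hab l).continuous.comp_continuousOn hreg2.continuousOn
  have hpd : ∀ l, ∀ t ∈ Ioo 0 T,
      HasDerivAt (fun t => p t l) (-Complex.I * κ l * p t l - Complex.I * g t l) t := by
    intro l t ht
    have h1 := hasDerivAt_fourierHat_of_solvesNLS hab hσ hVm hV hsol hreg2 ht
      (hRψ t (Ioo_subset_Icc_self ht)) l
    refine h1.congr_deriv ?_
    simp only [hp, hg, hκ, coeffVec_apply, hcle t (Ioo_subset_Icc_self ht)]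
    push_cast
    ring
  obtain ⟨Q, hQ, hrec⟩ := exists_error_recursion hτ hτT hκ0 hκτ hgc hpc hpd hL₁0 hg1 hL₂0 hg2
  set c := schemeCoeff a b V β σ ψ₀ N τ with hc
  set q : ℕ → EuclideanSpace ℂ S := fun n => WithLp.toLp 2 fun l => c n l with hq
  set r : ℕ → EuclideanSpace ℂ S := fun n =>
    WithLp.toLp 2 fun l => fourierHat a b (opB V β σ (trigPoly a b N (c n))) l with hr
  have hq0 : q 0 = p 0 := by
    ext l
    exact (fourierHat_congr_ae hψ₀ l).symm
  have hq1 : ∀ l, q 1 l = Complex.exp (-Complex.I * (τ * κ l)) * q 0 l -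
      Complex.I * τ * phi1 (-Complex.I * (τ * κ l)) * r 0 l := by
    intro l
    have : ((κ l : ℝ) : ℂ) = (freq a b l : ℂ) ^ 2 := by simp only [hκ]; push_cast; rfl
    rw [this, ← mul_assoc]
    rfl
  have hq2 : ∀ n l, q (n + 2) l = Complex.exp (-2 * Complex.I * (τ * κ l)) * q n l -
      2 * Complex.I * τ * Complex.exp (-Complex.I * (τ * κ l)) * (Real.sinc (τ * κ l) : ℂ) *
        r (n + 1) l := by
    intro n l
    have : ((κ l : ℝ) : ℂ) = (freq a b l : ℂ) ^ 2 := by simp only [hκ]; push_cast; rfl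
    rw [this, ← mul_assoc, ← mul_assoc]
    rfl
  obtain ⟨hstart, hstep⟩ := hrec q r hq0 hq1 hq2
  have hsum : ∀ n : ℕ, ∑ l ∈ S, ‖fourierHat a b (ψ (n * τ)) l - c n l‖ ^ 2 =
      ‖p (n * τ) - q n‖ ^ 2 := fun n =>
    sum_sq_eq_norm_sq (fun l => fourierHat a b (ψ (n * τ)) l - c n l) fun l => rfl
  -- Nonlinear stability, conditional on the error bound: Cδ is small enough for the numerical
  -- solution to stay in the ball of radius R + 1 where B is Lipschitz. The factors (b - a)^{±1/2}
  -- of Parseval's identity cancel.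
  have hnl : ∀ n : ℕ, n * τ ≤ T → ‖p (n * τ) - q n‖ ≤ C * δ →
      ‖g (n * τ) - r n‖ ≤ K * (d₀ * h ^ 4 + ‖p (n * τ) - q n‖) := by
    intro n hn hle
    have hmem : (n : ℝ) * τ ∈ Icc 0 T := ⟨by positivity, hn⟩
    have hR' := ae_norm_trigL2_le (a := a) (b := b) (hreg.sum_norm_coeff_le hE hmem (c n)
      (hsum n).le
      ((mul_le_mul_of_nonneg_left (pow_le_pow_left₀ (norm_nonneg _) hle 2) hN'.le).trans hsmall))
    have hrn : r n = coeffVec hab S (nonlin a b V β σ (trigL2 a b N (c n))) := by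
      ext l
      exact fourierHat_opB_trigPoly hσ hVm hV hR' l
    have h1 := hreg.norm_sub_trigL2_le hab hN hE hh hmem (c n) (norm_nonneg _) (hsum n).le
    have h2 := hLip _ _ (hRψ _ hmem) hR'
    have h3 := norm_coeffVec_le hab S
      (nonlin a b V β σ (ψ (n * τ)) - nonlin a b V β σ (trigL2 a b N (c n)))
    rw [hrn]
    simp only [hg]
    rw [hcle _ hmem, ← map_sub]
    calc _ ≤ s₀ * (K * (Real.sqrt (b - a) * (d₀ * h ^ 4 + ‖p (n * τ) - q n‖))) :=
          h3.trans (mul_le_mul_of_nonneg_left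
            (h2.trans (mul_le_mul_of_nonneg_left h1 hK)) hs₀0)
      _ = (s₀ * Real.sqrt (b - a)) * (K * (d₀ * h ^ 4 + ‖p (n * τ) - q n‖)) := by ring
      _ = _ := by rw [hs₀1, one_mul]
  set d : ℕ → ℝ := fun n => ‖p (n * τ) - q n - Q n‖ with hd
  have hQδ : ∀ n, ‖Q n‖ ≤ L₁ * δ := fun n =>
    (hQ n).trans (mul_le_mul_of_nonneg_left hτδ hL₁0)
  have hed : ∀ n : ℕ, ‖p (n * τ) - q n‖ ≤ d n + L₁ * δ := fun n => by
    have := norm_add_le (p (n * τ) - q n - Q n) (Q n)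
    rw [sub_add_cancel] at this
    exact this.trans (add_le_add_right (hQδ n) _)
  have hT0 : 0 ≤ T * (K * d₀) * δ := by positivity
  have hL1δ : 0 ≤ L₁ * δ := by positivity
  have hd0 : d 0 ≤ A₀ * δ := by
    simp only [hd]
    rw [Nat.cast_zero, zero_mul, hq0, sub_self, zero_sub, norm_neg, hA₀]
    have := hQδ 0
    linarith
  have hd1 : d 1 ≤ A₀ * δ := by
    have h1 := hnl 0 (by simpa using hT.le) (by simp [hq0]; positivity)
    simp only [Nat.cast_zero, zero_mul, hq0, sub_self, norm_zero, add_zero] at h1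
    have h2 := mul_le_mul_of_nonneg_left h1 hτ.le
    have h3 : τ * (K * (d₀ * h ^ 4)) ≤ T * (K * (d₀ * δ)) := by
      gcongr
      linarith
    have h4 : L₁ * τ ^ 2 ≤ L₁ * δ := mul_le_mul_of_nonneg_left hτδ hL₁0
    have h5 : d 1 ≤ ‖p τ - q 1‖ + ‖Q 1‖ := by
      simp only [hd, Nat.cast_one, one_mul]
      exact _root_.norm_sub_le _ _
    have h6 := hQδ 1
    rw [hA₀]
    linarith
  -- The conditional hypothesis of the Gronwall lemma bounds d (n+1) by C₁δ; adding the corrector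
  -- gives exactly the bound Cδ that the stability estimate requires.
  have hgron := two_step_gronwall (d := d) (A := A₀) (c := 2 * K) (B := B) (δ := δ) (T := T) hτ.le
    hδ0 (by positivity) (by positivity) hA₀1 hd0 hd1 (fun n hn hle => by
      have hn1 : ((n + 1 : ℕ) : ℝ) * τ ≤ T := by push_cast; linarith
      have e1 := hed (n + 1)
      have hle' : ‖p ((n + 1 : ℕ) * τ) - q (n + 1)‖ ≤ C * δ := by
        refine e1.trans ?_
        rw [hC, hC₁]
        linarith
      have h1 := hnl (n + 1) hn1 hle'
      have h2 := hstep n hn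
      have c1 : ((n + 1 : ℕ) : ℝ) = n + 1 := by push_cast; rfl
      have c2 : ((n + 2 : ℕ) : ℝ) = n + 2 := by push_cast; rfl
      have h3 : d (n + 2) ≤ d n + 2 * τ * ‖g ((n + 1) * τ) - r (n + 1)‖ + 3 * L₂ * τ ^ 3 := by
        simp only [hd, c2]
        exact h2
      rw [c1] at h1 e1
      have h4 : ‖g ((n + 1) * τ) - r (n + 1)‖ ≤ K * (d₀ * δ + (d (n + 1) + L₁ * δ)) := by
        refine h1.trans (mul_le_mul_of_nonneg_left (add_le_add ?_ e1) hK)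
        exact mul_le_mul_of_nonneg_left hhδ hd₀0
      have h5 := mul_le_mul_of_nonneg_left h4 (show 0 ≤ 2 * τ by positivity)
      have h6 : 3 * L₂ * τ ^ 3 ≤ 3 * L₂ * (τ * δ) := by
        have : τ ^ 3 ≤ τ * δ := by
          rw [show τ ^ 3 = τ * τ ^ 2 by ring]
          exact mul_le_mul_of_nonneg_left hτδ hτ.le
        gcongr
      refine h3.trans ?_
      rw [hB]
      linarith)
  intro n hn
  rw [hsum]
  refine pow_le_pow_left₀ (norm_nonneg _) ?_ 2
  refine (hed n).trans ?_
  have := hgron n hn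
  rw [hC, hC₁]
  linarith

end SEWI

end

/-! ### From coefficient errors to the L² and H¹ bounds. -/

theorem theorem4p3 (a b : ℝ) (hab : a < b) (V : ℝ → ℝ) (β σ : ℝ) (hσ : 1 / 2 ≤ σ)
    (hV : ∃ v ∈ SEWI.SobolevPer a b 2,
      ∀ᵐ x ∂(volume.restrict (Ioo a b)), (v 0 : SEWI.L2 a b) x = (V x : ℂ))
    (T : ℝ) (hT : 0 < T) (ψ₀ : ℝ → ℂ) (ψ : ℝ → SEWI.L2 a b)
    (hψ₀ : ∀ᵐ x ∂(volume.restrict (Ioo a b)), (ψ 0 : SEWI.L2 a b) x = ψ₀ x)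
    (hsol : SEWI.SolvesNLS a b V β σ T ψ)
    (hreg0 : SEWI.MemCk 0 T (SEWI.SobolevPer a b 4) ψ)
    (hreg1 : SEWI.MemCk 1 T (SEWI.Sobolev a b 2) ψ)
    (hreg2 : ContDiffOn ℝ 2 ψ (Icc 0 T)) :
    ∃ τ₀ > (0 : ℝ), ∃ h₀ > (0 : ℝ), ∃ C > (0 : ℝ),
      ∀ (τ : ℝ) (N : ℕ) (h : ℝ), 0 < N → Even N → h = (b - a) / N →
        0 < τ → τ < τ₀ → h < h₀ → τ ≤ h ^ 2 / (2 * Real.pi) →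
        ∀ n : ℕ, (n : ℝ) ≤ T / τ →
          ‖ψ (n * τ) - SEWI.schemeSol a b V β σ ψ₀ N τ n‖ ≤ C * (τ ^ 2 + h ^ 4) ∧
          SEWI.SobolevNormLE 1 (ψ (n * τ) - SEWI.schemeSol a b V β σ ψ₀ N τ n)
            (C * (τ ^ (3 / 2 : ℝ) + h ^ 3)) := by
  open SEWI in
  obtain ⟨hVm, M, hM, hVM⟩ := exists_bound_of_sobolevPer hV
  obtain ⟨R, hR, A, hA, D, hD, hreg⟩ := exists_regular hab hT hreg0 hreg1 hreg2
  obtain ⟨h₀, hh₀, C, hC, herr⟩ := exists_coeff_error_le hab hσ hVm hVM hM hT hR.le hA.le hreg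
    hψ₀ hsol hreg2
  have hba := sub_pos.2 hab
  have hpi := Real.pi_gt_three
  set s := Real.sqrt (b - a) with hs
  have hs0 : 0 < s := Real.sqrt_pos.2 hba
  set d₀ := Real.sqrt D with hd₀
  have hd₀0 : 0 < d₀ := Real.sqrt_pos.2 hD
  -- The bound T/2 leaves room for one full two-step interval in [0, T]. The constant is the sum of
  -- those for the function and for its derivative, as the H¹ norm is bounded by the sum of the two
  -- L² norms.
  refine ⟨min 1 (T / 2), by positivity, min h₀ 1, by positivity,
    s * (d₀ + C) + s * (d₀ + Real.pi * C), by positivity, ?_⟩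
  intro τ N h hN hE hh hτ hττ₀ hhh₀ hτh n hn
  have hN' : (0 : ℝ) < N := by exact_mod_cast hN
  have hh0 : 0 < h := by rw [hh]; positivity
  have hh1 : h ≤ 1 := hhh₀.le.trans (min_le_right _ _)
  have hτ1 : τ ≤ 1 := hττ₀.le.trans (min_le_left _ _)
  have hτT : 2 * τ ≤ T := by linarith [hττ₀.le.trans (min_le_right 1 (T / 2))]
  have hnT : n * τ ≤ T := (le_div_iff₀ hτ).1 hn
  have hmem : (n : ℝ) * τ ∈ Icc 0 T := ⟨by positivity, hnT⟩
  have hτh2 : τ ≤ h ^ 2 := hτh.trans (div_le_self (by positivity) (by linarith))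
  have he := herr τ N h hN hE hh hτ hτT (hhh₀.trans_le (min_le_left _ _)) hτh n hnT
  set c := schemeCoeff a b V β σ ψ₀ N τ n with hc
  set e := C * (τ ^ 2 + h ^ 4) with hedef
  have he0 : 0 ≤ e := by positivity
  change ‖ψ (n * τ) - trigL2 a b N c‖ ≤ _ ∧ SobolevNormLE 1 (ψ (n * τ) - trigL2 a b N c) _
  have hL2 := hreg.norm_sub_trigL2_le hab hN hE hh hmem c he0 he
  obtain ⟨v, hv, hvhat⟩ := hreg.weakDeriv _ hmem
  have hH1 := hreg.norm_deriv_sub_trigL2_le hab hN hE hh hmem hvhat c he0 he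
  have hL2' : ‖ψ (n * τ) - trigL2 a b N c‖ ≤ s * (d₀ + C) * (τ ^ 2 + h ^ 4) := by
    refine hL2.trans ?_
    have : d₀ * h ^ 4 ≤ d₀ * (τ ^ 2 + h ^ 4) := by
      gcongr
      linarith [pow_pos hτ 2]
    rw [mul_assoc]
    refine mul_le_mul_of_nonneg_left ?_ hs0.le
    rw [hedef]
    linarith
  refine ⟨hL2'.trans ?_, ?_⟩
  · gcongr
    have : 0 < s * (d₀ + Real.pi * C) := by positivity
    linarith
  · set ρ := τ ^ (3 / 2 : ℝ) with hρ
    have hρ0 : 0 < ρ := Real.rpow_pos_of_pos hτ _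
    -- Half a power of τ is traded for one power of h, which cancels the 1/h of the inverse
    -- inequality; this is why the H¹ rate is τ^{3/2}.
    have hτρ : τ ^ 2 = ρ * Real.sqrt τ := by
      rw [hρ, Real.sqrt_eq_rpow, ← Real.rpow_add hτ, ← Real.rpow_natCast]
      norm_num
    have hsq : Real.sqrt τ ≤ h := by
      rw [← Real.sqrt_sq hh0.le]
      exact Real.sqrt_le_sqrt hτh2
    have hτρh : τ ^ 2 ≤ ρ * h := by
      rw [hτρ]
      exact mul_le_mul_of_nonneg_left hsq hρ0.le
    have k1 : τ ^ 2 + h ^ 4 ≤ ρ + h ^ 3 := by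
      have h1 : ρ * h ≤ ρ := mul_le_of_le_one_right hρ0.le hh1
      have h2 : h ^ 3 * h ≤ h ^ 3 := mul_le_of_le_one_right (by positivity) hh1
      have h3 : h ^ 3 * h = h ^ 4 := by ring
      linarith
    have k2 : Real.pi / h * e ≤ Real.pi * C * (ρ + h ^ 3) := by
      rw [hedef, div_mul_eq_mul_div, div_le_iff₀ hh0]
      have h3 : τ ^ 2 + h ^ 4 ≤ (ρ + h ^ 3) * h := by
        have h3 : h ^ 3 * h = h ^ 4 := by ring
        linarith
      have h4 := mul_le_mul_of_nonneg_left h3 (show 0 ≤ Real.pi * C by positivity)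
      linarith
    have hH1' : ‖v - trigL2 a b N (fun l => Complex.I * freq a b l * c l)‖ ≤
        s * (d₀ + Real.pi * C) * (ρ + h ^ 3) := by
      refine hH1.trans ?_
      rw [mul_assoc]
      refine mul_le_mul_of_nonneg_left ?_ hs0.le
      have : d₀ * h ^ 3 ≤ d₀ * (ρ + h ^ 3) := by
        gcongr
        linarith
      linarith
    have hw : IsWeakDeriv a b (ψ (n * τ) - trigL2 a b N c)
        (v - trigL2 a b N (fun l => Complex.I * freq a b l * c l)) := by
      have := hv.add ((isWeakDeriv_trigL2 hab N c).smul (-1))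
      rwa [neg_one_smul, neg_one_smul, ← sub_eq_add_neg, ← sub_eq_add_neg] at this
    set u₀ := ψ (n * τ) - trigL2 a b N c
    set u₁ := v - trigL2 a b N (fun l => Complex.I * freq a b l * c l)
    have hmemS : (WithLp.toLp 2 ![u₀, u₁] : Jet a b 1) ∈ Sobolev a b 1 := by
      intro k
      fin_cases k
      exact hw
    refine ⟨⟨WithLp.toLp 2 ![u₀, u₁], hmemS⟩, rfl, ?_⟩
    have hnorm : ‖(WithLp.toLp 2 ![u₀, u₁] : Jet a b 1)‖ ≤ ‖u₀‖ + ‖u₁‖ := by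
      rw [PiLp.norm_eq_of_L2]
      refine (Real.sqrt_le_left (by positivity)).2 ?_
      have hsum2 : ∑ i : Fin (1 + 1), ‖(WithLp.toLp 2 ![u₀, u₁] : Jet a b 1) i‖ ^ 2 =
          ‖u₀‖ ^ 2 + ‖u₁‖ ^ 2 := Fin.sum_univ_two _
      rw [hsum2]
      nlinarith [mul_nonneg (norm_nonneg u₀) (norm_nonneg u₁)]
    refine hnorm.trans ?_
    have h5 := mul_le_mul_of_nonneg_left k1 (show 0 ≤ s * (d₀ + C) by positivity)
    linarith
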